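/- Let $M$ be a smooth oriented 3-manifold without boundary (for instance the complement of a knot $K'$ in $\mathbb R^3$), let $\alpha\in H^1(M;\mathbb Z_2)$ (for instance the linking number with $K'$ modulo 2), and let $F$ be a field. A (singular) knot $K$ in $M$ is called even if $\alpha([K])=0$. Here a singular knot with $n$ double points is a smooth immersion $K\colon S^1\to M$ that is injective except for $n$ transverse double points. Its chord diagram consists of the oriented circle $S^1$ and $n$ chords, each joining the two preimages of a double point. If $K$ is even, a double point divides $K$ into two closed curves on which $\alpha$ takes the same value; this value in $\mathbb Z_2$ is the framing (parity) of the chord. So $K$ has a framed chord diagram $D(K)$, considered up to isomorphism. An $F$-valued invariant $v$ of oriented knots in $M$ up to smooth isotopy is extended to singular knots by $v(K)=\sum_{\varepsilon}\varepsilon_1\cdots\varepsilon_n\,v(K_\varepsilon)$, where $\varepsilon$ runs over $\{\pm1\}^n$ and the $i$-th double point is replaced in $K_\varepsilon$ by a positive crossing if $\varepsilon_i=1$ and by a negative crossing if $\varepsilon_i=-1$. It is a Vassiliev invariant of order at most $n$ if it vanishes on all singular knots with more than $n$ double points. It is good if, moreover, its value on an even singular knot $K$ with $n$ double points depends only on $D(K)$.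 The symbol of a good $v$ is then the function $W$ on framed chord diagrams with $n$ chords with $W(D(K))=v(K)$ for every even $K$ with $n$ double points, and $W(D)=0$ if $D$ is not the diagram of any such $K$; it is extended linearly to the vector space over $F$ generated by the framed chord diagrams with $n$ chords. Then the symbol $W$ of every good Vassiliev invariant $v$ of order at most $n$ is a framed weight system and satisfies the 1T-relation: (1) (framed 4T-relations) Take three places on the oriented circle, a chord $p$ with framing $e$ joining two of them, and $n-2$ further chords with ends away from the three places. Let $D_1,D_2,D_3,D_4$ be obtained by adding a chord $q$ with one end at the third place and the other end immediately after, respectively immediately before, the first end of $p$ ($D_1$, $D_2$), or immediately after, respectively immediately before, the second end of $p$ ($D_3$, $D_4$), where $q$ has framing $f$ in $D_1$, $D_2$ and framing $e+f$ in $D_3$, $D_4$, and all other framings agree. Then $W(D_1)-W(D_2)+W(D_3)-W(D_4)=0$. (2) (1T-relation) $W(D)=0$ if $D$ has a chord of framing $0$ whose two ends are adjacent along the circle. (3) Correspondingly, $W^*(D)=(-1)^{\mathrm{odd}(D)}W(D)$, where $\mathrm{odd}(D)$ is the number of chords of framing $1$, satisfies the other version of the framed 4T-relations: $W^*(D_1)-W^*(D_2)+(-1)^e\bigl(W^*(D_3)-W^*(D_4)\bigr)=0$.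 -/

import Mathlib

open scoped Manifold ContDiff unitInterval

noncomputable section

/-! ### Framed chord diagrams -/

/-- A framed arc diagram with `n` labelled arcs: reading the line along its orientation one meets
the `2 * n` endpoints of the arcs, `word` lists the labels met, so that every label occurs
exactly twice; every arc carries a framing in `ℤ/2`. -/
structure FramedArcDiagram (n : ℕ) where
  word : List (Fin n)
  count_word : ∀ c, word.count c = 2
  framing : Fin n → ZMod 2

/-- Two framed arc diagrams close up to the same framed chord diagram if they agree up to
a rotation of the oriented circle and a relabelling of the chords. -/
def FramedArcDiagram.SameClosure {n : ℕ} (D D' : FramedArcDiagram n) : Prop :=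
  ∃ π : Equiv.Perm (Fin n), (D.word.map π).IsRotated D'.word ∧
    ∀ c, D'.framing (π c) = D.framing c

instance FramedArcDiagram.setoid (n : ℕ) : Setoid (FramedArcDiagram n) where
  r := FramedArcDiagram.SameClosure
  iseqv :=
    { refl := fun D => ⟨1, by simp [List.IsRotated.refl], by simp⟩
      symm := by
        rintro D D' ⟨π, h, hf⟩
        refine ⟨π⁻¹, ?_, fun c => ?_⟩
        · have h2 := (h.map (π⁻¹ : Equiv.Perm (Fin n))).symm
          simpa [List.map_map, Function.comp_def] using h2
        · have := hf (π⁻¹ c)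
          simpa using this.symm
      trans := by
        rintro D D' D'' ⟨π, h, hf⟩ ⟨ρ, h', hf'⟩
        refine ⟨ρ * π, ?_, fun c => ?_⟩
        · have h2 := (h.map ρ).trans h'
          simpa [List.map_map, Function.comp_def] using h2
        · simp [hf', hf] }

/-- Chord diagrams with `n` chords and a `ℤ/2`-framing: an oriented circle with `2 * n` points
on it, joined in pairs by framed chords, up to isomorphism. -/
def FramedChordDiagram (n : ℕ) : Type := Quotient (FramedArcDiagram.setoid n)

/-- The closure of a framed arc diagram. -/
def FramedArcDiagram.closure {n : ℕ} (D : FramedArcDiagram n) : FramedChordDiagram n :=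
  Quotient.mk (FramedArcDiagram.setoid n) D

/-- The number of odd chords (chords of framing `1`). -/
def FramedChordDiagram.oddCount {n : ℕ} : FramedChordDiagram n → ℕ :=
  Quotient.lift (fun D : FramedArcDiagram n => (Finset.univ.filter (D.framing · = 1)).card) (by
    rintro D D' ⟨π, -, hf⟩
    refine Finset.card_bij (fun c _ => π c) ?_ ?_ ?_
    · intro c hc
      simpa [hf] using hc
    · intro c _ c' _ h
      exact π.injective h
    · intro c hc
      refine ⟨π⁻¹ c, ?_, by simp⟩
      have := hf (π⁻¹ c)
      simp at this hc ⊢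
      rw [← this, hc])

/-- The configuration of the framed four-term relation. There are three places on the circle, one
of which is taken as the beginning of the word. A fixed chord `p` joins the other two places. One
end of the moving chord `q` is at the first place, the other end is
immediately after (`D₁`) or before (`D₂`) the first end of `p`, or
immediately after (`D₃`) or before (`D₄`) the second end of `p`.
All other chords are the same in the four diagrams. The framing of `q` changes by that of `p`
when its end passes from one end of `p` to the other; all other framings are the same. -/
def IsFourTermConfiguration {n : ℕ} (p q : Fin n) (D₁ D₂ D₃ D₄ : FramedArcDiagram n) : Prop :=
  (∃ X Y Z : List (Fin n),
    D₁.word = [q] ++ X ++ [p, q] ++ Y ++ [p] ++ Z ∧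
    D₂.word = [q] ++ X ++ [q, p] ++ Y ++ [p] ++ Z ∧
    D₃.word = [q] ++ X ++ [p] ++ Y ++ [p, q] ++ Z ∧
    D₄.word = [q] ++ X ++ [p] ++ Y ++ [q, p] ++ Z) ∧
  D₂.framing = D₁.framing ∧
  D₃.framing = Function.update D₁.framing q (D₁.framing p + D₁.framing q) ∧
  D₄.framing = D₃.framing

/-- The framed four-term relations `D₁ - D₂ + D₃ - D₄`, as elements of the space
generated by framed chord diagrams. -/
def framedFourTermRelations (F : Type*) [Field F] (n : ℕ) : Set (FramedChordDiagram n →₀ F) :=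
  {r | ∃ (p q : Fin n) (D₁ D₂ D₃ D₄ : FramedArcDiagram n),
    IsFourTermConfiguration p q D₁ D₂ D₃ D₄ ∧
    r = Finsupp.single D₁.closure 1 - Finsupp.single D₂.closure 1
      + (Finsupp.single D₃.closure 1 - Finsupp.single D₄.closure 1)}

/-- The other version of the framed four-term relations: the sign is reversed when
the fixed chord is odd. -/
def framedFourTermRelationsStar (F : Type*) [Field F] (n : ℕ) : Set (FramedChordDiagram n →₀ F) :=
  {r | ∃ (p q : Fin n) (D₁ D₂ D₃ D₄ : FramedArcDiagram n),
    IsFourTermConfiguration p q D₁ D₂ D₃ D₄ ∧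
    r = Finsupp.single D₁.closure 1 - Finsupp.single D₂.closure 1
      + (if D₁.framing p = 0 then (1 : F) else -1) •
        (Finsupp.single D₃.closure 1 - Finsupp.single D₄.closure 1)}

/-- The one-term relations: a framed chord diagram with a solitary chord of framing `0`
(its ends are adjacent along the circle) is zero. -/
def oneTermRelations (F : Type*) [Field F] (n : ℕ) : Set (FramedChordDiagram n →₀ F) :=
  {r | ∃ (D : FramedArcDiagram n) (p : Fin n) (X : List (Fin n)),
    D.word = [p, p] ++ X ∧ D.framing p = 0 ∧ r = Finsupp.single D.closure 1}

/-- A framed weight system: a linear function on the space generated by framed chord diagrams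
that satisfies the framed four-term relations. -/
def IsFramedWeightSystem {F : Type*} [Field F] {n : ℕ}
    (w : (FramedChordDiagram n →₀ F) →ₗ[F] F) : Prop :=
  ∀ r ∈ framedFourTermRelations F n, w r = 0

/-- The same for the other version of the framed four-term relations. -/
def IsFramedWeightSystemStar {F : Type*} [Field F] {n : ℕ}
    (w : (FramedChordDiagram n →₀ F) →ₗ[F] F) : Prop :=
  ∀ r ∈ framedFourTermRelationsStar F n, w r = 0

/-- The one-term relation for a linear function on the space generated by
framed chord diagrams. -/
def SatisfiesOneTerm {F : Type*} [Field F] {n : ℕ}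
    (w : (FramedChordDiagram n →₀ F) →ₗ[F] F) : Prop :=
  ∀ r ∈ oneTermRelations F n, w r = 0

/-! ### Cohomology classes modulo 2 -/

/-- The standard 2-simplex, with vertices `(0, 0)`, `(0, 1)`, `(1, 1)`. -/
abbrev Triangle : Type := {p : I × I // p.1 ≤ p.2}

/-- The edge from `(0, 0)` to `(0, 1)`. -/
def Triangle.edge₀₁ : C(I, Triangle) := ⟨fun r => ⟨(0, r), r.2.1⟩, by fun_prop⟩

/-- The edge from `(0, 1)` to `(1, 1)`. -/
def Triangle.edge₁₂ : C(I, Triangle) := ⟨fun r => ⟨(r, 1), r.2.2⟩, by fun_prop⟩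

/-- The edge from `(0, 0)` to `(1, 1)`. -/
def Triangle.edge₀₂ : C(I, Triangle) := ⟨fun r => ⟨(r, r), le_refl r⟩, by fun_prop⟩

/-- A singular 1-cocycle with coefficients in `ℤ/2`: a function on singular 1-simplices
whose sum over the boundary of every singular 2-simplex is zero. Its values on
closed paths depend only on its class in `H¹(M; ℤ/2)`. -/
structure ModTwoCocycle (M : Type*) [TopologicalSpace M] where
  toFun : C(I, M) → ZMod 2
  cocycle : ∀ τ : C(Triangle, M), toFun (τ.comp Triangle.edge₀₁) + toFun (τ.comp Triangle.edge₁₂)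
    + toFun (τ.comp Triangle.edge₀₂) = 0

/-- The value of a cocycle on the path run through by `γ` from time `s` to time `t`. -/
def ModTwoCocycle.onArc {M : Type*} [TopologicalSpace M] (α : ModTwoCocycle M) (γ : C(ℝ, M))
    (s t : ℝ) : ZMod 2 :=
  α.toFun ⟨fun r => γ (s + r * (t - s)), by fun_prop⟩

/-! ### Knots and singular knots in an oriented 3-manifold -/

/-- An orientation of a smooth 3-manifold: `sign x` says whether the preferred chart at `x`
preserves the orientation at `x`. The condition is that the orientation is locally constant: near
`x`, the orientation of the tangent spaces is the one that the chart at `x` carries over. -/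
structure ManifoldOrientation (M : Type*) [TopologicalSpace M]
    [ChartedSpace (EuclideanSpace ℝ (Fin 3)) M] where
  sign : M → ℤˣ
  locally_constant : ∀ x, ∀ᶠ y in nhds x,
    0 < (((sign x * sign y : ℤˣ) : ℤ) : ℝ) *
      (fderiv ℝ (chartAt (EuclideanSpace ℝ (Fin 3)) y ∘ (chartAt (EuclideanSpace ℝ (Fin 3)) x).symm)
        (chartAt (EuclideanSpace ℝ (Fin 3)) x y)).det

section Knots

variable {M : Type*} [TopologicalSpace M] [ChartedSpace (EuclideanSpace ℝ (Fin 3)) M]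

/-- The velocity of a curve; the tangent space at `γ t` is identified with `ℝ³` by
the preferred chart at `γ t`, as everywhere in Mathlib. -/
def velocity (γ : ℝ → M) (t : ℝ) : EuclideanSpace ℝ (Fin 3) :=
  mfderiv 𝓘(ℝ, ℝ) (𝓡 3) γ t (1 : ℝ)

/-- Three tangent vectors at `x` form a positive basis. -/
def ManifoldOrientation.IsPositive (o : ManifoldOrientation M) (x : M)
    (e₁ e₂ e₃ : EuclideanSpace ℝ (Fin 3)) : Prop :=
  0 < ((o.sign x : ℤ) : ℝ) * (Matrix.of ![e₁.ofLp, e₂.ofLp, e₃.ofLp]).det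

variable (M) in
/-- An oriented smooth knot: a smooth embedding of the circle `ℝ/ℤ`, written as
a periodic function. -/
structure Knot where
  toFun : ℝ → M
  smooth : ContMDiff 𝓘(ℝ, ℝ) (𝓡 3) ∞ toFun
  periodic : ∀ t, toFun (t + 1) = toFun t
  immersion : ∀ t, velocity toFun t ≠ 0
  injective : Set.InjOn toFun (Set.Ico 0 1)

/-- Smooth isotopy of knots. -/
def Knot.IsIsotopic (K K' : Knot M) : Prop :=
  ∃ H : ℝ → ℝ → M, ContMDiff 𝓘(ℝ, ℝ × ℝ) (𝓡 3) ∞ (Function.uncurry H) ∧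
    H 0 = K.toFun ∧ H 1 = K'.toFun ∧
    ∀ s ∈ Set.Icc (0 : ℝ) 1, ∃ L : Knot M, L.toFun = H s

variable (M) in
/-- A singular knot with `n` double points: a smooth immersion of the circle `ℝ/ℤ`
that is injective but for `n` transverse double points. The double point `c` is passed at the
times `fst c < snd c`. -/
structure SingularKnot (n : ℕ) where
  toFun : ℝ → M
  smooth : ContMDiff 𝓘(ℝ, ℝ) (𝓡 3) ∞ toFun
  periodic : ∀ t, toFun (t + 1) = toFun t
  immersion : ∀ t, velocity toFun t ≠ 0
  fst : Fin n → ℝ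
  snd : Fin n → ℝ
  fst_nonneg : ∀ c, 0 ≤ fst c
  fst_lt_snd : ∀ c, fst c < snd c
  snd_lt_one : ∀ c, snd c < 1
  times_injective : Function.Injective (Sum.elim fst snd)
  double_points : ∀ s ∈ Set.Ico (0 : ℝ) 1, ∀ t ∈ Set.Ico (0 : ℝ) 1,
    (toFun s = toFun t ↔
      s = t ∨ ∃ c, (s = fst c ∧ t = snd c) ∨ (s = snd c ∧ t = fst c))
  transverse : ∀ c, LinearIndependent ℝ ![velocity toFun (fst c), velocity toFun (snd c)]

namespace SingularKnot

variable {n : ℕ}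

/-- The underlying continuous map. -/
def toContinuousMap (K : SingularKnot M n) : C(ℝ, M) := ⟨K.toFun, K.smooth.continuous⟩

/-- The class `α` vanishes on the knot. -/
def IsEven (α : ModTwoCocycle M) (K : SingularKnot M n) : Prop :=
  α.onArc K.toContinuousMap 0 1 = 0

/-- The double points in the order in which they are passed. -/
def word (K : SingularKnot M n) : List (Fin n) :=
  open Classical in
  ((Finset.univ : Finset (Fin n ⊕ Fin n)).toList.mergeSort
    (fun x y => decide (Sum.elim K.fst K.snd x ≤ Sum.elim K.fst K.snd y))).map (Sum.elim id id)

theorem count_word (K : SingularKnot M n) (c : Fin n) : K.word.count c = 2 := by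
  classical
  unfold word
  rw [((List.mergeSort_perm _ _).map _).count_eq, ← Multiset.coe_count, ← Multiset.map_coe,
    Finset.coe_toList, Multiset.count_map]
  have : ((Finset.univ : Finset (Fin n ⊕ Fin n)).filter
      (fun x => c = Sum.elim id id x)) = {Sum.inl c, Sum.inr c} := by
    ext x
    rcases x with x | x <;> simp [eq_comm]
  change (((Finset.univ : Finset (Fin n ⊕ Fin n)).filter
      (fun x => c = Sum.elim id id x))).card = 2
  rw [this]
  simp

/-- The arc diagram of a singular knot, cut at time `0`: an arc joins the two preimages of a double
point; its framing is the value of `α` on one of the two closed curves into which the double point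
divides the knot (the two values agree if the knot is even). -/
def framedArcDiagram (α : ModTwoCocycle M) (K : SingularKnot M n) : FramedArcDiagram n where
  word := K.word
  count_word := K.count_word
  framing c := α.onArc K.toContinuousMap (K.fst c) (K.snd c)

/-- The framed chord diagram of a singular knot. -/
def framedChordDiagram (α : ModTwoCocycle M) (K : SingularKnot M n) : FramedChordDiagram n :=
  (K.framedArcDiagram α).closure

/-- A resolution of the double points of `K`: a smooth family of curves, indexed by the cube
`[-1, 1]ⁿ`, in which the double point `c` persists exactly as long as the coordinate `u c` is zero,
and the crossing is positive for `u c > 0` and negative for `u c < 0`: with growing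
`u c` the branches move apart so that the velocities of the first and the second branch together
with the relative displacement of the first from the second form a positive basis. (This
does not depend on the order of the two branches.) -/
structure Resolution (o : ManifoldOrientation M) (K : SingularKnot M n) where
  family : (Fin n → ℝ) → ℝ → M
  smooth : ContMDiff 𝓘(ℝ, (Fin n → ℝ) × ℝ) (𝓡 3) ∞ (Function.uncurry family)
  family_zero : family 0 = K.toFun
  periodic : ∀ u t, family u (t + 1) = family u t
  immersion : ∀ u ∈ Set.Icc (-1 : Fin n → ℝ) 1, ∀ t, velocity (family u) t ≠ 0
  double_points : ∀ u ∈ Set.Icc (-1 : Fin n → ℝ) 1,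
    ∀ s ∈ Set.Ico (0 : ℝ) 1, ∀ t ∈ Set.Ico (0 : ℝ) 1,
      (family u s = family u t ↔ s = t ∨
        ∃ c, u c = 0 ∧ ((s = K.fst c ∧ t = K.snd c) ∨ (s = K.snd c ∧ t = K.fst c)))
  positive : ∀ u ∈ Set.Icc (-1 : Fin n → ℝ) 1, ∀ c, u c = 0 →
    o.IsPositive (family u (K.fst c))
      (velocity (family u) (K.fst c))
      (velocity (family u) (K.snd c))
      (velocity (fun x => family (Function.update u c x) (K.fst c)) 0
        - velocity (fun x => family (Function.update u c x) (K.snd c)) 0)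

/-- The knot in which the crossing `c` is positive if `ε c = 1` and negative
if `ε c = -1`. -/
def Resolution.vertex {o : ManifoldOrientation M} {K : SingularKnot M n} (R : Resolution o K)
    (ε : Fin n → ℤˣ) : Knot M where
  toFun := R.family (fun c => ((ε c : ℤ) : ℝ))
  smooth := R.smooth.comp (contMDiff_iff_contDiff.2 (by fun_prop :
    ContDiff ℝ ∞ (fun t : ℝ => ((fun c => ((ε c : ℤ) : ℝ)), t))))
  periodic := R.periodic _
  immersion := R.immersion _ (by
    constructor <;> intro c <;> rcases Int.units_eq_one_or (ε c) with h | h <;> simp [h])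
  injective := by
    intro s hs t ht h
    have hu : (fun c => ((ε c : ℤ) : ℝ)) ∈ Set.Icc (-1 : Fin n → ℝ) 1 := by
      constructor <;> intro c <;> rcases Int.units_eq_one_or (ε c) with h | h <;> simp [h]
    rcases (R.double_points _ hu s hs t ht).1 h with h | ⟨c, hc, -⟩
    · exact h
    · simp at hc

/-- The value of (the Vassiliev extension of) a knot invariant `v` on a singular knot:
the alternating sum of the values of `v` over all resolutions of the double points. -/
def Resolution.alternatingSum {F : Type*} [Field F] {o : ManifoldOrientation M}
    {K : SingularKnot M n} (R : Resolution o K) (v : Knot M → F) : F :=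
  ∑ ε : Fin n → ℤˣ, (∏ c, ((ε c : ℤ) : F)) * v (R.vertex ε)

end SingularKnot

/-! ### Vassiliev invariants and their symbols -/

/-- `v` is a knot invariant that is a Vassiliev invariant of order at most `n`: its extension
to singular knots vanishes if there are more than `n` double points. -/
def IsVassilievInvariant {F : Type*} [Field F] (o : ManifoldOrientation M) (v : Knot M → F)
    (n : ℕ) : Prop :=
  (∀ K K' : Knot M, K.IsIsotopic K' → v K = v K') ∧
  ∀ m, n < m → ∀ (K : SingularKnot M m) (R : K.Resolution o), R.alternatingSum v = 0

/-- `v` is good: its value on an even singular knot with `n` double points depends only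
on the framed chord diagram. -/
def IsGood {F : Type*} [Field F] (o : ManifoldOrientation M) (α : ModTwoCocycle M)
    (v : Knot M → F) (n : ℕ) : Prop :=
  ∀ (K K' : SingularKnot M n) (R : K.Resolution o) (R' : K'.Resolution o),
    K.IsEven α → K'.IsEven α → K.framedChordDiagram α = K'.framedChordDiagram α →
    R.alternatingSum v = R'.alternatingSum v

/-- The symbol of a (good) Vassiliev invariant of order at most `n` as a function on framed chord
diagrams with `n` chords: its value at `D` is the value of `v` on any even singular knot with
diagram `D`, and `0` if there is no such singular knot (if `α` is zero, diagrams with odd chords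
do not occur). -/
def symbol {F : Type*} [Field F] (o : ManifoldOrientation M) (α : ModTwoCocycle M)
    (v : Knot M → F) (n : ℕ) (D : FramedChordDiagram n) : F :=
  open Classical in
  if h : ∃ (K : SingularKnot M n) (_ : K.Resolution o), K.IsEven α ∧ K.framedChordDiagram α = D
  then h.choose_spec.choose.alternatingSum v
  else 0

end Knots

end

/-! By goodness the symbol at a diagram can be computed on any even singular knot with that diagram
and with any resolution (`symbol_eq`). So each relation follows once suitable singular knots are
built and their resolutions compared.

Four-term relation. In a positively oriented chart let the two strands of `p` run along the first
and second axes, and let a third strand, parallel to the third axis near the origin, pass through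
the point `(w₁, w₂)` of the plane. Letting it hit the first axis at `(1, 0)` or `(-1, 0)`, or the
second axis at `(0, 1)` or `(0, -1)`, creates the chord `q` of `D₁`, `D₂`, `D₃`, `D₄`. Resolving
this double point moves the strand to a corner of the square. With signs determined by the
orientation, the four values are the differences `(1,1) - (1,-1)`, `(-1,1) - (-1,-1)`, `(-1,1) -
(1,1)` and `(-1,-1) - (1,-1)`, so `D₁ - D₂ + D₃ - D₄` cancels for each resolution of the other
chords. All these curves belong to one family, so the cancelling corners are literally the same
curve (`SlotWord.isCrossing_first`, `SlotWord.isCrossing_second`, `symbol_fourTerm`). The loop cut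
off by `q` changes by the loop of `p` when its end passes from one end of `p` to the other, whence
the framing `e + f`.

One-term relation. An isolated chord of framing `0` is realized by a small curl. Its positive and
negative resolutions are joined by an isotopy that first straightens the curl to a graph over an
axis (`SlotWord.Family.knotValue_kink`, `symbol_oneTerm`).

Realization of framings. A diagram with an odd chord occurs only if there is a loop with `α`-value
`1`, namely half of a singular knot that realizes it (`exists_chartedLoop`). Conversely, given such
a loop, every framed diagram occurs: run back and forth along the loop so that the slots are visited
at its two ends as the framings prescribe, and close up with total value `0`. If no such loop
exists, all symbols in the relation are zero (`symbol_closure_eq_zero`).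

The geometric work is to turn this plan into smooth immersed curves with no unwanted multiple
points. Perturbing by two generic vectors achieves general position, because the bad vectors form
sets of Hausdorff dimension at most two in `ℝ³` (`exists_generic_vectors`, `exists_base_curve`).
Then small copies of the model strands are inserted with their parameters
(`nonempty_insertedFamily`).

The other version of the four-term relations follows because only the framing of `q` changes, and by
that of `p`: the sign `(-1) ^ odd` changes exactly when `p` is odd. -/

noncomputable section

/-! ### Calculus of cocycles modulo 2 -/

section Cocycle

variable {M : Type*} [TopologicalSpace M]

namespace ModTwoCocycle

/-- The value of a cocycle on the image of the straight segment from `x` to `y`. -/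
def onSegment {V : Type*} [AddCommGroup V] [Module ℝ V] [TopologicalSpace V]
    [ContinuousAdd V] [ContinuousSMul ℝ V] (α : ModTwoCocycle M) (G : C(V, M)) (x y : V) : ZMod 2 :=
  α.toFun ⟨fun r : I => G (x + (r : ℝ) • (y - x)), by fun_prop⟩

section Segment

variable {V : Type*} [AddCommGroup V] [Module ℝ V] [TopologicalSpace V]
    [ContinuousAdd V] [ContinuousSMul ℝ V] (α : ModTwoCocycle M)

/-- The three paths are the edges of the affine triangle with vertices `x`, `y`, `z`, mapped by `G`;
modulo 2 the cocycle condition is additivity. -/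
theorem onSegment_add (G : C(V, M)) (x y z : V) :
    α.onSegment G x y + α.onSegment G y z = α.onSegment G x z := by
  let τ : C(Triangle, M) :=
    ⟨fun p => G (x + (p.1.2 : ℝ) • (y - x) + (p.1.1 : ℝ) • (z - y)), by fun_prop⟩
  have h := α.cocycle τ
  have h1 : τ.comp Triangle.edge₀₁ = ⟨fun r : I => G (x + (r : ℝ) • (y - x)), by fun_prop⟩ := by
    ext r; simp [τ, Triangle.edge₀₁]
  have h2 : τ.comp Triangle.edge₁₂ = ⟨fun r : I => G (y + (r : ℝ) • (z - y)), by fun_prop⟩ := by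
    ext r; simp [τ, Triangle.edge₁₂]
  have h3 : τ.comp Triangle.edge₀₂ = ⟨fun r : I => G (x + (r : ℝ) • (z - x)), by fun_prop⟩ := by
    ext r
    simp only [τ, Triangle.edge₀₂, ContinuousMap.comp_apply, ContinuousMap.coe_mk]
    congr 1
    module
  rw [h1, h2, h3] at h
  rw [CharTwo.add_eq_zero] at h
  exact h

theorem onSegment_self (G : C(V, M)) (x : V) : α.onSegment G x x = 0 := by
  simpa using α.onSegment_add G x x x

/-- The two parameter spaces may differ, so that a side of a homotopy square in `ℝ × ℝ` can be
compared with an arc in `ℝ`. -/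
theorem onSegment_congr {V' : Type*} [AddCommGroup V'] [Module ℝ V'] [TopologicalSpace V']
    [ContinuousAdd V'] [ContinuousSMul ℝ V'] {G : C(V, M)} {G' : C(V', M)} {x y : V} {x' y' : V'}
    (h : ∀ r : I, G (x + (r : ℝ) • (y - x)) = G' (x' + (r : ℝ) • (y' - x'))) :
    α.onSegment G x y = α.onSegment G' x' y' := by
  unfold onSegment
  congr 1
  ext r
  exact h r

end Segment

variable (α : ModTwoCocycle M)

theorem onArc_add (γ : C(ℝ, M)) (r s t : ℝ) :
    α.onArc γ r s + α.onArc γ s t = α.onArc γ r t :=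
  α.onSegment_add γ r s t

theorem onArc_self (γ : C(ℝ, M)) (t : ℝ) : α.onArc γ t t = 0 := α.onSegment_self γ t

theorem onArc_comm (γ : C(ℝ, M)) (s t : ℝ) : α.onArc γ s t = α.onArc γ t s := by
  have h := α.onArc_add γ s t s
  rwa [onArc_self, CharTwo.add_eq_zero] at h

/-- In the real line, `y` along the segment is homotopic to the straight segment from `y s` to `y t`
with fixed ends; the two ways around the homotopy square have the same value. So running back and
forth does not count. -/
theorem onArc_comp (γ : C(ℝ, M)) (y : C(ℝ, ℝ)) (s t : ℝ) :
    α.onArc (γ.comp y) s t = α.onArc γ (y s) (y t) := by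
  let G : C(ℝ × ℝ, M) := ⟨fun p => γ ((1 - p.1) * y (s + p.2 * (t - s)) +
    p.1 * (y s + p.2 * (y t - y s))), by fun_prop⟩
  have h1 := α.onSegment_add G (0, 0) (0, 1) (1, 1)
  have h2 := α.onSegment_add G (0, 0) (1, 0) (1, 1)
  have e1 : α.onSegment G (0, 0) (0, 1) = α.onArc (γ.comp y) s t :=
    α.onSegment_congr (fun r => by simp [G])
  have e2 : α.onSegment G (1, 0) (1, 1) = α.onArc γ (y s) (y t) :=
    α.onSegment_congr (fun r => by simp [G])
  have e3 : α.onSegment G (0, 0) (1, 0) = 0 := by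
    rw [← α.onSegment_self G (0, 0)]
    refine α.onSegment_congr fun r => ?_
    simp only [G, ContinuousMap.coe_mk]
    congr 1
    simp
    ring
  have e4 : α.onSegment G (0, 1) (1, 1) = 0 := by
    rw [← α.onSegment_self G (0, 1)]
    refine α.onSegment_congr fun r => ?_
    simp only [G, ContinuousMap.coe_mk]
    congr 1
    simp
    ring
  rw [e1, e4] at h1
  rw [e2, e3] at h2
  rw [add_zero] at h1
  rw [zero_add] at h2
  rw [h1, h2]

/-- Homotopic curves have the same value on an arc if the cocycle vanishes on the tracks of
the two ends. -/
theorem onArc_eq_of_homotopy (H : C(ℝ × ℝ, M)) {γ γ' : C(ℝ, M)} (h0 : ∀ t, H (0, t) = γ t)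
    (h1 : ∀ t, H (1, t) = γ' t) {s t : ℝ} (hs : α.onSegment H (0, s) (1, s) = 0)
    (ht : α.onSegment H (0, t) (1, t) = 0) : α.onArc γ s t = α.onArc γ' s t := by
  have a1 := α.onSegment_add H (0, s) (0, t) (1, t)
  have a2 := α.onSegment_add H (0, s) (1, s) (1, t)
  have e1 : α.onSegment H (0, s) (0, t) = α.onArc γ s t :=
    α.onSegment_congr (fun r => by simp [← h0])
  have e2 : α.onSegment H (1, s) (1, t) = α.onArc γ' s t :=
    α.onSegment_congr (fun r => by simp [← h1])
  rw [e1, ht, add_zero] at a1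
  rw [e2, hs, zero_add] at a2
  rw [a1, a2]

/-- For a closed curve of period `1`, the value on a period does not depend on the starting
point. -/
theorem onArc_period (γ : C(ℝ, M)) (hγ : ∀ t, γ (t + 1) = γ t) (s : ℝ) :
    α.onArc γ s (s + 1) = α.onArc γ 0 1 := by
  have h1 := α.onArc_add γ 0 s (s + 1)
  have h2 := α.onArc_add γ 0 1 (s + 1)
  have h3 : α.onArc γ 1 (s + 1) = α.onArc γ 0 s :=
    α.onSegment_congr (fun r => by
      rw [← hγ (0 + (r : ℝ) • (s - 0))]
      congr 1
      simp
      ring)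
  rw [h3, add_comm, ← h1] at h2
  exact (add_left_cancel h2).symm

/-- The cocycle vanishes on all paths in the set `U`. -/
def VanishesOn (U : Set M) : Prop := ∀ f : C(I, M), (∀ r, f r ∈ U) → α.toFun f = 0

/-- Adding a coboundary. -/
def addCoboundary (h : M → ZMod 2) : ModTwoCocycle M where
  toFun f := α.toFun f + (h (f 0) + h (f 1))
  cocycle τ := by
    have := α.cocycle τ
    have e : ∀ a b c d e f : ZMod 2, a + b + c = 0 →
      (a + (d + e)) + (b + (e + f)) + (c + (d + f)) = 0 := by decide
    simpa [Triangle.edge₀₁, Triangle.edge₁₂, Triangle.edge₀₂] using e _ _ _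
      (h (τ ⟨(0, 0), le_refl _⟩)) (h (τ ⟨(0, 1), zero_le_one⟩)) (h (τ ⟨(1, 1), le_refl _⟩)) this

/-- The two boundary terms cancel modulo 2. Hence framings and evenness may be computed with a
cocycle normalized in a chart. -/
theorem addCoboundary_onArc (h : M → ZMod 2) (γ : C(ℝ, M)) {s t : ℝ} (hst : γ s = γ t) :
    (α.addCoboundary h).onArc γ s t = α.onArc γ s t := by
  have : ∀ a b : ZMod 2, a + (b + b) = a := by decide
  simp [onArc, addCoboundary, hst, this]

/-- On the domain of a chart onto a vector space, a cocycle is a coboundary. -/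
theorem exists_addCoboundary_vanishesOn {E : Type*} [AddCommGroup E] [Module ℝ E]
    [TopologicalSpace E] [ContinuousAdd E] [ContinuousSMul ℝ E]
    (e : OpenPartialHomeomorph M E) (he : e.target = Set.univ) :
    ∃ h : M → ZMod 2, (α.addCoboundary h).VanishesOn e.source := by
  have hc : Continuous e.symm := by
    rw [← continuousOn_univ, ← he]; exact e.continuousOn_symm
  let ψ : C(E, M) := ⟨e.symm, hc⟩
  -- The primitive is the value on the ray from the origin of the chart; the square `G` below is the
  -- cone over the given path.
  refine ⟨fun x => α.onSegment ψ 0 (e x), fun f hf => ?_⟩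
  let f' : C(I, E) := ⟨fun r => e (f r), e.continuousOn.comp_continuous f.continuous hf⟩
  -- The path is extended by constants, since homotopy squares are parametrized by the whole plane.
  let f'' : C(ℝ, E) := ⟨fun x => f' (Set.projIcc 0 1 zero_le_one x), by fun_prop⟩
  let G : C(ℝ × ℝ, M) := ⟨fun p => ψ (p.1 • f'' p.2), by fun_prop⟩
  have h1 := α.onSegment_add G (0, 0) (0, 1) (1, 1)
  have h2 := α.onSegment_add G (0, 0) (1, 0) (1, 1)
  have e1 : α.onSegment G (0, 0) (0, 1) = 0 := by
    rw [← α.onSegment_self G (0, 0)]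
    exact α.onSegment_congr fun r => by simp [G]
  have e2 : α.onSegment G (1, 0) (1, 1) = α.toFun f := by
    unfold onSegment
    congr 1
    ext r
    simp [G, f'', f', ψ, e.left_inv (hf r)]
  have e3 : α.onSegment G (0, 0) (1, 0) = α.onSegment ψ 0 (e (f 0)) :=
    α.onSegment_congr fun r => by simp [G, f'', f']
  have e4 : α.onSegment G (0, 1) (1, 1) = α.onSegment ψ 0 (e (f 1)) :=
    α.onSegment_congr fun r => by simp [G, f'', f']
  rw [e1, e4] at h1
  rw [e2, e3] at h2
  have : ∀ a b c d : ZMod 2, 0 + a = b → c + d = b → d + (c + a) = 0 := by decide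
  exact this _ _ _ _ h1 h2

end ModTwoCocycle

end Cocycle

/-! ### Charts and velocities -/

section Charts

variable {M : Type*} [TopologicalSpace M] [ChartedSpace (EuclideanSpace ℝ (Fin 3)) M]

/-- A chart that is smooth together with its inverse. -/
structure IsSmoothChart (e : OpenPartialHomeomorph M (EuclideanSpace ℝ (Fin 3))) : Prop where
  smooth : ContMDiffOn (𝓡 3) (𝓡 3) ∞ e e.source
  smooth_symm : ContMDiffOn (𝓡 3) (𝓡 3) ∞ e.symm e.target

theorem isSmoothChart_chartAt [IsManifold (𝓡 3) ∞ M] (x : M) :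
    IsSmoothChart (chartAt (EuclideanSpace ℝ (Fin 3)) x) :=
  ⟨contMDiffOn_chart, contMDiffOn_chart_symm⟩

/-- The derivative of the inverse of a chart, in the preferred coordinates of tangent spaces. -/
def chartFrame (e : OpenPartialHomeomorph M (EuclideanSpace ℝ (Fin 3)))
    (z : EuclideanSpace ℝ (Fin 3)) : EuclideanSpace ℝ (Fin 3) →L[ℝ] EuclideanSpace ℝ (Fin 3) :=
  mfderiv (𝓡 3) (𝓡 3) e.symm z

namespace IsSmoothChart

variable {e : OpenPartialHomeomorph M (EuclideanSpace ℝ (Fin 3))}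

theorem mdifferentiable (he : IsSmoothChart e) : e.MDifferentiable (𝓡 3) (𝓡 3) :=
  ⟨he.smooth.mdifferentiableOn (by simp), he.smooth_symm.mdifferentiableOn (by simp)⟩

/-- The chain rule. It reduces all statements on velocities to calculus in the coordinates of `e`,
with `chartFrame` as an invertible factor. -/
theorem velocity_eq (he : IsSmoothChart e) {γ : ℝ → M} {f : ℝ → EuclideanSpace ℝ (Fin 3)} {t : ℝ}
    (hf : DifferentiableAt ℝ f t) (ht : f t ∈ e.target) (h : γ =ᶠ[nhds t] fun x => e.symm (f x)) :
    velocity γ t = chartFrame e (f t) (deriv f t) := by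
  unfold velocity
  rw [h.mfderiv_eq]
  have h1 : MDifferentiableAt (𝓡 3) (𝓡 3) e.symm (f t) :=
    he.mdifferentiable.mdifferentiableAt_symm ht
  have h2 : MDifferentiableAt 𝓘(ℝ, ℝ) (𝓡 3) f t := hf.mdifferentiableAt
  have := mfderiv_comp t h1 h2
  change (mfderiv 𝓘(ℝ, ℝ) (𝓡 3) (e.symm ∘ f) t) (1 : ℝ) = _
  rw [this, mfderiv_eq_fderiv]
  rfl

theorem chartFrame_injective (he : IsSmoothChart e) {z : EuclideanSpace ℝ (Fin 3)}
    (hz : z ∈ e.target) : Function.Injective (chartFrame e z) :=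
  he.mdifferentiable.symm.mfderiv_injective hz

theorem velocity_eq_zero_iff (he : IsSmoothChart e) {γ : ℝ → M}
    {f : ℝ → EuclideanSpace ℝ (Fin 3)} {t : ℝ}
    (hf : DifferentiableAt ℝ f t) (ht : f t ∈ e.target) (h : γ =ᶠ[nhds t] fun x => e.symm (f x)) :
    velocity γ t = 0 ↔ deriv f t = 0 := by
  rw [he.velocity_eq hf ht h, map_eq_zero_iff _ (he.chartFrame_injective ht)]

theorem contDiffOn_comp (he : IsSmoothChart e) {γ : ℝ → M} (hγ : ContMDiff 𝓘(ℝ, ℝ) (𝓡 3) ∞ γ) :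
    ContDiffOn ℝ ∞ (fun t => e (γ t)) (γ ⁻¹' e.source) := by
  rw [← contMDiffOn_iff_contDiffOn]
  exact he.smooth.comp hγ.contMDiffOn (fun _ h => h)

end IsSmoothChart

theorem velocity_congr {γ γ' : ℝ → M} {t : ℝ} (h : γ =ᶠ[nhds t] γ') :
    velocity γ t = velocity γ' t := by
  unfold velocity
  rw [h.mfderiv_eq]
  rfl

theorem velocity_add_period {γ : ℝ → M} (hγ : ContMDiff 𝓘(ℝ, ℝ) (𝓡 3) ∞ γ)
    (hp : ∀ t, γ (t + 1) = γ t) (t : ℝ) : velocity γ (t + 1) = velocity γ t := by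
  have h1 : γ ∘ (fun x => x + 1) = γ := funext hp
  unfold velocity
  have h2 : MDifferentiableAt 𝓘(ℝ, ℝ) 𝓘(ℝ, ℝ) (fun x : ℝ => x + 1) t :=
    (by fun_prop : DifferentiableAt ℝ (fun x : ℝ => x + 1) t).mdifferentiableAt
  have h6 : MDifferentiableAt 𝓘(ℝ, ℝ) (𝓡 3) γ (t + 1) := (hγ (t + 1)).mdifferentiableAt (by simp)
  have h3 := mfderiv_comp t h6 h2
  have h4 : mfderiv 𝓘(ℝ, ℝ) 𝓘(ℝ, ℝ) (fun x : ℝ => x + 1) t (1 : ℝ) = (1 : ℝ) := by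
    rw [mfderiv_eq_fderiv]
    change fderiv ℝ (fun x : ℝ => x + 1) t 1 = 1
    simp
  -- The type of `mfderiv` depends on the curve, so the equality of functions is used by
  -- substitution and not by rewriting.
  have h5 : ∀ γ' : ℝ → M, γ' = γ → (mfderiv 𝓘(ℝ, ℝ) (𝓡 3) γ' t (1 : ℝ) : EuclideanSpace ℝ (Fin 3))
      = mfderiv 𝓘(ℝ, ℝ) (𝓡 3) γ t (1 : ℝ) := by rintro _ rfl; rfl
  rw [← h5 _ h1, h3]
  change _ = mfderiv 𝓘(ℝ, ℝ) (𝓡 3) γ (t + 1) (mfderiv 𝓘(ℝ, ℝ) 𝓘(ℝ, ℝ) (fun x : ℝ => x + 1) t (1 : ℝ))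
  rw [h4]

/-! ### Modifications of a curve in a chart -/

open Classical in
/-- The curve `γ`, changed at the times in `C` by adding `m t` in the coordinates of the chart `e`. -/
def chartModification (e : OpenPartialHomeomorph M (EuclideanSpace ℝ (Fin 3))) (γ : ℝ → M)
    (C : Set ℝ) (m : ℝ → EuclideanSpace ℝ (Fin 3)) (t : ℝ) : M :=
  if t ∈ C then e.symm (e (γ t) + m t) else γ t

section Modification

variable {e : OpenPartialHomeomorph M (EuclideanSpace ℝ (Fin 3))} {γ : ℝ → M} {C : Set ℝ}

set_option linter.unusedSectionVars false

theorem chartModification_of_mem {m : ℝ → EuclideanSpace ℝ (Fin 3)} {t : ℝ} (ht : t ∈ C) :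
    chartModification e γ C m t = e.symm (e (γ t) + m t) := if_pos ht

theorem chartModification_of_notMem {m : ℝ → EuclideanSpace ℝ (Fin 3)} {t : ℝ} (ht : t ∉ C) :
    chartModification e γ C m t = γ t := if_neg ht

theorem chartModification_of_eq_zero {m : ℝ → EuclideanSpace ℝ (Fin 3)} {t : ℝ}
    (hC : t ∈ C → γ t ∈ e.source) (hm : m t = 0) : chartModification e γ C m t = γ t := by
  by_cases ht : t ∈ C
  · rw [chartModification_of_mem ht, hm, add_zero, e.left_inv (hC ht)]
  · exact chartModification_of_notMem ht

/-- The formula is valid on a whole neighbourhood of `C`, not only on `C`; this makes the modified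
curve smooth at the boundary of `C`. -/
theorem chartModification_of_source {m : ℝ → EuclideanSpace ℝ (Fin 3)} {t : ℝ}
    (ht : γ t ∈ e.source) (hm : t ∉ C → m t = 0) :
    chartModification e γ C m t = e.symm (e (γ t) + m t) := by
  by_cases h : t ∈ C
  · exact chartModification_of_mem h
  · rw [chartModification_of_notMem h, hm h, add_zero, e.left_inv ht]

variable {P : Type*} [NormedAddCommGroup P] [NormedSpace ℝ P]

/-- Near a time in `C` the formula in the chart holds, and near a time outside the closed set `C`
nothing is changed. The set `O` of parameters serves perturbations that stay in the target of the
chart only when they are small. -/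
theorem contMDiffOn_chartModification (he : IsSmoothChart e)
    (hγ : ContMDiff 𝓘(ℝ, ℝ) (𝓡 3) ∞ γ) (hC : IsClosed C) {O : Set P}
    {m : P → ℝ → EuclideanSpace ℝ (Fin 3)} (hm : ContDiff ℝ ∞ (Function.uncurry m))
    (hsource : ∀ t ∈ C, γ t ∈ e.source) (htarget : ∀ p ∈ O, ∀ t ∈ C, e (γ t) + m p t ∈ e.target)
    (hzero : ∀ p, ∀ t ∉ C, m p t = 0) :
    ContMDiffOn 𝓘(ℝ, P × ℝ) (𝓡 3) ∞
      (fun x : P × ℝ => chartModification e γ C (m x.1) x.2) (O ×ˢ Set.univ) := by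
  rintro ⟨p, t⟩ ⟨hp, -⟩
  refine ContMDiffAt.contMDiffWithinAt ?_
  have hγ2 : ContMDiff 𝓘(ℝ, P × ℝ) (𝓡 3) ∞ (fun x : P × ℝ => γ x.2) :=
    hγ.comp (contMDiff_iff_contDiff.2 contDiff_snd)
  by_cases ht : t ∈ C
  · have h1 : ContMDiffAt 𝓘(ℝ, P × ℝ) (𝓡 3) ∞ (fun x : P × ℝ => e (γ x.2)) (p, t) :=
      (he.smooth.contMDiffAt (e.open_source.mem_nhds (hsource t ht))).comp (p, t) hγ2.contMDiffAt
    have h2 : ContMDiffAt 𝓘(ℝ, P × ℝ) (𝓡 3) ∞ (fun x : P × ℝ => e (γ x.2) + m x.1 x.2) (p, t) := by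
      rw [contMDiffAt_iff_contDiffAt] at h1 ⊢
      exact h1.add hm.contDiffAt
    have h3 : ContMDiffAt 𝓘(ℝ, P × ℝ) (𝓡 3) ∞
        (fun x : P × ℝ => e.symm (e (γ x.2) + m x.1 x.2)) (p, t) :=
      (he.smooth_symm.contMDiffAt (e.open_target.mem_nhds (htarget p hp t ht))).comp (p, t) h2
    refine h3.congr_of_eventuallyEq ?_
    have : ∀ᶠ x : P × ℝ in nhds (p, t), γ x.2 ∈ e.source :=
      hγ2.continuous.continuousAt.eventually (e.open_source.mem_nhds (hsource t ht))
    filter_upwards [this] with x hx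
    exact chartModification_of_source hx (hzero _ _)
  · refine hγ2.contMDiffAt.congr_of_eventuallyEq ?_
    have : ∀ᶠ x : P × ℝ in nhds (p, t), x.2 ∉ C :=
      (continuous_snd (X := P)).continuousAt.eventually
        (hC.isOpen_compl.mem_nhds (x := (p, t).2) ht)
    filter_upwards [this] with x hx
    exact chartModification_of_notMem hx

theorem contMDiff_chartModification_family (he : IsSmoothChart e)
    (hγ : ContMDiff 𝓘(ℝ, ℝ) (𝓡 3) ∞ γ) (hC : IsClosed C)
    {m : P → ℝ → EuclideanSpace ℝ (Fin 3)} (hm : ContDiff ℝ ∞ (Function.uncurry m))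
    (hsource : ∀ t ∈ C, γ t ∈ e.source) (htarget : ∀ p, ∀ t ∈ C, e (γ t) + m p t ∈ e.target)
    (hzero : ∀ p, ∀ t ∉ C, m p t = 0) :
    ContMDiff 𝓘(ℝ, P × ℝ) (𝓡 3) ∞
      (Function.uncurry fun p => chartModification e γ C (m p)) := by
  have := contMDiffOn_chartModification he hγ hC (O := Set.univ) hm hsource
    (fun p _ => htarget p) hzero
  rw [Set.univ_prod_univ, contMDiffOn_univ] at this
  exact this

theorem contMDiff_chartModification (he : IsSmoothChart e)
    (hγ : ContMDiff 𝓘(ℝ, ℝ) (𝓡 3) ∞ γ) (hC : IsClosed C)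
    {m : ℝ → EuclideanSpace ℝ (Fin 3)} (hm : ContDiff ℝ ∞ m)
    (hsource : ∀ t ∈ C, γ t ∈ e.source) (htarget : ∀ t ∈ C, e (γ t) + m t ∈ e.target)
    (hzero : ∀ t ∉ C, m t = 0) :
    ContMDiff 𝓘(ℝ, ℝ) (𝓡 3) ∞ (chartModification e γ C m) := by
  have := contMDiff_chartModification_family (P := ℝ) (m := fun _ => m) he hγ hC
    (hm.comp contDiff_snd) hsource (fun _ => htarget) (fun _ => hzero)
  exact this.comp (contMDiff_iff_contDiff.2 (by fun_prop : ContDiff ℝ ∞ (fun t : ℝ => ((0 : ℝ), t))))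

/-- A modification in a chart does not change the value of a cocycle on an arc if at the ends
of the arc the curve is not changed or the cocycle vanishes on the domain of the chart. -/
theorem onArc_chartModification (he : IsSmoothChart e)
    (hγ : ContMDiff 𝓘(ℝ, ℝ) (𝓡 3) ∞ γ) (hC : IsClosed C)
    {m : ℝ → EuclideanSpace ℝ (Fin 3)} (hm : ContDiff ℝ ∞ m)
    (hsource : ∀ t ∈ C, γ t ∈ e.source)
    (htarget : ∀ r ∈ Set.Icc (0 : ℝ) 1, ∀ t ∈ C, e (γ t) + r • m t ∈ e.target)
    (hzero : ∀ t ∉ C, m t = 0) (α : ModTwoCocycle M) {s t : ℝ}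
    (hs : m s = 0 ∨ α.VanishesOn e.source) (ht : m t = 0 ∨ α.VanishesOn e.source)
    (γ₀ γ₁ : C(ℝ, M)) (h₀ : ∀ t, γ₀ t = γ t) (h₁ : ∀ t, γ₁ t = chartModification e γ C m t) :
    α.onArc γ₁ s t = α.onArc γ₀ s t := by
  -- `Real.smoothTransition` keeps the factor of `m` in `[0, 1]` for all real parameters, where
  -- `htarget` applies, and still joins `0` to `1`.
  have key := contMDiff_chartModification_family (P := ℝ)
    (m := fun p t => Real.smoothTransition p • m t) he hγ hC
    ((Real.smoothTransition.contDiff.comp contDiff_fst).smul (hm.comp contDiff_snd)) hsource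
    (fun p t ht => htarget _ ⟨Real.smoothTransition.nonneg _, Real.smoothTransition.le_one _⟩ t ht)
    (fun p t ht => by simp [hzero t ht])
  let H : C(ℝ × ℝ, M) := ⟨_, key.continuous⟩
  have hH0 : ∀ t, H (0, t) = γ₀ t := by
    intro t
    rw [h₀]
    exact chartModification_of_eq_zero (m := fun t => Real.smoothTransition 0 • m t)
      (hsource t) (by simp)
  have hH1 : ∀ t, H (1, t) = γ₁ t := by
    intro t
    rw [h₁]
    simp [H]
  have track : ∀ t, (m t = 0 ∨ α.VanishesOn e.source) → α.onSegment H (0, t) (1, t) = 0 := by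
    intro t ht
    by_cases hm0 : m t = 0
    · rw [← α.onSegment_self H (0, t)]
      refine α.onSegment_congr fun r => ?_
      rw [show ((0 : ℝ), t) + (r : ℝ) • ((1, t) - (0, t)) = ((r : ℝ), t) by simp,
        show ((0 : ℝ), t) + (r : ℝ) • ((0, t) - (0, t)) = (0, t) by simp]
      have : ∀ p, H (p, t) = γ t := fun p =>
        chartModification_of_eq_zero (m := fun t => Real.smoothTransition p • m t)
          (hsource t) (by simp [hm0])
      rw [this, this]
    · have htC : t ∈ C := by by_contra h; exact hm0 (hzero t h)
      refine (ht.resolve_left hm0) _ fun r => ?_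
      simp only [H, Function.uncurry, ContinuousMap.coe_mk]
      rw [show ((0 : ℝ), t) + (r : ℝ) • ((1, t) - (0, t)) = ((r : ℝ), t) by simp,
        chartModification_of_mem htC]
      refine e.map_target ?_
      exact htarget _ ⟨Real.smoothTransition.nonneg _, Real.smoothTransition.le_one _⟩ t htC
  exact (α.onArc_eq_of_homotopy H hH0 hH1 (track s hs) (track t ht)).symm

end Modification

/-! ### Periodic extension -/

/-- The representative of `t` modulo `1` in `[a, a + 1)`. -/
def periodRep (a t : ℝ) : ℝ := a + Int.fract (t - a)

theorem periodRep_add_one (a t : ℝ) : periodRep a (t + 1) = periodRep a t := by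
  unfold periodRep
  rw [show t + 1 - a = t - a + 1 by ring, Int.fract_add_one]

theorem periodRep_mem (a t : ℝ) : periodRep a t ∈ Set.Ico a (a + 1) :=
  ⟨by unfold periodRep; linarith [Int.fract_nonneg (t - a)],
    by unfold periodRep; linarith [Int.fract_lt_one (t - a)]⟩

theorem periodRep_of_mem {a t : ℝ} (h : t ∈ Set.Ico a (a + 1)) : periodRep a t = t := by
  unfold periodRep
  rw [Int.fract_eq_self.2 ⟨by linarith [h.1], by linarith [h.2]⟩]
  ring

theorem periodRep_eq (a t : ℝ) : ∃ k : ℤ, periodRep a t = t - k :=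
  ⟨⌊t - a⌋, by unfold periodRep; rw [Int.fract]; ring⟩

theorem apply_sub_int {X : Type*} {γ : ℝ → X} (hγ : ∀ t, γ (t + 1) = γ t) (t : ℝ) (k : ℤ) :
    γ (t - k) = γ t := by
  have hp : Function.Periodic γ 1 := hγ
  simpa using hp.sub_int_mul_eq (x := t) k

theorem apply_periodRep {X : Type*} {γ : ℝ → X} (hγ : ∀ t, γ (t + 1) = γ t) (a t : ℝ) :
    γ (periodRep a t) = γ t := by
  obtain ⟨k, hk⟩ := periodRep_eq a t
  rw [hk, apply_sub_int hγ]

/-- Near every time, `periodRep a` is a translation or its values are near the ends of the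
period. -/
theorem periodRep_eventually {a b c : ℝ} (hab : a < b) (hc : c < a + 1) (t : ℝ) :
    (∃ k : ℤ, ∀ᶠ x in nhds t, periodRep a x = x - k) ∨
      ∀ᶠ x in nhds t, periodRep a x ∉ Set.Icc b c := by
  by_cases h : Int.fract (t - a) = 0
  · right
    set k := ⌊t - a⌋
    have hk : t = a + k := by
      have := Int.fract_add_floor (t - a)
      rw [h] at this
      linarith
    have h1 : ∀ᶠ x in nhds t, x ∈ Set.Ioo (a + k - min (a + 1 - c) 1) (a + k + min (b - a) 1) := by
      refine Ioo_mem_nhds ?_ ?_ <;> rw [hk]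
      · have : 0 < min (a + 1 - c) 1 := lt_min (by linarith) one_pos
        linarith
      · have : 0 < min (b - a) 1 := lt_min (by linarith) one_pos
        linarith
    filter_upwards [h1] with x hx hx'
    have m1 := min_le_left (a + 1 - c) 1
    have m2 := min_le_right (a + 1 - c) 1
    have m3 := min_le_left (b - a) 1
    have m4 := min_le_right (b - a) 1
    rcases le_or_gt (a + k) x with hxk | hxk
    · have : Int.fract (x - a) = x - a - k := by
        rw [Int.fract, (Int.floor_eq_iff (a := x - a) (z := k)).2 ⟨by linarith, by linarith [hx.2]⟩]
      unfold periodRep at hx'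
      rw [this] at hx'
      linarith [hx'.1, hx.2]
    · have : Int.fract (x - a) = x - a - (k - 1 : ℤ) := by
        rw [Int.fract, (Int.floor_eq_iff (a := x - a) (z := k - 1)).2
          ⟨by push_cast; linarith [hx.1], by push_cast; linarith⟩]
      unfold periodRep at hx'
      rw [this] at hx'
      push_cast at hx'
      linarith [hx'.2, hx.1]
  · left
    refine ⟨⌊t - a⌋, ?_⟩
    have hpos : 0 < Int.fract (t - a) := lt_of_le_of_ne (Int.fract_nonneg _) (Ne.symm h)
    have h1 : ∀ᶠ x in nhds t, x ∈ Set.Ioo (a + ⌊t - a⌋) (a + ⌊t - a⌋ + 1) := by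
      refine Ioo_mem_nhds ?_ ?_
      · have := Int.fract_add_floor (t - a); linarith
      · have := Int.lt_floor_add_one (t - a); linarith
    filter_upwards [h1] with x hx
    unfold periodRep
    rw [Int.fract, (Int.floor_eq_iff (a := x - a) (z := ⌊t - a⌋)).2
      ⟨by linarith [hx.1], by linarith [hx.2]⟩]
    ring

/-- The jumps of `periodRep a` are harmless because `f` vanishes near both ends of the period. -/
theorem contDiff_comp_periodRep {P : Type*} [NormedAddCommGroup P] [NormedSpace ℝ P]
    {F : Type*} [NormedAddCommGroup F] [NormedSpace ℝ F] {f : P → ℝ → F}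
    (hf : ContDiff ℝ ∞ (Function.uncurry f)) {a b c : ℝ} (hab : a < b) (hc : c < a + 1)
    (h : ∀ p, ∀ t ∉ Set.Icc b c, f p t = 0) :
    ContDiff ℝ ∞ (Function.uncurry fun p t => f p (periodRep a t)) := by
  rw [contDiff_iff_contDiffAt]
  rintro ⟨p, t⟩
  rcases periodRep_eventually hab hc t with ⟨k, hk⟩ | hk
  · have : ContDiff ℝ ∞ (fun x : P × ℝ => Function.uncurry f (x.1, x.2 - k)) :=
      hf.comp (by fun_prop)
    refine this.contDiffAt.congr_of_eventuallyEq ?_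
    filter_upwards [continuous_snd.continuousAt.eventually hk] with x hx
    simp [Function.uncurry, hx]
  · refine (contDiffAt_const (c := (0 : F))).congr_of_eventuallyEq ?_
    filter_upwards [continuous_snd.continuousAt.eventually hk] with x hx
    exact h _ _ hx

theorem contDiff_comp_periodRep_single {F : Type*} [NormedAddCommGroup F] [NormedSpace ℝ F]
    {f : ℝ → F} (hf : ContDiff ℝ ∞ f) {a b c : ℝ} (hab : a < b) (hc : c < a + 1)
    (h : ∀ t ∉ Set.Icc b c, f t = 0) : ContDiff ℝ ∞ (fun t => f (periodRep a t)) := by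
  have := contDiff_comp_periodRep (P := ℝ) (f := fun _ => f) (hf.comp contDiff_snd) hab hc
    (fun _ => h)
  exact this.comp (by fun_prop : ContDiff ℝ ∞ (fun t : ℝ => ((0 : ℝ), t)))

theorem isClosed_periodRep_preimage {a b c : ℝ} (hab : a < b) (hc : c < a + 1) {C : Set ℝ}
    (hC : IsClosed C) (h : C ⊆ Set.Icc b c) : IsClosed (periodRep a ⁻¹' C) := by
  rw [← isOpen_compl_iff, isOpen_iff_mem_nhds]
  intro t ht
  rcases periodRep_eventually hab hc t with ⟨k, hk⟩ | hk
  · have h1 : t - k ∉ C := by rw [← hk.self_of_nhds]; exact ht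
    have h2 : ∀ᶠ x in nhds t, x - (k : ℝ) ∈ Cᶜ :=
      (by fun_prop : Continuous fun x : ℝ => x - (k : ℝ)).continuousAt.eventually
        (hC.isOpen_compl.mem_nhds h1)
    filter_upwards [hk, h2] with x hx hx2
    change periodRep a x ∉ C
    rw [hx]
    exact hx2
  · filter_upwards [hk] with x hx hxC
    exact hx (h hxC)

end Charts

/-! ### General position -/

section GeneralPosition

/-- Maps of class `C¹` are locally Lipschitz and do not raise the Hausdorff dimension. -/
theorem dimH_image_le_of_contDiffOn {V W : Type*} [NormedAddCommGroup V] [NormedSpace ℝ V]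
    [FiniteDimensional ℝ V] [NormedAddCommGroup W] [NormedSpace ℝ W] {f : V → W} {s : Set V}
    (hs : IsOpen s) (hf : ContDiffOn ℝ 1 f s) : dimH (f '' s) ≤ Module.finrank ℝ V := by
  refine (dimH_image_le_of_locally_lipschitzOn fun x hx => ?_).trans
    ((dimH_mono (Set.subset_univ s)).trans (Real.dimH_univ_eq_finrank V).le)
  obtain ⟨K, t, ht, h⟩ := (hf.contDiffAt (hs.mem_nhds hx)).exists_lipschitzOnWith
  exact ⟨K, t, mem_nhdsWithin_of_mem_nhds ht, h⟩

/-- A set of dimension less than three has dense complement in `ℝ³`. This takes the place of Sard's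
theorem in the choice of generic vectors. -/
theorem exists_notMem_of_dimH_le_two {A B : Set (EuclideanSpace ℝ (Fin 3))} (hA : dimH A ≤ 2)
    (hB : dimH B ≤ 2) {U : Set (EuclideanSpace ℝ (Fin 3))} {x : EuclideanSpace ℝ (Fin 3)}
    (hU : U ∈ nhds x) : ∃ w ∈ U, w ∉ A ∧ w ∉ B := by
  have h : Dense (A ∪ B)ᶜ := by
    refine dense_compl_of_dimH_lt_finrank ?_
    rw [dimH_union, finrank_euclideanSpace_fin]
    refine (max_le hA hB).trans_lt ?_
    norm_num
  obtain ⟨w, hw1, hw2⟩ := h.inter_nhds_nonempty hU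
  exact ⟨w, hw2, fun h => hw1 (Or.inl h), fun h => hw1 (Or.inr h)⟩

/-- A smooth function that is positive exactly on the interval `(a, b)`. -/
def intervalBump (a b t : ℝ) : ℝ := expNegInvGlue (t - a) * expNegInvGlue (b - t)

theorem contDiff_intervalBump (a b : ℝ) : ContDiff ℝ ∞ (intervalBump a b) :=
  (expNegInvGlue.contDiff.comp (by fun_prop)).mul (expNegInvGlue.contDiff.comp (by fun_prop))

theorem intervalBump_nonneg (a b t : ℝ) : 0 ≤ intervalBump a b t :=
  mul_nonneg (expNegInvGlue.nonneg _) (expNegInvGlue.nonneg _)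

theorem intervalBump_ne_zero_iff {a b t : ℝ} : intervalBump a b t ≠ 0 ↔ t ∈ Set.Ioo a b := by
  unfold intervalBump
  constructor
  · intro h
    constructor
    · by_contra h'
      exact h (by rw [expNegInvGlue.zero_of_nonpos (by linarith), zero_mul])
    · by_contra h'
      exact h (by rw [expNegInvGlue.zero_of_nonpos (x := b - t) (by linarith), mul_zero])
  · intro h
    exact (mul_pos (expNegInvGlue.pos_of_pos (by linarith [h.1]))
      (expNegInvGlue.pos_of_pos (by linarith [h.2]))).ne'

/-- The function has a minimum there. Consequently a perturbation by the bump leaves the velocities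
at the ends of the interval unchanged. -/
theorem deriv_intervalBump_of_notMem {a b t : ℝ} (h : t ∉ Set.Ioo a b) :
    deriv (intervalBump a b) t = 0 := by
  have h0 : intervalBump a b t = 0 := by
    by_contra h'
    exact h (intervalBump_ne_zero_iff.1 h')
  refine IsLocalMin.deriv_eq_zero (Filter.Eventually.of_forall fun x => ?_)
  rw [h0]
  exact intervalBump_nonneg a b x

/-- Generic values of `w₁` and `w₀` make the curve `x + β (w₀ + t w₁)` immersed and injective
where `β` does not vanish. -/
theorem exists_generic_vectors {x : ℝ → EuclideanSpace ℝ (Fin 3)} {O : Set ℝ} (hO : IsOpen O)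
    (hx : ContDiffOn ℝ ∞ x O) {β : ℝ → ℝ} (hβ : ContDiff ℝ ∞ β) (hβO : ∀ t, β t ≠ 0 → t ∈ O)
    {U : Set (EuclideanSpace ℝ (Fin 3) × EuclideanSpace ℝ (Fin 3))} (hU : U ∈ nhds 0) :
    ∃ w ∈ U,
      (∀ s t, β s ≠ 0 → t ∈ O → s ≠ t →
        x s + β s • (w.1 + s • w.2) ≠ x t + β t • (w.1 + t • w.2)) ∧
      ∀ t, β t ≠ 0 → deriv (fun t => x t + β t • (w.1 + t • w.2)) t ≠ 0 := by
  obtain ⟨U₀, hU₀, U₁, hU₁, hsub⟩ := mem_nhds_prod_iff.1 hU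
  have hx' : ContDiffOn ℝ 1 (deriv x) O :=
    ((contDiffOn_infty_iff_deriv_of_isOpen hO).1 hx).2.of_le (by simp)
  have hx1 : ContDiffOn ℝ 1 x O := hx.of_le (by simp)
  have hβ1 : ContDiff ℝ 1 β := hβ.of_le (by simp)
  have hβ' : ContDiff ℝ 1 (deriv β) := (contDiff_infty_iff_deriv.1 hβ).2.of_le (by simp)
  have hβo : IsOpen {t | β t ≠ 0} := isOpen_ne_fun hβ.continuous continuous_const
  -- If `β s = β t`, a coincidence at the times `s`, `t` does not involve `w₀` and forces `w₁ = F₁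
  -- (s, t)`. This is why one vector does not suffice.
  let S₁ : Set (ℝ × ℝ) := {p | β p.1 ≠ 0 ∧ p.2 ∈ O ∧ p.1 ≠ p.2}
  have hS₁ : IsOpen S₁ :=
    (hβo.preimage continuous_fst).inter ((hO.preimage continuous_snd).inter
      (isOpen_ne_fun continuous_fst continuous_snd))
  let F₁ : ℝ × ℝ → EuclideanSpace ℝ (Fin 3) :=
    fun p => (β p.1 * (p.1 - p.2))⁻¹ • (x p.2 - x p.1)
  have xfst : ∀ S : Set (ℝ × ℝ), (∀ p ∈ S, β p.1 ≠ 0) → ContDiffOn ℝ 1 (fun p => x p.1) S :=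
    fun S h => hx1.comp contDiff_fst.contDiffOn (fun p hp => hβO _ (h p hp))
  have xsnd : ∀ S : Set (ℝ × ℝ), (∀ p ∈ S, p.2 ∈ O) → ContDiffOn ℝ 1 (fun p => x p.2) S :=
    fun S h => hx1.comp contDiff_snd.contDiffOn (fun p hp => h p hp)
  have bfst : ContDiff ℝ 1 (fun p : ℝ × ℝ => β p.1) := hβ1.comp contDiff_fst
  have bsnd : ContDiff ℝ 1 (fun p : ℝ × ℝ => β p.2) := hβ1.comp contDiff_snd
  have hF₁ : ContDiffOn ℝ 1 F₁ S₁ := by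
    have i1 : ContDiffOn ℝ 1 (fun p : ℝ × ℝ => (β p.1 * (p.1 - p.2))⁻¹) S₁ :=
      (bfst.mul (contDiff_fst.sub contDiff_snd)).contDiffOn.inv
        fun p hp => mul_ne_zero hp.1 (sub_ne_zero.2 hp.2.2)
    exact i1.smul ((xsnd S₁ fun p hp => hp.2.1).sub (xfst S₁ fun p hp => hp.1))
  -- If `deriv β t = 0`, a zero velocity at `t` forces `w₁ = G₁ t`.
  let G₁ : ℝ → EuclideanSpace ℝ (Fin 3) := fun t => (β t)⁻¹ • (-deriv x t)
  have hG₁ : ContDiffOn ℝ 1 G₁ {t | β t ≠ 0} :=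
    (hβ1.contDiffOn.inv (fun t ht => ht)).smul (hx'.mono fun t ht => hβO t ht).neg
  have two : ∀ {A : Set (ℝ × ℝ)} {f : ℝ × ℝ → EuclideanSpace ℝ (Fin 3)}, IsOpen A →
      ContDiffOn ℝ 1 f A → dimH (f '' A) ≤ 2 := by
    intro A f hA hf
    simpa using dimH_image_le_of_contDiffOn hA hf
  have one : ∀ {A : Set ℝ} {f : ℝ → EuclideanSpace ℝ (Fin 3)}, IsOpen A →
      ContDiffOn ℝ 1 f A → dimH (f '' A) ≤ 2 := by
    intro A f hA hf
    refine (dimH_image_le_of_contDiffOn hA hf).trans ?_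
    simp
  -- The vector `w₁` is fixed first, since the bad values of `w₀` depend on it.
  obtain ⟨w₁, hw₁, hw₁F, hw₁G⟩ := exists_notMem_of_dimH_le_two (two hS₁ hF₁) (one hβo hG₁) hU₁
  let S₀ : Set (ℝ × ℝ) := {p | β p.1 ≠ 0 ∧ p.2 ∈ O ∧ β p.1 ≠ β p.2}
  have hS₀ : IsOpen S₀ :=
    (hβo.preimage continuous_fst).inter ((hO.preimage continuous_snd).inter
      (isOpen_ne_fun bfst.continuous bsnd.continuous))
  -- The solution for `w₀` of a coincidence at times with `β s ≠ β t`; similarly `G₀` below solves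
  -- for `w₀` a zero velocity at a time with `deriv β t ≠ 0`.
  let F₀ : ℝ × ℝ → EuclideanSpace ℝ (Fin 3) :=
    fun p => (β p.1 - β p.2)⁻¹ • ((x p.2 - x p.1) + (β p.2 * p.2 - β p.1 * p.1) • w₁)
  have hF₀ : ContDiffOn ℝ 1 F₀ S₀ := by
    have i1 : ContDiffOn ℝ 1 (fun p : ℝ × ℝ => (β p.1 - β p.2)⁻¹) S₀ :=
      (bfst.sub bsnd).contDiffOn.inv fun p hp => sub_ne_zero.2 hp.2.2
    have i2 : ContDiffOn ℝ 1 (fun p : ℝ × ℝ => (β p.2 * p.2 - β p.1 * p.1) • w₁) S₀ :=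
      (((bsnd.mul contDiff_snd).sub (bfst.mul contDiff_fst)).smul contDiff_const).contDiffOn
    exact i1.smul (((xsnd S₀ fun p hp => hp.2.1).sub (xfst S₀ fun p hp => hp.1)).add i2)
  let T : Set ℝ := {t | β t ≠ 0 ∧ deriv β t ≠ 0}
  have hT : IsOpen T := hβo.inter (isOpen_ne_fun hβ'.continuous continuous_const)
  let G₀ : ℝ → EuclideanSpace ℝ (Fin 3) :=
    fun t => (deriv β t)⁻¹ • (-deriv x t - β t • w₁) - t • w₁
  have hG₀ : ContDiffOn ℝ 1 G₀ T := by
    refine ContDiffOn.sub (ContDiffOn.smul (hβ'.contDiffOn.inv (fun t ht => ht.2)) ?_)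
      (contDiff_id.smul contDiff_const).contDiffOn
    exact (hx'.mono fun t ht => hβO t ht.1).neg.sub (hβ1.smul contDiff_const).contDiffOn
  obtain ⟨w₀, hw₀, hw₀F, hw₀G⟩ := exists_notMem_of_dimH_le_two (two hS₀ hF₀) (one hT hG₀) hU₀
  refine ⟨(w₀, w₁), hsub ⟨hw₀, hw₁⟩, ?_, ?_⟩
  · intro s t hs ht hst heq
    simp only at heq
    by_cases hb : β s = β t
    · apply hw₁F
      refine ⟨(s, t), ⟨hs, ht, hst⟩, ?_⟩
      have h1 : x t - x s = (β s * (s - t)) • w₁ := by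
        rw [← hb] at heq
        have : x t - x s = β s • (w₀ + s • w₁) - β s • (w₀ + t • w₁) := by
          rw [sub_eq_sub_iff_add_eq_add, ← heq]; abel
        rw [this]
        module
      simp only [F₁]
      rw [h1, inv_smul_smul₀ (mul_ne_zero hs (sub_ne_zero.2 hst))]
    · apply hw₀F
      refine ⟨(s, t), ⟨hs, ht, hb⟩, ?_⟩
      have h1 : (x t - x s) + (β t * t - β s * s) • w₁ = (β s - β t) • w₀ := by
        have : x t - x s = β s • (w₀ + s • w₁) - β t • (w₀ + t • w₁) := by
          rw [sub_eq_sub_iff_add_eq_add, ← heq]; abel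
        rw [this]
        module
      simp only [F₀]
      rw [h1, inv_smul_smul₀ (sub_ne_zero.2 hb)]
  · intro t ht hd
    have hxd : HasDerivAt x (deriv x t) t :=
      ((hx1.contDiffAt (hO.mem_nhds (hβO t ht))).differentiableAt (by simp)).hasDerivAt
    have hβd : HasDerivAt β (deriv β t) t := (hβ1.differentiable (by simp) t).hasDerivAt
    have hlin : HasDerivAt (fun t : ℝ => w₀ + t • w₁) w₁ t := by
      simpa using ((hasDerivAt_id t).smul_const w₁).const_add w₀
    have h1 := (hxd.fun_add (hβd.fun_smul hlin)).deriv
    simp only at hd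
    rw [h1] at hd
    by_cases hb : deriv β t = 0
    · apply hw₁G
      refine ⟨t, ht, ?_⟩
      rw [hb, zero_smul, add_zero] at hd
      simp only [G₁]
      rw [neg_eq_of_add_eq_zero_right hd, inv_smul_smul₀ ht]
    · apply hw₀G
      refine ⟨t, ⟨ht, hb⟩, ?_⟩
      have h2 : -deriv x t - β t • w₁ = deriv β t • (w₀ + t • w₁) := by
        rw [neg_eq_of_add_eq_zero_right hd]
        abel
      simp only [G₀]
      rw [h2, inv_smul_smul₀ hb]
      abel

end GeneralPosition

/-! ### Perturbation of closed curves in charts -/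

section Perturbation

variable {M : Type*} [TopologicalSpace M] [ChartedSpace (EuclideanSpace ℝ (Fin 3)) M]

/-- The times that are in the interval `(a, b)` modulo `1`. -/
def periodicIoo (a b : ℝ) : Set ℝ := {t | ∃ k : ℤ, t - k ∈ Set.Ioo a b}

theorem sub_int_mem_periodicIoo {a b t : ℝ} (k : ℤ) (h : t ∈ periodicIoo a b) :
    t - k ∈ periodicIoo a b := by
  obtain ⟨j, hj⟩ := h
  exact ⟨j - k, by push_cast; convert hj using 1; ring⟩

theorem sub_int_mem_periodicIoo_iff {a b t : ℝ} (k : ℤ) :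
    t - k ∈ periodicIoo a b ↔ t ∈ periodicIoo a b :=
  ⟨fun h => by simpa using sub_int_mem_periodicIoo (-k) h, sub_int_mem_periodicIoo k⟩

theorem periodRep_mem_Ioo {a₀ a b t : ℝ} (ha : a₀ < a) (hb : b < a₀ + 1)
    (h : t ∈ periodicIoo a b) : periodRep a₀ t ∈ Set.Ioo a b := by
  obtain ⟨k, hk⟩ := h
  have : periodRep a₀ t = t - k := by
    rw [← periodRep_of_mem (a := a₀) (t := t - k) ⟨by linarith [hk.1], by linarith [hk.2]⟩]
    exact (apply_sub_int (γ := periodRep a₀) (periodRep_add_one a₀) t k).symm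
  rwa [this]

theorem mem_periodicIoo_of_periodRep {a₀ a b t : ℝ} (h : periodRep a₀ t ∈ Set.Ioo a b) :
    t ∈ periodicIoo a b := by
  obtain ⟨k, hk⟩ := periodRep_eq a₀ t
  exact ⟨k, hk ▸ h⟩

/-- Perturbation of a closed curve on an interval that is mapped into a chart: the curve becomes
immersed there and no other point of the curve is on this part. -/
theorem exists_perturbation {e : OpenPartialHomeomorph M (EuclideanSpace ℝ (Fin 3))}
    (he : IsSmoothChart e) {γ : ℝ → M} (hγ : ContMDiff 𝓘(ℝ, ℝ) (𝓡 3) ∞ γ)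
    (hp : ∀ t, γ (t + 1) = γ t) {a b : ℝ} (hba : b < a + 1)
    (hsource : ∀ t ∈ Set.Icc a b, γ t ∈ e.source) {S : Set (ℝ × ℝ × Set M)} (hSf : S.Finite)
    (hS : ∀ x ∈ S, IsOpen x.2.2 ∧ ∀ t ∈ Set.Icc x.1 x.2.1, γ t ∈ x.2.2) :
    ∃ γ' : ℝ → M, ContMDiff 𝓘(ℝ, ℝ) (𝓡 3) ∞ γ' ∧ (∀ t, γ' (t + 1) = γ' t) ∧
      (∀ t ∉ periodicIoo a b, γ' t = γ t ∧ velocity γ' t = velocity γ t) ∧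
      (∀ t ∈ periodicIoo a b, velocity γ' t ≠ 0) ∧
      (∀ s ∈ periodicIoo a b, ∀ t, γ' s = γ' t → ∃ k : ℤ, s - t = k) ∧
      (∀ x ∈ S, ∀ t ∈ Set.Icc x.1 x.2.1, γ' t ∈ x.2.2) ∧
      ∀ (α : ModTwoCocycle M) (s t : ℝ), s ∉ periodicIoo a b → t ∉ periodicIoo a b →
        ∀ g g' : C(ℝ, M), (∀ t, g t = γ t) → (∀ t, g' t = γ' t) →
          α.onArc g' s t = α.onArc g s t := by
  -- This choice puts `[a, b]` in the middle of the period `[a₀, a₀ + 1)`, away from the jumps of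
  -- `periodRep a₀`.
  set a₀ : ℝ := (a + b - 1) / 2 with ha₀
  have h1 : a₀ < a := by rw [ha₀]; linarith
  have h2 : b < a₀ + 1 := by rw [ha₀]; linarith
  let C : Set ℝ := periodRep a₀ ⁻¹' Set.Icc a b
  have hC : IsClosed C := isClosed_periodRep_preimage h1 h2 isClosed_Icc subset_rfl
  have hCs : ∀ t ∈ C, γ t ∈ e.source := fun t ht => by
    rw [← apply_periodRep hp a₀]; exact hsource _ ht
  let β := intervalBump a b
  have hβ : ContDiff ℝ ∞ β := contDiff_intervalBump a b
  let f : EuclideanSpace ℝ (Fin 3) × EuclideanSpace ℝ (Fin 3) →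
      ℝ → EuclideanSpace ℝ (Fin 3) := fun w t => β t • (w.1 + t • w.2)
  have hf : ContDiff ℝ ∞ (Function.uncurry f) := by
    refine ContDiff.smul (hβ.comp contDiff_snd) ?_
    fun_prop
  have hf0 : ∀ w : EuclideanSpace ℝ (Fin 3) × EuclideanSpace ℝ (Fin 3), ∀ t ∉ Set.Ioo a b, f w t = 0 := by
    intro w t ht
    have : β t = 0 := by
      by_contra h
      exact ht (intervalBump_ne_zero_iff.1 h)
    simp [f, this]
  have hf0' : ∀ w : EuclideanSpace ℝ (Fin 3) × EuclideanSpace ℝ (Fin 3), ∀ t ∉ Set.Icc a b, f w t = 0 := fun w t ht =>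
    hf0 w t fun h => ht (Set.Ioo_subset_Icc_self h)
  let m : EuclideanSpace ℝ (Fin 3) × EuclideanSpace ℝ (Fin 3) →
      ℝ → EuclideanSpace ℝ (Fin 3) := fun w t => f w (periodRep a₀ t)
  have hm : ContDiff ℝ ∞ (Function.uncurry m) := contDiff_comp_periodRep hf h1 h2 hf0'
  have hm0 : ∀ w : EuclideanSpace ℝ (Fin 3) × EuclideanSpace ℝ (Fin 3), ∀ t ∉ C, m w t = 0 := fun w t ht => hf0' w _ ht
  let x : ℝ → EuclideanSpace ℝ (Fin 3) := fun t => e (γ t)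
  let O : Set ℝ := γ ⁻¹' e.source
  have hO : IsOpen O := e.open_source.preimage hγ.continuous
  have hx : ContDiffOn ℝ ∞ x O := he.contDiffOn_comp hγ
  -- small perturbations stay in the chart
  have ev1 : ∀ᶠ w : EuclideanSpace ℝ (Fin 3) × EuclideanSpace ℝ (Fin 3) in nhds 0, ∀ t ∈ Set.Icc a b, x t + f w t ∈ e.target := by
    refine isCompact_Icc.eventually_forall_of_forall_eventually fun t ht => ?_
    have hc : ContinuousAt (fun z : (EuclideanSpace ℝ (Fin 3) × EuclideanSpace ℝ (Fin 3)) × ℝ => x z.2 + f z.1 z.2) (0, t) := by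
      refine ContinuousAt.add ?_ hf.continuous.continuousAt
      have : ContinuousAt x t := hx.continuousOn.continuousAt (hO.mem_nhds (hsource t ht))
      exact ContinuousAt.comp (g := x) (f := Prod.snd) (x := ((0 : EuclideanSpace ℝ (Fin 3) × EuclideanSpace ℝ (Fin 3)), t)) this
        continuous_snd.continuousAt
    refine hc.eventually (e.open_target.mem_nhds ?_)
    have : f 0 t = 0 := by simp [f]
    simp only [this, add_zero]
    exact e.map_source (hsource t ht)
  obtain ⟨r, hr, hball⟩ := Metric.eventually_nhds_iff_ball.1 ev1
  have htarget : ∀ w ∈ Metric.ball (0 : EuclideanSpace ℝ (Fin 3) × EuclideanSpace ℝ (Fin 3)) r, ∀ t ∈ C, e (γ t) + m w t ∈ e.target := by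
    intro w hw t ht
    have := hball w hw _ ht
    simp only [x] at this
    rwa [apply_periodRep hp] at this
  have hΦ := contMDiffOn_chartModification he hγ hC hm hCs htarget hm0
  -- Finitely many conditions, open and on compact intervals, survive small perturbations.
  have ev2 : ∀ᶠ w : EuclideanSpace ℝ (Fin 3) × EuclideanSpace ℝ (Fin 3) in nhds 0, ∀ y ∈ S, ∀ t ∈ Set.Icc y.1 y.2.1,
      chartModification e γ C (m w) t ∈ y.2.2 := by
    refine (Filter.eventually_all_finite hSf).2 fun y hy => ?_
    refine isCompact_Icc.eventually_forall_of_forall_eventually fun t ht => ?_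
    have hc : ContinuousAt (fun z : (EuclideanSpace ℝ (Fin 3) × EuclideanSpace ℝ (Fin 3)) × ℝ => chartModification e γ C (m z.1) z.2) (0, t) :=
      hΦ.continuousOn.continuousAt
        (prod_mem_nhds (Metric.ball_mem_nhds 0 hr) Filter.univ_mem)
    refine hc.eventually ((hS y hy).1.mem_nhds ?_)
    have h0 : chartModification e γ C (m 0) t = γ t :=
      chartModification_of_eq_zero (hCs t) (by simp [m, f])
    simp only [h0]
    exact (hS y hy).2 t ht
  have hβO : ∀ t, β t ≠ 0 → t ∈ O := fun t ht =>
    hsource t (Set.Ioo_subset_Icc_self (intervalBump_ne_zero_iff.1 ht))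
  obtain ⟨w, ⟨hwr, hwS⟩, hinj, himm⟩ := exists_generic_vectors hO hx hβ hβO
    ((Filter.inter_mem (Metric.ball_mem_nhds (0 : EuclideanSpace ℝ (Fin 3) × EuclideanSpace ℝ (Fin 3)) hr) ev2))
  have hmw : ContDiff ℝ ∞ (m w) :=
    hm.comp (by fun_prop : ContDiff ℝ ∞ (fun t : ℝ => (w, t)))
  have hfw : ContDiff ℝ ∞ (f w) :=
    hf.comp (by fun_prop : ContDiff ℝ ∞ (fun t : ℝ => (w, t)))
  set γ' := chartModification e γ C (m w) with hγ'
  have sm : ContMDiff 𝓘(ℝ, ℝ) (𝓡 3) ∞ γ' :=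
    contMDiff_chartModification he hγ hC hmw hCs (htarget w hwr) (hm0 w)
  have per : ∀ t, γ' (t + 1) = γ' t := by
    intro t
    simp only [hγ', chartModification, C, m, Set.mem_preimage, periodRep_add_one, hp]
  have vper : ∀ t, velocity γ' (t + 1) = velocity γ' t := velocity_add_period sm per
  have vper0 : ∀ t, velocity γ (t + 1) = velocity γ t := velocity_add_period hγ hp
  have hloc : ∀ t ∈ Set.Ioo a₀ (a₀ + 1), γ t ∈ e.source →
      γ' =ᶠ[nhds t] fun y => e.symm (x y + f w y) := by
    intro t ht hts
    filter_upwards [Ioo_mem_nhds ht.1 ht.2, hO.mem_nhds hts] with y hy hyO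
    rw [hγ', chartModification_of_source hyO (hm0 w y)]
    simp only [m, x]
    rw [periodRep_of_mem (Set.Ioo_subset_Ico_self hy)]
  have hdx : ∀ t, γ t ∈ e.source → DifferentiableAt ℝ x t := fun t ht =>
    (hx.contDiffAt (hO.mem_nhds ht)).differentiableAt (by simp)
  have hdf : ∀ t, DifferentiableAt ℝ (f w) t := fun t => hfw.differentiable (by simp) t
  have hunch : ∀ t ∉ periodicIoo a b, γ' t = γ t := by
    intro t ht
    refine chartModification_of_eq_zero (hCs t) (hf0 w _ fun h => ht ?_)
    exact mem_periodicIoo_of_periodRep h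
  refine ⟨γ', sm, per, ?_, ?_, ?_, ?_, ?_⟩
  · intro t ht
    refine ⟨hunch t ht, ?_⟩
    rw [← apply_periodRep vper a₀, ← apply_periodRep vper0 a₀]
    set t' := periodRep a₀ t
    have ht' : t' ∉ Set.Ioo a b := fun h => ht (mem_periodicIoo_of_periodRep h)
    have hmem : t' ∈ Set.Ico a₀ (a₀ + 1) := periodRep_mem a₀ t
    by_cases hC' : t' ∈ Set.Icc a b
    · have hs := hsource t' hC'
      have h3 : t' ∈ Set.Ioo a₀ (a₀ + 1) := ⟨by linarith [hC'.1], hmem.2⟩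
      have hz : f w t' = 0 := hf0 w t' ht'
      -- At the ends `a` and `b` both the bump and its derivative vanish, so position and velocity
      -- are kept there.
      have hd : deriv (f w) t' = 0 := by
        have h5 := (((hβ.differentiable (by simp)) t').hasDerivAt.fun_smul
          ((by fun_prop : DifferentiableAt ℝ (fun t : ℝ => w.1 + t • w.2) t').hasDerivAt)).deriv
        have h6 : β t' = 0 := by
          by_contra h
          exact ht' (intervalBump_ne_zero_iff.1 h)
        rw [h6, deriv_intervalBump_of_notMem ht'] at h5
        simpa only [zero_smul, add_zero] using h5
      rw [he.velocity_eq (f := fun y => x y + f w y) ((hdx t' hs).fun_add (hdf t'))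
        (by simpa [hz, x] using e.map_source hs) (hloc t' h3 hs),
        he.velocity_eq (γ := γ) (f := x) (hdx t' hs) (e.map_source hs) ?_,
        deriv_fun_add (hdx t' hs) (hdf t'), hd, hz, add_zero, add_zero]
      filter_upwards [hO.mem_nhds hs] with y hy
      exact (e.left_inv hy).symm
    · refine velocity_congr ?_
      have : t' ∉ C := by
        change periodRep a₀ t' ∉ Set.Icc a b
        rwa [periodRep_of_mem hmem]
      filter_upwards [hC.isOpen_compl.mem_nhds this] with y hy
      exact chartModification_of_notMem hy
  · intro t ht
    rw [← apply_periodRep vper a₀]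
    have ht' := periodRep_mem_Ioo h1 h2 ht
    set t' := periodRep a₀ t
    have hs := hsource t' (Set.Ioo_subset_Icc_self ht')
    have h3 : t' ∈ Set.Ioo a₀ (a₀ + 1) := ⟨by linarith [ht'.1], by linarith [ht'.2]⟩
    rw [Ne, he.velocity_eq_zero_iff (f := fun y => x y + f w y) ((hdx t' hs).fun_add (hdf t')) ?_
      (hloc t' h3 hs)]
    · exact himm t' (intervalBump_ne_zero_iff.2 ht')
    · exact hball w hwr t' (Set.Ioo_subset_Icc_self ht')
  · intro s hs t hst
    have hs' := periodRep_mem_Ioo h1 h2 hs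
    rw [← apply_periodRep per a₀ s, ← apply_periodRep per a₀ t] at hst
    obtain ⟨k, hk⟩ := periodRep_eq a₀ s
    obtain ⟨j, hj⟩ := periodRep_eq a₀ t
    have hmt := periodRep_mem a₀ t
    set s' := periodRep a₀ s
    set t' := periodRep a₀ t
    have hrs : periodRep a₀ s' = s' := periodRep_of_mem (periodRep_mem a₀ s)
    have hrt : periodRep a₀ t' = t' := periodRep_of_mem hmt
    suffices h : s' = t' by
      refine ⟨k - j, ?_⟩
      push_cast
      linarith
    by_contra hne
    have hsC : s' ∈ C := by
      change periodRep a₀ s' ∈ Set.Icc a b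
      rw [hrs]; exact Set.Ioo_subset_Icc_self hs'
    have es : γ' s' = e.symm (x s' + f w s') := by
      rw [hγ', chartModification_of_mem hsC]
      simp only [m, hrs, x]
    have hst1 := hball w hwr s' (Set.Ioo_subset_Icc_self hs')
    by_cases htO : t' ∈ O
    · have et : γ' t' = e.symm (x t' + f w t') := by
        rw [hγ', chartModification_of_source htO (hm0 w t')]
        simp only [m, hrt, x]
      have htt : x t' + f w t' ∈ e.target := by
        by_cases htI : t' ∈ Set.Icc a b
        · exact hball w hwr t' htI
        · rw [hf0' w t' htI, add_zero]
          exact e.map_source htO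
      rw [es, et] at hst
      exact hinj s' t' (intervalBump_ne_zero_iff.2 hs') htO hne (e.symm.injOn hst1 htt hst)
    -- Here `γ t'` is outside the chart and unchanged, whereas the perturbed point `γ' s'` is inside
    -- the chart.
    · have htC : t' ∉ C := fun h => htO (hCs t' h)
      have et : γ' t' = γ t' := chartModification_of_notMem htC
      apply htO
      change γ t' ∈ e.source
      rw [← et, ← hst, es]
      exact e.map_target hst1
  · exact hwS
  · intro α s t hs ht g g' hg hg'
    have hz : ∀ t ∉ periodicIoo a b, m w t = 0 := fun t ht =>
      hf0 w _ fun h => ht (mem_periodicIoo_of_periodRep h)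
    refine onArc_chartModification he hγ hC hmw hCs ?_ (hm0 w) α (Or.inl (hz s hs))
      (Or.inl (hz t ht)) g g' hg hg'
    intro r' hr' t ht
    -- The perturbation is linear in `w`, so the straight homotopy to it stays among the admissible
    -- perturbations of the ball.
    have h3 : r' • m w t = m (r' • w) t := by
      simp only [m, f, Prod.smul_fst, Prod.smul_snd]
      module
    rw [h3]
    refine htarget _ ?_ t ht
    rw [mem_ball_zero_iff] at hwr ⊢
    calc ‖r' • w‖ = |r'| * ‖w‖ := norm_smul _ _
      _ ≤ 1 * ‖w‖ := by gcongr; rw [abs_of_nonneg hr'.1]; exact hr'.2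
      _ < r := by rwa [one_mul]

/-- General position: a closed curve can be made immersed and injective on finitely many
intervals, each of which is mapped into a chart, without changing it elsewhere. -/
theorem exists_general_position [IsManifold (𝓡 3) ∞ M] (Ls : List (ℝ × ℝ × M)) :
    ∀ {γ : ℝ → M}, ContMDiff 𝓘(ℝ, ℝ) (𝓡 3) ∞ γ → (∀ t, γ (t + 1) = γ t) →
    (∀ x ∈ Ls, x.1 < x.2.1 ∧ x.2.1 < x.1 + 1 ∧ ∀ t ∈ Set.Icc x.1 x.2.1,
      γ t ∈ (chartAt (EuclideanSpace ℝ (Fin 3)) x.2.2).source) →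
    ∃ γ' : ℝ → M, ContMDiff 𝓘(ℝ, ℝ) (𝓡 3) ∞ γ' ∧ (∀ t, γ' (t + 1) = γ' t) ∧
      (∀ t, (∀ x ∈ Ls, t ∉ periodicIoo x.1 x.2.1) → γ' t = γ t ∧ velocity γ' t = velocity γ t) ∧
      (∀ x ∈ Ls, ∀ t ∈ periodicIoo x.1 x.2.1, velocity γ' t ≠ 0) ∧
      (∀ x ∈ Ls, ∀ s ∈ periodicIoo x.1 x.2.1, ∀ t, γ' s = γ' t → ∃ k : ℤ, s - t = k) ∧
      ∀ (α : ModTwoCocycle M) (s t : ℝ), (∀ x ∈ Ls, s ∉ periodicIoo x.1 x.2.1) →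
        (∀ x ∈ Ls, t ∉ periodicIoo x.1 x.2.1) →
        ∀ g g' : C(ℝ, M), (∀ t, g t = γ t) → (∀ t, g' t = γ' t) →
          α.onArc g' s t = α.onArc g s t := by
  induction Ls with
  | nil =>
    intro γ hγ hp _
    refine ⟨γ, hγ, hp, fun t _ => ⟨rfl, rfl⟩, by simp, by simp, ?_⟩
    intro α s t _ _ g g' hg hg'
    have : g' = g := by ext t; rw [hg, hg']
    rw [this]
  | cons y Ls ih =>
    intro γ hγ hp hL
    obtain ⟨h1, h2, h3⟩ := hL y List.mem_cons_self
    -- The first perturbation must leave the remaining intervals in their charts, otherwise the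
    -- induction could not continue.
    let S : Set (ℝ × ℝ × Set M) :=
      (fun x : ℝ × ℝ × M => (x.1, x.2.1, (chartAt (EuclideanSpace ℝ (Fin 3)) x.2.2).source)) ''
        {x | x ∈ Ls}
    have hSf : S.Finite := (List.finite_toSet Ls).image _
    obtain ⟨γ₁, sm₁, per₁, un₁, imm₁, inj₁, st₁, al₁⟩ :=
      exists_perturbation (isSmoothChart_chartAt y.2.2) hγ hp h2 h3 hSf (by
        rintro _ ⟨x, hx, rfl⟩
        exact ⟨(chartAt (EuclideanSpace ℝ (Fin 3)) x.2.2).open_source,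
          (hL x (List.mem_cons_of_mem _ hx)).2.2⟩)
    obtain ⟨γ₂, sm₂, per₂, un₂, imm₂, inj₂, al₂⟩ := ih sm₁ per₁ (by
      intro x hx
      obtain ⟨h4, h5, -⟩ := hL x (List.mem_cons_of_mem _ hx)
      exact ⟨h4, h5, st₁ _ ⟨x, hx, rfl⟩⟩)
    refine ⟨γ₂, sm₂, per₂, ?_, ?_, ?_, ?_⟩
    · intro t ht
      have a1 := un₁ t (ht y List.mem_cons_self)
      have a2 := un₂ t (fun x hx => ht x (List.mem_cons_of_mem _ hx))
      exact ⟨a2.1.trans a1.1, a2.2.trans a1.2⟩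
    · intro x hx t ht
      -- A time in a later interval is handled by the later perturbations; at any other time these
      -- preserve what the first perturbation has achieved.
      by_cases h : ∃ z ∈ Ls, t ∈ periodicIoo z.1 z.2.1
      · obtain ⟨z, hz, htz⟩ := h
        exact imm₂ z hz t htz
      · push Not at h
        rw [(un₂ t h).2]
        rcases List.mem_cons.1 hx with rfl | hx
        · exact imm₁ t ht
        · exact absurd ht (h x hx)
    · intro x hx s hs t hst
      by_cases h : ∃ z ∈ Ls, s ∈ periodicIoo z.1 z.2.1
      · obtain ⟨z, hz, hsz⟩ := h
        exact inj₂ z hz s hsz t hst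
      · push Not at h
        rcases List.mem_cons.1 hx with rfl | hx
        · by_cases h' : ∃ z ∈ Ls, t ∈ periodicIoo z.1 z.2.1
          · obtain ⟨z, hz, htz⟩ := h'
            obtain ⟨k, hk⟩ := inj₂ z hz t htz s hst.symm
            exact ⟨-k, by push_cast; linarith⟩
          · push Not at h'
            rw [(un₂ s h).1, (un₂ t h').1] at hst
            exact inj₁ s hs t hst
        · exact absurd hs (h x hx)
    · intro α s t hs ht g g' hg hg'
      let g₁ : C(ℝ, M) := ⟨γ₁, sm₁.continuous⟩
      rw [al₂ α s t (fun x hx => hs x (List.mem_cons_of_mem _ hx))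
        (fun x hx => ht x (List.mem_cons_of_mem _ hx)) g₁ g' (fun _ => rfl) hg',
        al₁ α s t (hs y List.mem_cons_self) (ht y List.mem_cons_self) g g₁ hg (fun _ => rfl)]

end Perturbation

/-! ### Positively oriented charts -/

section OrientedChart

variable {M : Type*} [TopologicalSpace M] [ChartedSpace (EuclideanSpace ℝ (Fin 3)) M]

theorem det_of_map (A : EuclideanSpace ℝ (Fin 3) →L[ℝ] EuclideanSpace ℝ (Fin 3))
    (e₁ e₂ e₃ : EuclideanSpace ℝ (Fin 3)) :
    (Matrix.of ![(A e₁).ofLp, (A e₂).ofLp, (A e₃).ofLp]).det =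
      A.det * (Matrix.of ![e₁.ofLp, e₂.ofLp, e₃.ofLp]).det := by
  let b := (EuclideanSpace.basisFun (Fin 3) ℝ).toBasis
  have h := b.det_comp (A : EuclideanSpace ℝ (Fin 3) →ₗ[ℝ] EuclideanSpace ℝ (Fin 3)) ![e₁, e₂, e₃]
  have key : ∀ v : Fin 3 → EuclideanSpace ℝ (Fin 3),
      b.det v = (Matrix.of ![(v 0).ofLp, (v 1).ofLp, (v 2).ofLp]).det := by
    intro v
    rw [Module.Basis.det_apply, ← Matrix.det_transpose]
    congr 1
    ext i j
    fin_cases i <;> simp [b, Module.Basis.toMatrix_apply]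
  rw [key, key] at h
  simpa using h

/-- Tangent spaces are identified with `ℝ³` by the preferred charts, so the frame is the derivative
of a transition map. This links it with `ManifoldOrientation.locally_constant`. -/
theorem chartFrame_eq_fderiv {e : OpenPartialHomeomorph M (EuclideanSpace ℝ (Fin 3))}
    (he : IsSmoothChart e) {z : EuclideanSpace ℝ (Fin 3)} (hz : z ∈ e.target) :
    chartFrame e z = fderiv ℝ (chartAt (EuclideanSpace ℝ (Fin 3)) (e.symm z) ∘ e.symm) z := by
  have h : MDifferentiableAt (𝓡 3) (𝓡 3) e.symm z := he.mdifferentiable.mdifferentiableAt_symm hz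
  unfold chartFrame
  simp only [mfderiv, h]
  simp only [writtenInExtChartAt, Function.comp_def, extChartAt, chartAt_self_eq]
  simp

theorem IsSmoothChart.contDiffAt_chartAt_comp [IsManifold (𝓡 3) ∞ M]
    {e : OpenPartialHomeomorph M (EuclideanSpace ℝ (Fin 3))}
    (he : IsSmoothChart e) {x : M} {z : EuclideanSpace ℝ (Fin 3)} (hz : z ∈ e.target)
    (hx : e.symm z ∈ (chartAt (EuclideanSpace ℝ (Fin 3)) x).source) :
    ContDiffAt ℝ ∞ (chartAt (EuclideanSpace ℝ (Fin 3)) x ∘ e.symm) z := by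
  rw [← contMDiffAt_iff_contDiffAt]
  exact ((isSmoothChart_chartAt x).smooth.contMDiffAt
    ((chartAt (EuclideanSpace ℝ (Fin 3)) x).open_source.mem_nhds hx)).comp z
    (he.smooth_symm.contMDiffAt (e.open_target.mem_nhds hz))

theorem chartFrame_det_ne_zero {e : OpenPartialHomeomorph M (EuclideanSpace ℝ (Fin 3))}
    (he : IsSmoothChart e) {z : EuclideanSpace ℝ (Fin 3)} (hz : z ∈ e.target) :
    (chartFrame e z).det ≠ 0 := by
  intro h
  have h1 : LinearMap.ker (chartFrame e z).toLinearMap = ⊥ :=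
    LinearMap.ker_eq_bot.2 (he.chartFrame_injective hz)
  exact (LinearMap.bot_lt_ker_of_det_eq_zero h).ne' h1

/-- The sign with which a chart compares the orientations. -/
def orientationSign (o : ManifoldOrientation M)
    (e : OpenPartialHomeomorph M (EuclideanSpace ℝ (Fin 3))) (z : EuclideanSpace ℝ (Fin 3)) : ℝ :=
  ((o.sign (e.symm z) : ℤ) : ℝ) * (chartFrame e z).det

theorem orientationSign_ne_zero (o : ManifoldOrientation M)
    {e : OpenPartialHomeomorph M (EuclideanSpace ℝ (Fin 3))}
    (he : IsSmoothChart e) {z : EuclideanSpace ℝ (Fin 3)} (hz : z ∈ e.target) :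
    orientationSign o e z ≠ 0 := by
  unfold orientationSign
  refine mul_ne_zero ?_ (chartFrame_det_ne_zero he hz)
  rcases Int.units_eq_one_or (o.sign (e.symm z)) with h | h <;> simp [h]

/-- The frame at `z'` factors through the preferred chart at `e.symm z`. The determinant of one
factor is continuous and nonzero at `z`, and the sign of the other is controlled by the local
constancy of the orientation. -/
theorem orientationSign_eventually [IsManifold (𝓡 3) ∞ M] (o : ManifoldOrientation M)
    {e : OpenPartialHomeomorph M (EuclideanSpace ℝ (Fin 3))}
    (he : IsSmoothChart e) {z : EuclideanSpace ℝ (Fin 3)} (hz : z ∈ e.target) :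
    ∀ᶠ z' in nhds z, 0 < orientationSign o e z * orientationSign o e z' := by
  set x := e.symm z with hx
  let φ := chartAt (EuclideanSpace ℝ (Fin 3)) x
  have hc : ContinuousAt e.symm z := e.symm.continuousAt hz
  have hxs : e.symm z ∈ φ.source := mem_chart_source _ x
  have hev : ∀ᶠ z' in nhds z, e.symm z' ∈ φ.source :=
    hc.eventually (φ.open_source.mem_nhds hxs)
  have hD := he.contDiffAt_chartAt_comp hz hxs
  have hdc : ContinuousAt (fun z' => (fderiv ℝ (φ ∘ e.symm) z').det) z := by
    have h1 : ContinuousAt (fderiv ℝ (φ ∘ e.symm)) z :=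
      (hD.fderiv_right (m := 0) (by norm_num)).continuousAt
    exact (ContinuousLinearMap.continuous_det).continuousAt.comp h1
  have hd0 : (fderiv ℝ (φ ∘ e.symm) z).det ≠ 0 := by
    rw [← chartFrame_eq_fderiv he hz]
    exact chartFrame_det_ne_zero he hz
  have hpos : ∀ᶠ z' in nhds z,
      0 < (fderiv ℝ (φ ∘ e.symm) z).det * (fderiv ℝ (φ ∘ e.symm) z').det :=
    (continuousAt_const.mul hdc).eventually (lt_mem_nhds (mul_self_pos.2 hd0))
  filter_upwards [hev, hpos, e.open_target.mem_nhds hz, hc.eventually (o.locally_constant x)]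
    with z' h1 h2 h3 h4
  have hcomp : chartFrame e z' =
      (fderiv ℝ (chartAt (EuclideanSpace ℝ (Fin 3)) (e.symm z') ∘ φ.symm) (φ (e.symm z'))).comp
        (fderiv ℝ (φ ∘ e.symm) z') := by
    rw [chartFrame_eq_fderiv he h3]
    have hA : DifferentiableAt ℝ (chartAt (EuclideanSpace ℝ (Fin 3)) (e.symm z') ∘ φ.symm)
        (φ (e.symm z')) := by
      refine ((isSmoothChart_chartAt x).contDiffAt_chartAt_comp (φ.map_source h1) ?_).differentiableAt
        (by simp)
      rw [φ.left_inv h1]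
      exact mem_chart_source _ _
    have hB : DifferentiableAt ℝ (φ ∘ e.symm) z' :=
      (he.contDiffAt_chartAt_comp h3 h1).differentiableAt (by simp)
    refine Eq.trans ?_ (fderiv_comp z' hA hB)
    refine Filter.EventuallyEq.fderiv_eq ?_
    have : ∀ᶠ y in nhds z', e.symm y ∈ φ.source :=
      (e.symm.continuousAt h3).eventually (φ.open_source.mem_nhds h1)
    filter_upwards [this] with y hy
    simp [φ.left_inv hy]
  have hdet : (chartFrame e z').det =
      (fderiv ℝ (chartAt (EuclideanSpace ℝ (Fin 3)) (e.symm z') ∘ φ.symm) (φ (e.symm z'))).det *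
        (fderiv ℝ (φ ∘ e.symm) z').det := by
    rw [hcomp]
    exact LinearMap.det_comp _ _
  unfold orientationSign
  rw [hdet, chartFrame_eq_fderiv he hz]
  have := mul_pos h4 h2
  refine this.trans_eq ?_
  push_cast
  simp only [φ, x]
  ring

/-- Around every point there is a chart onto the whole space that preserves the orientation. -/
theorem exists_oriented_chart [IsManifold (𝓡 3) ∞ M] (o : ManifoldOrientation M) (x₀ : M) :
    ∃ e : OpenPartialHomeomorph M (EuclideanSpace ℝ (Fin 3)), IsSmoothChart e ∧
      e.target = Set.univ ∧ e.symm 0 = x₀ ∧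
      ∀ z e₁ e₂ e₃, 0 < (Matrix.of ![e₁.ofLp, e₂.ofLp, e₃.ofLp]).det →
        o.IsPositive (e.symm z) (chartFrame e z e₁) (chartFrame e z e₂) (chartFrame e z e₃) := by
  let φ := chartAt (EuclideanSpace ℝ (Fin 3)) x₀
  have hφ : IsSmoothChart φ := isSmoothChart_chartAt x₀
  obtain ⟨r, hr, hball⟩ := Metric.isOpen_iff.1 φ.open_target (φ x₀)
    (φ.map_source (mem_chart_source _ x₀))
  -- A diffeomorphism of `ℝ³` onto a ball in the target; composing with it makes the chart
  -- surjective.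
  let U := OpenPartialHomeomorph.univBall (φ x₀) r
  have hUt : U.target = Metric.ball (φ x₀) r := OpenPartialHomeomorph.univBall_target _ hr
  have hUs : U.source = Set.univ := OpenPartialHomeomorph.univBall_source _ _
  have hU : ∀ z, U z ∈ φ.target := fun z => hball (hUt ▸ U.map_source (hUs ▸ Set.mem_univ z))
  let e := φ.trans U.symm
  have het : e.target = Set.univ := by
    ext z
    simp only [e, OpenPartialHomeomorph.trans_target, OpenPartialHomeomorph.symm_target, hUs,
      OpenPartialHomeomorph.symm_symm, Set.univ_inter, Set.mem_preimage, Set.mem_univ, iff_true]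
    exact hU z
  have he : IsSmoothChart e := by
    constructor
    · have h1 : ContMDiffOn (𝓡 3) (𝓡 3) ∞ U.symm (Metric.ball (φ x₀) r) :=
        (OpenPartialHomeomorph.contDiffOn_univBall_symm).contMDiffOn
      refine h1.comp (hφ.smooth.mono ?_) ?_
      · intro x hx
        exact hx.1
      · intro x hx
        rw [← hUt]
        exact hx.2
    · have h1 : ContMDiff (𝓡 3) (𝓡 3) ∞ U :=
        (OpenPartialHomeomorph.contDiff_univBall).contMDiff
      exact hφ.smooth_symm.comp h1.contMDiffOn (fun z _ => hU z)
  have he0 : e.symm 0 = x₀ := by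
    have : U 0 = φ x₀ := OpenPartialHomeomorph.univBall_apply_zero _ _
    simp [e, this]
    exact φ.left_inv (mem_chart_source _ x₀)
  -- A locally constant sign on the connected space `ℝ³` is constant.
  have hpos : (∀ z, 0 < orientationSign o e z) ∨ ∀ z, orientationSign o e z < 0 := by
    let f : EuclideanSpace ℝ (Fin 3) → SignType := fun z => SignType.sign (orientationSign o e z)
    have hf : IsLocallyConstant f := by
      rw [IsLocallyConstant.iff_eventually_eq]
      intro z
      filter_upwards [orientationSign_eventually o he (z := z) (by simp [het])] with z' h
      rcases pos_and_pos_or_neg_and_neg_of_mul_pos h with ⟨h1, h2⟩ | ⟨h1, h2⟩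
      · simp [f, h1, h2]
      · simp [f, h1, h2]
    have hne := orientationSign_ne_zero o he (z := 0) (by simp [het])
    rcases lt_or_gt_of_ne hne with h | h
    · right
      intro z
      have := hf.apply_eq_of_isPreconnected isPreconnected_univ (Set.mem_univ z) (Set.mem_univ 0)
      simp only [f, sign_neg h] at this
      exact sign_eq_neg_one_iff.1 this
    · left
      intro z
      have := hf.apply_eq_of_isPreconnected isPreconnected_univ (Set.mem_univ z) (Set.mem_univ 0)
      simp only [f, sign_pos h] at this
      exact sign_eq_one_iff.1 this
  rcases hpos with hpos | hneg
  · refine ⟨e, he, het, he0, fun z e₁ e₂ e₃ h => ?_⟩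
    unfold ManifoldOrientation.IsPositive
    rw [det_of_map, ← mul_assoc]
    exact mul_pos (hpos z) h
  -- Negation reverses the orientation because the dimension is odd.
  · let n := (Homeomorph.neg (EuclideanSpace ℝ (Fin 3))).toOpenPartialHomeomorph
    let e' := e.trans n
    have het' : e'.target = Set.univ := by
      ext z
      simp [e', n, het]
    have he' : IsSmoothChart e' := by
      constructor
      · have h1 : ContMDiff (𝓡 3) (𝓡 3) ∞ n := (contDiff_neg (𝕜 := ℝ)).contMDiff
        refine h1.comp_contMDiffOn (he.smooth.mono ?_)
        intro x hx
        exact hx.1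
      · have h1 : ContMDiff (𝓡 3) (𝓡 3) ∞ n.symm := (contDiff_neg (𝕜 := ℝ)).contMDiff
        exact he.smooth_symm.comp h1.contMDiffOn (fun z _ => by simp [het])
    have hfr : ∀ z v, chartFrame e' z v = chartFrame e (-z) (-v) := by
      intro z v
      have h1 := he'.velocity_eq (γ := fun t : ℝ => e'.symm (z + t • v)) (f := fun t => z + t • v)
        (t := 0) (by fun_prop) (by simp [het']) (Filter.EventuallyEq.refl _ _)
      have h2 := he.velocity_eq (γ := fun t : ℝ => e'.symm (z + t • v))
        (f := fun t => -z + t • (-v))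
        (t := 0) (by fun_prop) (by simp [het]) (Filter.Eventually.of_forall fun t => by
          simp only [e', n, OpenPartialHomeomorph.trans_symm_eq_symm_trans_symm,
            OpenPartialHomeomorph.coe_trans, Function.comp_apply]
          congr 1
          simp
          abel)
      have d : ∀ w u : EuclideanSpace ℝ (Fin 3), deriv (fun t : ℝ => w + t • u) 0 = u := by
        intro w u
        have : HasDerivAt (fun t : ℝ => w + t • u) u 0 := by
          simpa using ((hasDerivAt_id (0 : ℝ)).smul_const u).const_add w
        exact this.deriv
      rw [d] at h1 h2
      simp only [zero_smul, add_zero] at h1 h2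
      rw [← h1, h2]
    refine ⟨e', he', het', ?_, fun z e₁ e₂ e₃ h => ?_⟩
    · simp [e', n, he0]
    · unfold ManifoldOrientation.IsPositive
      have h1 : e'.symm z = e.symm (-z) := by simp [e', n]
      rw [hfr, hfr, hfr, h1, det_of_map, ← mul_assoc]
      refine mul_pos_of_neg_of_neg (hneg (-z)) ?_
      have h2 : (Matrix.of ![(-e₁).ofLp, (-e₂).ofLp, (-e₃).ofLp]) =
          -(Matrix.of ![e₁.ofLp, e₂.ofLp, e₃.ofLp]) := by
        ext i j
        fin_cases i <;> simp
      rw [h2, Matrix.det_neg]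
      simpa [pow_succ] using h

end OrientedChart

/-! ### A closed curve in general position with prescribed multiple points -/

section BaseCurve

/-- A smooth function that is `1` for `|x| ≤ r` and `0` for `|x| ≥ R`. -/
def plateau (r R x : ℝ) : ℝ := Real.smoothTransition ((R ^ 2 - x ^ 2) / (R ^ 2 - r ^ 2))

theorem contDiff_plateau (r R : ℝ) : ContDiff ℝ ∞ (plateau r R) :=
  Real.smoothTransition.contDiff.comp (by fun_prop)

theorem plateau_eq_one {r R x : ℝ} (hr : 0 ≤ r) (hR : r < R) (hx : |x| ≤ r) :
    plateau r R x = 1 := by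
  refine Real.smoothTransition.one_of_one_le ?_
  have h1 : x ^ 2 ≤ r ^ 2 := sq_le_sq.2 (by rwa [abs_of_nonneg hr])
  rw [le_div_iff₀ (by nlinarith)]
  linarith

theorem plateau_eq_zero {r R x : ℝ} (hr : 0 ≤ r) (hR : r < R) (hx : R ≤ |x|) :
    plateau r R x = 0 := by
  refine Real.smoothTransition.zero_of_nonpos ?_
  have h1 : R ^ 2 ≤ x ^ 2 := sq_le_sq.2 (by rwa [abs_of_nonneg (hr.trans hR.le)])
  refine div_nonpos_of_nonpos_of_nonneg (by linarith) (by nlinarith)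

/-- `N` equidistant times between `0` and `1`. -/
def slotTime (N : ℕ) (j : Fin N) : ℝ := ((j : ℝ) + 1) / (N + 1)

/-- An eighth of the distance of the times `slotTime`. -/
def slotRadius (N : ℕ) : ℝ := 1 / (8 * (N + 1))

theorem slotRadius_pos (N : ℕ) : 0 < slotRadius N := by unfold slotRadius; positivity

theorem slotTime_eq (N : ℕ) (j : Fin N) : slotTime N j = 8 * slotRadius N * (j + 1) := by
  unfold slotTime slotRadius; field_simp

theorem slotTime_ge (N : ℕ) (j : Fin N) : 8 * slotRadius N ≤ slotTime N j := by
  rw [slotTime_eq]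
  have : (0 : ℝ) ≤ j := by positivity
  nlinarith [slotRadius_pos N]

theorem slotTime_le (N : ℕ) (j : Fin N) : slotTime N j ≤ 1 - 8 * slotRadius N := by
  have h1 : 8 * slotRadius N * (N + 1) = 1 := by unfold slotRadius; field_simp
  have h2 : (j : ℝ) + 1 ≤ N := by exact_mod_cast j.2
  rw [slotTime_eq]
  nlinarith [slotRadius_pos N]

theorem slotTime_add_le {N : ℕ} {i j : Fin N} (h : i < j) :
    slotTime N i + 8 * slotRadius N ≤ slotTime N j := by
  have h2 : (i : ℝ) + 1 ≤ j := by exact_mod_cast h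
  rw [slotTime_eq, slotTime_eq]
  nlinarith [slotRadius_pos N]

theorem slotTime_dist {N : ℕ} {i j : Fin N} (h : i ≠ j) :
    8 * slotRadius N ≤ |slotTime N i - slotTime N j| := by
  rcases lt_or_gt_of_ne h with h | h
  · have := slotTime_add_le h
    rw [abs_sub_comm]
    exact (by linarith : _ ≤ slotTime N j - slotTime N i).trans (le_abs_self _)
  · have := slotTime_add_le h
    exact (by linarith : _ ≤ slotTime N i - slotTime N j).trans (le_abs_self _)

/-- A sum of functions supported near the times `slotTime` has one summand at most. -/
theorem sum_slots_eq {N : ℕ} {F : Type*} [AddCommMonoid F] {f : Fin N → ℝ → F} {r : ℝ}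
    (hr : r ≤ 4 * slotRadius N) (hf : ∀ j t, r ≤ |t - slotTime N j| → f j t = 0) {j : Fin N}
    {t : ℝ} (ht : |t - slotTime N j| ≤ 4 * slotRadius N) : ∑ i, f i t = f j t := by
  refine Finset.sum_eq_single j (fun i _ hij => hf i t ?_) (by simp)
  have h1 := slotTime_dist hij
  have h2 := abs_sub_le (slotTime N i) t (slotTime N j)
  rw [abs_sub_comm (slotTime N i) t] at h2
  linarith

theorem sum_slots_eq_zero {N : ℕ} {F : Type*} [AddCommMonoid F] {f : Fin N → ℝ → F} {r : ℝ}
    (hf : ∀ j t, r ≤ |t - slotTime N j| → f j t = 0)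
    {t : ℝ} (ht : ∀ j, r ≤ |t - slotTime N j|) : ∑ i, f i t = 0 :=
  Finset.sum_eq_zero fun i _ => hf i t (ht i)

theorem slot_mem_Icc {N : ℕ} {r t : ℝ} (hr : r ≤ 4 * slotRadius N) {j : Fin N}
    (ht : |t - slotTime N j| ≤ r) : t ∈ Set.Icc (4 * slotRadius N) (1 - 4 * slotRadius N) := by
  have h1 := slotTime_ge N j
  have h2 := slotTime_le N j
  have h3 := abs_le.1 ht
  constructor <;> linarith [h3.1, h3.2]

/-- The closed set of times near the times `slotTime`, modulo `1`. -/
def slotWindows (N : ℕ) (r : ℝ) : Set ℝ := periodRep 0 ⁻¹' {t | ∃ j, |t - slotTime N j| ≤ r}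

theorem isClosed_slotWindows {N : ℕ} {r : ℝ} (hr : r ≤ 4 * slotRadius N) :
    IsClosed (slotWindows N r) := by
  refine isClosed_periodRep_preimage (b := 4 * slotRadius N) (c := 1 - 4 * slotRadius N)
    (by linarith [slotRadius_pos N]) (by linarith [slotRadius_pos N]) ?_ ?_
  · have : {t : ℝ | ∃ j, |t - slotTime N j| ≤ r} = ⋃ j, {t | |t - slotTime N j| ≤ r} := by
      ext t; simp
    rw [this]
    exact isClosed_iUnion_of_finite fun j => isClosed_le (by fun_prop) continuous_const
  · rintro t ⟨j, hj⟩
    exact slot_mem_Icc hr hj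

theorem mem_slotWindows_iff {N : ℕ} {r t : ℝ} (ht : t ∈ Set.Ico (0 : ℝ) 1) :
    t ∈ slotWindows N r ↔ ∃ j, |t - slotTime N j| ≤ r := by
  change (∃ j, |periodRep 0 t - slotTime N j| ≤ r) ↔ _
  rw [periodRep_of_mem (by simpa using ht)]

theorem contDiff_slots {N : ℕ} {P : Type*} [NormedAddCommGroup P] [NormedSpace ℝ P]
    {F : Type*} [NormedAddCommGroup F] [NormedSpace ℝ F] {f : Fin N → P → ℝ → F} {r : ℝ}
    (hr : r ≤ 4 * slotRadius N) (hf : ∀ j p t, r ≤ |t - slotTime N j| → f j p t = 0)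
    (hs : ∀ j, ContDiff ℝ ∞ (Function.uncurry (f j))) :
    ContDiff ℝ ∞ (Function.uncurry fun p t => ∑ j, f j p (periodRep 0 t)) := by
  refine contDiff_comp_periodRep (f := fun p t => ∑ j, f j p t) (b := 4 * slotRadius N)
    (c := 1 - 4 * slotRadius N) ?_ (by linarith [slotRadius_pos N])
    (by linarith [slotRadius_pos N]) ?_
  · exact ContDiff.sum fun j _ => hs j
  · intro p t ht
    refine sum_slots_eq_zero (r := r) (f := fun j => f j p) (fun j t => hf j p t) fun j => ?_
    by_contra h
    exact ht (slot_mem_Icc hr (not_le.1 h).le)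

theorem contDiff_slots_single {N : ℕ} {F : Type*} [NormedAddCommGroup F] [NormedSpace ℝ F]
    {f : Fin N → ℝ → F} {r : ℝ} (hr : r ≤ 4 * slotRadius N)
    (hf : ∀ j t, r ≤ |t - slotTime N j| → f j t = 0) (hs : ∀ j, ContDiff ℝ ∞ (f j)) :
    ContDiff ℝ ∞ (fun t => ∑ j, f j (periodRep 0 t)) := by
  refine contDiff_comp_periodRep_single (f := fun t => ∑ j, f j t) (b := 4 * slotRadius N)
    (c := 1 - 4 * slotRadius N) (ContDiff.sum fun j _ => hs j) (by linarith [slotRadius_pos N])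
    (by linarith [slotRadius_pos N]) fun t ht => ?_
  refine sum_slots_eq_zero (r := r) hf fun j => ?_
  by_contra h
  exact ht (slot_mem_Icc hr (not_le.1 h).le)

variable {M : Type*} [TopologicalSpace M] [ChartedSpace (EuclideanSpace ℝ (Fin 3)) M]

/-- The curve before it is brought into general position. -/
theorem exists_slot_curve {e : OpenPartialHomeomorph M (EuclideanSpace ℝ (Fin 3))}
    (he : IsSmoothChart e) (het : e.target = Set.univ) {L : ℝ → M}
    (hL : ContMDiff 𝓘(ℝ, ℝ) (𝓡 3) ∞ L) (hL0 : L 0 = e.symm 0) (hL1 : L 1 = e.symm 0) {N : ℕ}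
    (c V : Fin N → EuclideanSpace ℝ (Fin 3)) (g : Fin N → ℝ) (hg : ∀ j, g j = 0 ∨ g j = 1) :
    ∃ γ : ℝ → M, ContMDiff 𝓘(ℝ, ℝ) (𝓡 3) ∞ γ ∧ (∀ t, γ (t + 1) = γ t) ∧
      (∀ j t, |t - slotTime N j| ≤ slotRadius N →
        γ t = e.symm (c j + (t - slotTime N j) • V j)) ∧
      ∀ α : ModTwoCocycle M, α.VanishesOn e.source → ∀ g₀ g₁ : C(ℝ, M), (∀ t, g₀ t = L t) →
        (∀ t, g₁ t = γ t) →
        (∀ i j, α.onArc g₁ (slotTime N i) (slotTime N j) = α.onArc g₀ (g i) (g j)) ∧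
        α.onArc g₁ 0 1 = 0 := by
  set d := slotRadius N with hd
  have hd0 : 0 < d := slotRadius_pos N
  -- Three nested radii: the reparametrization `y` is constant up to distance `2 * d` from a slot
  -- and returns to zero by `3 * d`; the strand inserted later is a straight segment up to `d` and
  -- supported within `2 * d`.
  let f : Fin N → ℝ → ℝ := fun j t => g j * plateau (2 * d) (3 * d) (t - slotTime N j)
  have hf : ∀ j t, 3 * d ≤ |t - slotTime N j| → f j t = 0 := fun j t h => by
    simp [f, plateau_eq_zero (by linarith : 0 ≤ 2 * d) (by linarith : 2 * d < 3 * d) h]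
  let y : ℝ → ℝ := fun t => ∑ j, f j (periodRep 0 t)
  have hy : ContDiff ℝ ∞ y := contDiff_slots_single (r := 3 * d) (by linarith) hf fun j =>
    contDiff_const.mul ((contDiff_plateau _ _).comp (contDiff_id.sub contDiff_const))
  have hyj : ∀ j t, |t - slotTime N j| ≤ 2 * d → y t = g j := by
    intro j t ht
    have hmem := slot_mem_Icc (by linarith) ht
    simp only [y]
    rw [periodRep_of_mem ⟨by linarith [hmem.1], by linarith [hmem.2]⟩,
      sum_slots_eq (r := 3 * d) (by linarith) hf (j := j) (by linarith)]
    simp [f, plateau_eq_one (by linarith : 0 ≤ 2 * d) (by linarith : 2 * d < 3 * d) ht]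
  have hyp : ∀ t, y (t + 1) = y t := fun t => by simp only [y, periodRep_add_one]
  have hy0 : y 0 = 0 := by
    simp only [y]
    rw [periodRep_of_mem (by simp)]
    refine sum_slots_eq_zero hf fun j => ?_
    rw [zero_sub, abs_neg, abs_of_nonneg] <;> linarith [slotTime_ge N j]
  have hy1 : y 1 = 0 := by rw [← zero_add (1 : ℝ), hyp, hy0]
  let γ₀ : ℝ → M := L ∘ y
  have sm₀ : ContMDiff 𝓘(ℝ, ℝ) (𝓡 3) ∞ γ₀ := hL.comp hy.contMDiff
  have hLg : ∀ j, L (g j) = e.symm 0 := fun j => by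
    rcases hg j with h | h <;> rw [h] <;> assumption
  let h : Fin N → ℝ → EuclideanSpace ℝ (Fin 3) := fun j t =>
    plateau d (2 * d) (t - slotTime N j) • (c j + (t - slotTime N j) • V j)
  have hh : ∀ j t, 2 * d ≤ |t - slotTime N j| → h j t = 0 := fun j t ht => by
    simp [h, plateau_eq_zero hd0.le (by linarith : d < 2 * d) ht]
  let m : ℝ → EuclideanSpace ℝ (Fin 3) := fun t => ∑ j, h j (periodRep 0 t)
  have hm : ContDiff ℝ ∞ m := contDiff_slots_single (r := 2 * d) (by linarith) hh fun j =>
    ((contDiff_plateau _ _).comp (contDiff_id.sub contDiff_const)).smul (by fun_prop)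
  let C := slotWindows N (2 * d)
  have hC : IsClosed C := isClosed_slotWindows (by linarith)
  -- In these windows the curve rests at the origin of the chart, because `g j` is an end of the
  -- loop. Adding `m` there prescribes the position.
  have hCx : ∀ t ∈ C, γ₀ t = e.symm 0 := by
    rintro t ⟨j, hj⟩
    change L (y t) = _
    rw [← apply_periodRep hyp 0, hyj j _ hj, hLg]
  have hCs : ∀ t ∈ C, γ₀ t ∈ e.source := fun t ht => by
    rw [hCx t ht]; exact e.map_target (by simp [het])
  have hm0 : ∀ t ∉ C, m t = 0 := by
    intro t ht
    refine sum_slots_eq_zero hh fun j => ?_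
    by_contra h'
    exact ht ⟨j, (not_le.1 h').le⟩
  refine ⟨chartModification e γ₀ C m,
    contMDiff_chartModification he sm₀ hC hm hCs (fun t _ => by simp [het]) hm0, ?_, ?_, ?_⟩
  · intro t
    simp only [chartModification, C, m, γ₀, slotWindows, Set.mem_preimage, periodRep_add_one,
      Function.comp_apply, hyp]
  · intro j t ht
    have hmem := slot_mem_Icc (by linarith) ht
    have hrep : periodRep 0 t = t :=
      periodRep_of_mem ⟨by linarith [hmem.1], by linarith [hmem.2]⟩
    have htC : t ∈ C := ⟨j, by rw [hrep]; linarith⟩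
    rw [chartModification_of_mem htC, hCx t htC, e.right_inv (by simp [het]), zero_add]
    simp only [m]
    rw [hrep, sum_slots_eq (r := 2 * d) (by linarith) hh (j := j) (by linarith)]
    simp [h, plateau_eq_one hd0.le (by linarith : d < 2 * d) ht]
  · intro α hα g₀ g₁ h₀ h₁
    have key : ∀ s t, α.onArc g₁ s t = α.onArc g₀ (y s) (y t) := by
      intro s t
      let y' : C(ℝ, ℝ) := ⟨y, hy.continuous⟩
      rw [onArc_chartModification he sm₀ hC hm hCs (fun r _ t _ => by simp [het]) hm0 α
        (Or.inr hα) (Or.inr hα) (g₀.comp y') g₁ (fun t => h₀ _) h₁, α.onArc_comp]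
      rfl
    have self : ∀ j, y (slotTime N j) = g j := fun j => hyj j _ (by simp; linarith)
    refine ⟨fun i j => by rw [key, self, self], ?_⟩
    -- The reparametrization starts and ends at `0`, so the closed curve runs along the loop and
    -- back, with total value zero.
    rw [key, hy0, hy1, α.onArc_self]

/-- A closed curve that passes through given points of a chart in given directions and has no other
multiple points. -/
theorem exists_base_curve [IsManifold (𝓡 3) ∞ M]
    {e : OpenPartialHomeomorph M (EuclideanSpace ℝ (Fin 3))}
    (he : IsSmoothChart e) (het : e.target = Set.univ) {L : ℝ → M}
    (hL : ContMDiff 𝓘(ℝ, ℝ) (𝓡 3) ∞ L) (hL0 : L 0 = e.symm 0) (hL1 : L 1 = e.symm 0) {N : ℕ}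
    (hN : 0 < N) (c V : Fin N → EuclideanSpace ℝ (Fin 3)) (hV : ∀ j, V j ≠ 0)
    (hcV : ∀ i j, i ≠ j → c i = c j → LinearIndependent ℝ ![V i, V j])
    (g : Fin N → ℝ) (hg : ∀ j, g j = 0 ∨ g j = 1) :
    ∃ (γ : ℝ → M) (δ : ℝ), 0 < δ ∧ δ ≤ slotRadius N ∧
      (∀ i j, c i ≠ c j → δ * (‖V i‖ + ‖V j‖) < ‖c i - c j‖) ∧
      ContMDiff 𝓘(ℝ, ℝ) (𝓡 3) ∞ γ ∧ (∀ t, γ (t + 1) = γ t) ∧ (∀ t, velocity γ t ≠ 0) ∧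
      (∀ j t, |t - slotTime N j| ≤ δ → γ t = e.symm (c j + (t - slotTime N j) • V j)) ∧
      (∀ s ∈ Set.Ico (0 : ℝ) 1, ∀ t ∈ Set.Ico (0 : ℝ) 1, γ s = γ t →
        s = t ∨ ∃ i j, s = slotTime N i ∧ t = slotTime N j ∧ c i = c j) ∧
      ∀ α : ModTwoCocycle M, α.VanishesOn e.source → ∀ g₀ g₁ : C(ℝ, M), (∀ t, g₀ t = L t) →
        (∀ t, g₁ t = γ t) →
        (∀ i j, α.onArc g₁ (slotTime N i) (slotTime N j) = α.onArc g₀ (g i) (g j)) ∧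
        α.onArc g₁ 0 1 = 0 := by
  obtain ⟨γ₀, sm₀, per₀, lin₀, al₀⟩ := exists_slot_curve he het hL hL0 hL1 c V g hg
  have hd0 : 0 < slotRadius N := slotRadius_pos N
  obtain ⟨δ, hδ0, hδ1, hδ2⟩ : ∃ δ : ℝ, 0 < δ ∧ δ ≤ slotRadius N ∧
      ∀ i j, c i ≠ c j → δ * (‖V i‖ + ‖V j‖) < ‖c i - c j‖ := by
    have ev : ∀ᶠ δ : ℝ in nhdsWithin 0 (Set.Ioi 0), ∀ i j, c i ≠ c j →
        δ * (‖V i‖ + ‖V j‖) < ‖c i - c j‖ := by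
      refine Filter.eventually_all.2 fun i => Filter.eventually_all.2 fun j => ?_
      by_cases hij : c i = c j
      · simp [hij]
      · have h1 : Filter.Tendsto (fun δ : ℝ => δ * (‖V i‖ + ‖V j‖)) (nhdsWithin 0 (Set.Ioi 0))
            (nhds (0 * (‖V i‖ + ‖V j‖))) :=
          ((continuous_id.mul continuous_const).tendsto 0).mono_left nhdsWithin_le_nhds
        rw [zero_mul] at h1
        filter_upwards [h1.eventually (gt_mem_nhds (norm_pos_iff.2 (sub_ne_zero.2 hij)))]
          with δ h _ using h
    obtain ⟨δ, h1, h2⟩ := (ev.and (Ioo_mem_nhdsGT hd0)).exists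
    exact ⟨δ, h2.1, h2.2.le, h1⟩
  -- The compact set of times at which general position still has to be achieved.
  let K : Set ℝ := {t | t ∈ Set.Icc (0 : ℝ) 1 ∧ ∀ j, δ ≤ |t - slotTime N j|}
  have hK : IsCompact K := by
    refine isCompact_Icc.inter_right (s := Set.Icc (0 : ℝ) 1) ?_
    have : {t : ℝ | ∀ j, δ ≤ |t - slotTime N j|} = ⋂ j, {t | δ ≤ |t - slotTime N j|} := by
      ext t; simp
    change IsClosed {t : ℝ | ∀ j, δ ≤ |t - slotTime N j|}
    rw [this]
    exact isClosed_iInter fun j => isClosed_le continuous_const (by fun_prop)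
  -- The bound `δ / 2` keeps the intervals outside the half windows around the slots, and `1 / 4`
  -- keeps their length below a period.
  have hr : ∀ t : ℝ, ∃ r, 0 < r ∧ r ≤ δ / 2 ∧ r ≤ 1 / 4 ∧ ∀ x ∈ Set.Icc (t - r) (t + r),
      γ₀ x ∈ (chartAt (EuclideanSpace ℝ (Fin 3)) (γ₀ t)).source := by
    intro t
    have h1 : γ₀ ⁻¹' (chartAt (EuclideanSpace ℝ (Fin 3)) (γ₀ t)).source ∈ nhds t :=
      sm₀.continuous.continuousAt
        ((chartAt (EuclideanSpace ℝ (Fin 3)) (γ₀ t)).open_source.mem_nhds (mem_chart_source _ _))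
    obtain ⟨ε, hε, hball⟩ := Metric.mem_nhds_iff.1 h1
    refine ⟨min (ε / 2) (min (δ / 2) (1 / 4)), by positivity, ?_, ?_, ?_⟩
    · exact (min_le_right _ _).trans (min_le_left _ _)
    · exact (min_le_right _ _).trans (min_le_right _ _)
    · intro x hx
      apply hball
      rw [Metric.mem_ball, Real.dist_eq, abs_lt]
      have := min_le_left (ε / 2) (min (δ / 2) (1 / 4))
      constructor <;> linarith [hx.1, hx.2]
  choose r hr0 hrδ hr4 hrs using hr
  obtain ⟨T, hTK, hT⟩ := hK.elim_nhds_subcover (fun t => Set.Ioo (t - r t) (t + r t))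
    (fun t _ => Ioo_mem_nhds (by linarith [hr0 t]) (by linarith [hr0 t]))
  let Ls : List (ℝ × ℝ × M) := T.toList.map fun t => (t - r t, t + r t, γ₀ t)
  have hLs : ∀ x ∈ Ls, ∃ t ∈ K, x = (t - r t, t + r t, γ₀ t) := by
    intro x hx
    obtain ⟨t, ht, rfl⟩ := List.mem_map.1 hx
    exact ⟨t, hTK t (Finset.mem_toList.1 ht), rfl⟩
  obtain ⟨γ, sm, per, un, imm, inj, al⟩ := exists_general_position Ls sm₀ per₀ (by
    intro x hx
    obtain ⟨t, -, rfl⟩ := hLs x hx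
    exact ⟨by simp only; linarith [hr0 t], by simp only; linarith [hr4 t], hrs t⟩)
  -- Perturbations act periodically, so the distance to all integer translates of the slot times
  -- matters.
  have far : ∀ t ∈ K, ∀ j, ∀ k : ℤ, δ ≤ |t - (slotTime N j - k)| := by
    intro t ht j k
    have a1 := slotTime_ge N j
    have a2 := slotTime_le N j
    rcases lt_trichotomy k 0 with hk | hk | hk
    · have : (k : ℝ) ≤ -1 := by exact_mod_cast Int.le_sub_one_of_lt hk
      rw [abs_sub_comm]
      refine le_trans ?_ (le_abs_self _)
      linarith [ht.1.2]
    · subst hk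
      simpa using ht.2 j
    · have : (1 : ℝ) ≤ k := by exact_mod_cast hk
      refine le_trans ?_ (le_abs_self _)
      linarith [ht.1.1]
  have frozen : ∀ j, ∀ k : ℤ, ∀ t, |t - slotTime N j| ≤ δ / 2 →
      ∀ x ∈ Ls, t - k ∉ periodicIoo x.1 x.2.1 := by
    rintro j k t ht x hx h
    rw [sub_int_mem_periodicIoo_iff] at h
    obtain ⟨τ, hτ, rfl⟩ := hLs x hx
    obtain ⟨i, hi⟩ := h
    have h1 := far τ hτ j i
    have h2 : |τ - (t - i)| < r τ := by
      rw [abs_lt]; constructor <;> linarith [hi.1, hi.2]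
    have h3 := abs_sub_le τ (t - i) (slotTime N j - i)
    have h4 : t - i - (slotTime N j - i) = t - slotTime N j := by ring
    rw [h4] at h3
    linarith [hrδ τ]
  -- A time in no perturbed interval lies within `δ` of a slot, where the original curve is
  -- straight.
  have window : ∀ t ∈ Set.Ico (0 : ℝ) 1, (∀ x ∈ Ls, t ∉ periodicIoo x.1 x.2.1) →
      ∃ j, |t - slotTime N j| < δ := by
    intro t ht h
    by_contra hn
    push Not at hn
    obtain ⟨τ, hτ, hmem⟩ := Set.mem_iUnion₂.1 (hT (⟨⟨ht.1, ht.2.le⟩, hn⟩ : t ∈ K))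
    exact h (τ - r τ, τ + r τ, γ₀ τ) (List.mem_map.2 ⟨τ, Finset.mem_toList.2 hτ, rfl⟩)
      ⟨0, by simpa using hmem⟩
  have hsymm : Function.Injective e.symm := fun x y h =>
    e.symm.injOn (by simp [het]) (by simp [het]) h
  -- Only the half windows are certain to be untouched. Between `δ / 2` and `δ` a time may be
  -- perturbed, and then the genericity of the perturbation applies.
  refine ⟨γ, δ / 2, by linarith, by linarith, ?_, sm, per, ?_, ?_, ?_, ?_⟩
  · intro i j hij
    have := hδ2 i j hij
    have h0 : 0 ≤ ‖V i‖ + ‖V j‖ := by positivity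
    nlinarith
  · intro t
    rw [← apply_periodRep (velocity_add_period sm per) 0]
    have hmem := periodRep_mem 0 t
    rw [zero_add] at hmem
    set t' := periodRep 0 t
    by_cases h : ∃ x ∈ Ls, t' ∈ periodicIoo x.1 x.2.1
    · obtain ⟨x, hx, h⟩ := h
      exact imm x hx t' h
    · push Not at h
      obtain ⟨j, hj⟩ := window t' hmem h
      rw [(un t' h).2, Ne, he.velocity_eq_zero_iff (γ := γ₀)
        (f := fun x => c j + (x - slotTime N j) • V j) (by fun_prop) (by simp [het])]
      · have : HasDerivAt (fun x : ℝ => c j + (x - slotTime N j) • V j) (V j) t' := by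
          simpa using (((hasDerivAt_id t').sub_const (slotTime N j)).smul_const (V j)).const_add
            (c j)
        rw [this.deriv]
        exact hV j
      · have : ∀ᶠ x in nhds t', |x - slotTime N j| < δ :=
          (by fun_prop : Continuous fun x : ℝ => |x - slotTime N j|).continuousAt.eventually
            (gt_mem_nhds hj)
        filter_upwards [this] with x hx
        exact lin₀ j x (by linarith)
  · intro j t ht
    have := (un t (by simpa using frozen j 0 t ht)).1
    rw [this]
    exact lin₀ j t (by linarith)
  · intro s hs t ht hst
    have done : ∀ k : ℤ, s - t = k → s = t := by
      intro k hk
      have h1 : (k : ℝ) < 1 := by linarith [hs.2, ht.1]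
      have h2 : (-1 : ℝ) < k := by linarith [hs.1, ht.2]
      have h3 : k < 1 := by exact_mod_cast h1
      have h4 : -1 < k := by exact_mod_cast h2
      have h5 : k = 0 := by omega
      rw [h5] at hk
      push_cast at hk
      linarith
    by_cases h : ∃ x ∈ Ls, s ∈ periodicIoo x.1 x.2.1
    · obtain ⟨x, hx, h⟩ := h
      obtain ⟨k, hk⟩ := inj x hx s h t hst
      exact Or.inl (done k hk)
    by_cases h' : ∃ x ∈ Ls, t ∈ periodicIoo x.1 x.2.1
    · obtain ⟨x, hx, h'⟩ := h'
      obtain ⟨k, hk⟩ := inj x hx t h' s hst.symm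
      exact Or.inl (done (-k) (by push_cast; linarith))
    push Not at h h'
    obtain ⟨i, hi⟩ := window s hs h
    obtain ⟨j, hj⟩ := window t ht h'
    rw [(un s h).1, (un t h').1, lin₀ i s (by linarith), lin₀ j t (by linarith)] at hst
    replace hst := hsymm hst
    by_cases hc : c i = c j
    · rw [hc, add_right_inj] at hst
      by_cases hij : i = j
      · subst hij
        left
        have := smul_left_injective ℝ (hV i) hst
        simpa using this
      · right
        refine ⟨i, j, ?_⟩
        have h1 := LinearIndependent.pair_iff.1 (hcV i j hij hc) (s - slotTime N i)
          (-(t - slotTime N j)) (by rw [neg_smul, hst, add_neg_cancel])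
        exact ⟨by linarith [h1.1], by linarith [h1.2], hc⟩
    -- Two segments with different centers are too short to meet, by the choice of `δ`.
    · exfalso
      have h1 := hδ2 i j hc
      have h2 : c i - c j = (t - slotTime N j) • V j - (s - slotTime N i) • V i := by
        rw [sub_eq_sub_iff_add_eq_add, hst]; abel
      have h3 : ‖c i - c j‖ ≤ δ * ‖V j‖ + δ * ‖V i‖ := by
        rw [h2]
        refine (norm_sub_le _ _).trans ?_
        rw [norm_smul, norm_smul, Real.norm_eq_abs, Real.norm_eq_abs]
        gcongr
      linarith
  · intro α hα g₀ g₁ h₀ h₁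
    let g₂ : C(ℝ, M) := ⟨γ₀, sm₀.continuous⟩
    obtain ⟨b1, b2⟩ := al₀ α hα g₀ g₂ h₀ (fun _ => rfl)
    have self : ∀ j, |slotTime N j - slotTime N j| ≤ δ / 2 := fun j => by simp; linarith
    refine ⟨fun i j => ?_, ?_⟩
    · rw [← b1, al α _ _ (by simpa using frozen i 0 _ (self i))
        (by simpa using frozen j 0 _ (self j)) g₂ g₁ (fun _ => rfl) h₁]
    -- Time `0` lies in a perturbed interval, so the period is counted from a slot time, which is
    -- not perturbed.
    · let j : Fin N := ⟨0, hN⟩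
      rw [← α.onArc_period g₁ (fun t => by rw [h₁, h₁, per]) (slotTime N j),
        al α _ _ (by simpa using frozen j 0 _ (self j))
        (by simpa using frozen j (-1) _ (self j)) g₂ g₁ (fun _ => rfl) h₁,
        α.onArc_period g₂ (fun t => per₀ t), b2]

end BaseCurve

/-! ### Insertion of local models -/

section Insertion

variable {M : Type*} [TopologicalSpace M] [ChartedSpace (EuclideanSpace ℝ (Fin 3)) M]

/-- A smooth family of closed curves, parametrized by `P`, in which the strand at the time
`slotTime N j` is a small copy, in the chart `e`, of the model curve `l j p`. The scale of the
copies is `scale`; the strands `j` with the same `loc j` are placed at the same point. There are no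
multiple points for `p ∈ Q` but those of the models. -/
structure InsertedFamily (e : OpenPartialHomeomorph M (EuclideanSpace ℝ (Fin 3))) (L : ℝ → M)
    {N : ℕ} {κ : Type*} (loc : Fin N → κ) (g : Fin N → ℝ) {P : Type*} [NormedAddCommGroup P]
    [NormedSpace ℝ P] (l : Fin N → P → ℝ → EuclideanSpace ℝ (Fin 3)) (R : ℝ) (Q : Set P) where
  scale : ℝ
  center : Fin N → EuclideanSpace ℝ (Fin 3)
  curve : P → ℝ → M
  scale_pos : 0 < scale
  scale_le : scale * R ≤ slotRadius N
  center_eq : ∀ i j, loc i = loc j → center i = center j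
  smooth : ContMDiff 𝓘(ℝ, P × ℝ) (𝓡 3) ∞ (Function.uncurry curve)
  periodic : ∀ p t, curve p (t + 1) = curve p t
  curve_eq : ∀ j p τ, |τ| ≤ R →
    curve p (slotTime N j + scale * τ) = e.symm (center j + scale • l j p τ)
  velocity_eq : ∀ j p τ, |τ| ≤ R → velocity (curve p) (slotTime N j + scale * τ) =
    chartFrame e (center j + scale • l j p τ) (deriv (l j p) τ)
  immersion : ∀ p, (∀ j τ, deriv (l j p) τ ≠ 0) → ∀ t, velocity (curve p) t ≠ 0
  multiple_points : ∀ p ∈ Q, ∀ s ∈ Set.Ico (0 : ℝ) 1, ∀ t ∈ Set.Ico (0 : ℝ) 1,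
    curve p s = curve p t → s = t ∨ ∃ i j θ τ, loc i = loc j ∧ s = slotTime N i + scale * θ ∧
      t = slotTime N j + scale * τ ∧ l i p θ = l j p τ
  onArc_eq : ∀ α : ModTwoCocycle M, α.VanishesOn e.source → ∀ p, ∀ g₀ g₁ : C(ℝ, M),
    (∀ t, g₀ t = L t) → (∀ t, g₁ t = curve p t) →
    (∀ i j θ τ, |θ| ≤ R → |τ| ≤ R →
      α.onArc g₁ (slotTime N i + scale * θ) (slotTime N j + scale * τ) = α.onArc g₀ (g i) (g j)) ∧
    α.onArc g₁ 0 1 = 0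

theorem nonempty_insertedFamily [T2Space M] [IsManifold (𝓡 3) ∞ M]
    {e : OpenPartialHomeomorph M (EuclideanSpace ℝ (Fin 3))}
    (he : IsSmoothChart e) (het : e.target = Set.univ) {L : ℝ → M}
    (hL : ContMDiff 𝓘(ℝ, ℝ) (𝓡 3) ∞ L) (hL0 : L 0 = e.symm 0) (hL1 : L 1 = e.symm 0) {N : ℕ}
    (hN : 0 < N) {K : ℕ} (loc : Fin N → Fin K) (V : Fin N → EuclideanSpace ℝ (Fin 3))
    (hV : ∀ j, V j ≠ 0)
    (hlV : ∀ i j, i ≠ j → loc i = loc j → LinearIndependent ℝ ![V i, V j])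
    (g : Fin N → ℝ) (hg : ∀ j, g j = 0 ∨ g j = 1) {P : Type*} [NormedAddCommGroup P]
    [NormedSpace ℝ P] (l : Fin N → P → ℝ → EuclideanSpace ℝ (Fin 3))
    (hl : ∀ j, ContDiff ℝ ∞ (Function.uncurry (l j))) {R : ℝ} (hR : 0 < R)
    (hlR : ∀ j p τ, R ≤ |τ| → l j p τ = τ • V j) {Q : Set P} (hQ : IsCompact Q) :
    Nonempty (InsertedFamily e L loc g l R Q) := by
  -- Different locations become different points of the first axis.
  let c : Fin N → EuclideanSpace ℝ (Fin 3) := fun j => !₂[((loc j : ℕ) : ℝ), 0, 0]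
  have hc : ∀ i j, c i = c j ↔ loc i = loc j := by
    intro i j
    constructor
    · intro h
      have := congrArg (fun v => v 0) h
      simp [c] at this
      exact Fin.ext this
    · intro h
      simp only [c, h]
  obtain ⟨Γ, δ, hδ0, hδr, hδc, smΓ, perΓ, immΓ, linΓ, injΓ, alΓ⟩ :=
    exists_base_curve he het hL hL0 hL1 hN c V hV
      (fun i j hij h => hlV i j hij ((hc i j).1 h)) g hg
  have hrad := slotRadius_pos N
  have hsymm : Function.Injective e.symm := fun x y h =>
    e.symm.injOn (by simp [het]) (by simp [het]) h
  have hcont : Continuous e.symm := by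
    rw [← continuousOn_univ, ← het]; exact e.continuousOn_symm
  have right_inv : ∀ z, e (e.symm z) = z := fun z => e.right_inv (by simp [het])
  have mem_source : ∀ z, e.symm z ∈ e.source := fun z => e.map_target (by simp [het])
  -- a bound for the models
  obtain ⟨B, hB0, hB⟩ : ∃ B : ℝ, 0 < B ∧ ∀ j, ∀ p ∈ Q, ∀ τ, |τ| ≤ R → ‖l j p τ‖ ≤ B := by
    have h1 : ∀ j, ∃ B : ℝ, ∀ p ∈ Q, ∀ τ, |τ| ≤ R → ‖l j p τ‖ ≤ B := by
      intro j
      obtain ⟨B, hB⟩ := (hQ.prod (isCompact_Icc (a := -R) (b := R))).exists_bound_of_continuousOn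
        (hl j).continuous.continuousOn
      exact ⟨B, fun p hp τ hτ => hB (p, τ) ⟨hp, abs_le.1 hτ⟩⟩
    choose B hB using h1
    refine ⟨∑ j, |B j| + 1, by positivity, fun j p hp τ hτ => (hB j p hp τ hτ).trans ?_⟩
    have := Finset.single_le_sum (f := fun j => |B j|) (fun i _ => abs_nonneg _) (Finset.mem_univ j)
    linarith [le_abs_self (B j)]
  -- the rest of the curve is away from the centers
  obtain ⟨ε, hε0, hε⟩ : ∃ ε : ℝ, 0 < ε ∧ ∀ t ∈ Set.Icc (0 : ℝ) 1,
      (∀ j, δ ≤ |t - slotTime N j|) → ∀ i v, ‖v‖ < ε → Γ t ≠ e.symm (c i + v) := by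
    let K' : Set ℝ := {t | t ∈ Set.Icc (0 : ℝ) 1 ∧ ∀ j, δ ≤ |t - slotTime N j|}
    have hK : IsCompact K' := by
      refine isCompact_Icc.inter_right (s := Set.Icc (0 : ℝ) 1) ?_
      have : {t : ℝ | ∀ j, δ ≤ |t - slotTime N j|} = ⋂ j, {t | δ ≤ |t - slotTime N j|} := by
        ext t; simp
      change IsClosed {t : ℝ | ∀ j, δ ≤ |t - slotTime N j|}
      rw [this]
      exact isClosed_iInter fun j => isClosed_le continuous_const (by fun_prop)
    have hclosed : IsClosed (Γ '' K') := (hK.image smΓ.continuous).isClosed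
    have hnot : ∀ i, e.symm (c i) ∉ Γ '' K' := by
      rintro i ⟨t, ⟨ht, htj⟩, h⟩
      have hi : Γ (slotTime N i) = e.symm (c i) := by
        rw [linΓ i _ (by simp; linarith)]; simp
      rw [← hi, ← apply_periodRep perΓ 0 t] at h
      have hmem := periodRep_mem 0 t
      rw [zero_add] at hmem
      have h8 := slotTime_ge N i
      have h9 := slotTime_le N i
      have key : periodRep 0 t ≠ slotTime N i := by
        intro h'
        rcases eq_or_lt_of_le ht.2 with h1 | h1
        · have : periodRep 0 (1 : ℝ) = 0 := by
            have := periodRep_add_one 0 0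
            rw [zero_add] at this
            rw [this]
            exact periodRep_of_mem (by simp)
          rw [h1, this] at h'
          linarith
        · rw [periodRep_of_mem (by simpa using ⟨ht.1, h1⟩)] at h'
          have := htj i
          rw [h', sub_self, abs_zero] at this
          linarith
      rcases injΓ _ hmem _ ⟨by linarith, by linarith⟩ h with h1 | ⟨j, k, h1, -, -⟩
      · exact key h1
      · rcases eq_or_lt_of_le ht.2 with h2 | h2
        · have : periodRep 0 (1 : ℝ) = 0 := by
            have := periodRep_add_one 0 0
            rw [zero_add] at this
            rw [this]
            exact periodRep_of_mem (by simp)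
          rw [h2, this] at h1
          linarith [slotTime_ge N j]
        · rw [periodRep_of_mem (by simpa using ⟨ht.1, h2⟩)] at h1
          have := htj j
          rw [h1, sub_self, abs_zero] at this
          linarith
    have ev : ∀ᶠ v : EuclideanSpace ℝ (Fin 3) in nhds 0, ∀ i, e.symm (c i + v) ∉ Γ '' K' := by
      refine Filter.eventually_all.2 fun i => ?_
      have : ContinuousAt (fun v => e.symm (c i + v)) 0 := by fun_prop
      exact this.eventually (hclosed.isOpen_compl.mem_nhds (by simpa using hnot i))
    obtain ⟨ε, hε0, hε⟩ := Metric.eventually_nhds_iff_ball.1 ev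
    refine ⟨ε, hε0, fun t ht htj i v hv h => ?_⟩
    exact hε v (by simpa using hv) i ⟨t, ⟨ht, htj⟩, h⟩
  -- The scale is so small that the models fit into the windows, stay as close to their centers as
  -- the straight segments do, and do not reach the rest of the curve.
  obtain ⟨ρ, hρ0, hρR, hρV, hρε⟩ : ∃ ρ : ℝ, 0 < ρ ∧ ρ * R < δ ∧ (∀ j, ρ * B < δ * ‖V j‖) ∧
      ρ * B < ε := by
    have tend : ∀ b : ℝ, Filter.Tendsto (fun x : ℝ => x * b) (nhdsWithin 0 (Set.Ioi 0)) (nhds 0) := by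
      intro b
      have : Filter.Tendsto (fun x : ℝ => x * b) (nhds 0) (nhds (0 * b)) :=
        (continuous_id.mul continuous_const).tendsto 0
      rw [zero_mul] at this
      exact this.mono_left nhdsWithin_le_nhds
    have e1 := (tend R).eventually (gt_mem_nhds hδ0)
    have e2 : ∀ᶠ x : ℝ in nhdsWithin 0 (Set.Ioi 0), ∀ j, x * B < δ * ‖V j‖ :=
      Filter.eventually_all.2 fun j =>
        (tend B).eventually (gt_mem_nhds (mul_pos hδ0 (norm_pos_iff.2 (hV j))))
    have e3 := (tend B).eventually (gt_mem_nhds hε0)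
    obtain ⟨ρ, h⟩ := (e1.and (e2.and (e3.and self_mem_nhdsWithin))).exists
    exact ⟨ρ, h.2.2.2, h.1, h.2.1, h.2.2.1⟩
  -- The correction that turns the straight strand into the scaled model; it vanishes where the
  -- model is itself straight.
  let f : Fin N → P → ℝ → EuclideanSpace ℝ (Fin 3) := fun j p t =>
    ρ • (l j p ((t - slotTime N j) / ρ) - ((t - slotTime N j) / ρ) • V j)
  have hf0 : ∀ j p t, ρ * R ≤ |t - slotTime N j| → f j p t = 0 := by
    intro j p t ht
    simp only [f]
    rw [hlR j p _ (by rw [abs_div, abs_of_pos hρ0, le_div_iff₀ hρ0]; linarith), sub_self, smul_zero]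
  have hfs : ∀ j, ContDiff ℝ ∞ (Function.uncurry (f j)) := by
    intro j
    have : ContDiff ℝ ∞ (fun x : P × ℝ => l j x.1 ((x.2 - slotTime N j) / ρ)) :=
      (hl j).comp (by fun_prop : ContDiff ℝ ∞ fun x : P × ℝ => (x.1, (x.2 - slotTime N j) / ρ))
    have h2 : ContDiff ℝ ∞ (fun x : P × ℝ => ((x.2 - slotTime N j) / ρ) • V j) := by fun_prop
    exact (this.sub h2).const_smul ρ
  let m : P → ℝ → EuclideanSpace ℝ (Fin 3) := fun p t => ∑ j, f j p (periodRep 0 t)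
  have hm : ContDiff ℝ ∞ (Function.uncurry m) :=
    contDiff_slots (r := ρ * R) (by linarith) hf0 hfs
  let C := slotWindows N (ρ * R)
  have hC : IsClosed C := isClosed_slotWindows (by linarith)
  have repj : ∀ j t, |t - slotTime N j| ≤ δ → t ∈ Set.Ico (0 : ℝ) 1 := by
    intro j t ht
    have := slot_mem_Icc (by linarith : δ ≤ 4 * slotRadius N) ht
    exact ⟨by linarith [this.1], by linarith [this.2]⟩
  have hCs : ∀ t ∈ C, Γ t ∈ e.source := by
    rintro t ⟨j, hj⟩
    rw [← apply_periodRep perΓ 0, linΓ j _ (by linarith)]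
    exact mem_source _
  have hm0 : ∀ p, ∀ t ∉ C, m p t = 0 := by
    intro p t ht
    refine sum_slots_eq_zero (f := fun j => f j p) (fun j t => hf0 j p t) fun j => ?_
    by_contra h'
    exact ht ⟨j, (not_le.1 h').le⟩
  let Φ : P → ℝ → M := fun p => chartModification e Γ C (m p)
  have hΦ : ∀ j p t, |t - slotTime N j| ≤ δ →
      Φ p t = e.symm (c j + ρ • l j p ((t - slotTime N j) / ρ)) := by
    intro j p t ht
    have hs : Γ t ∈ e.source := by rw [linΓ j t ht]; exact mem_source _
    simp only [Φ]
    rw [chartModification_of_source hs (hm0 p t), linΓ j t ht, right_inv]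
    congr 1
    simp only [m]
    rw [periodRep_of_mem (by simpa using repj j t ht), sum_slots_eq (f := fun j => f j p)
      (by linarith) (fun j t => hf0 j p t) (j := j) (by linarith)]
    simp only [f]
    rw [smul_sub, smul_smul, mul_div_cancel₀ _ hρ0.ne']
    abel
  have hΦj : ∀ j p τ, |τ| ≤ R →
      Φ p (slotTime N j + ρ * τ) = e.symm (c j + ρ • l j p τ) := by
    intro j p τ hτ
    rw [hΦ j p]
    · rw [add_sub_cancel_left, mul_div_cancel_left₀ _ hρ0.ne']
    · rw [add_sub_cancel_left, abs_mul, abs_of_pos hρ0]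
      nlinarith
  have smΦ : ContMDiff 𝓘(ℝ, P × ℝ) (𝓡 3) ∞ (Function.uncurry Φ) :=
    contMDiff_chartModification_family he smΓ hC hm hCs (fun p t _ => by simp [het]) hm0
  have perΦ : ∀ p t, Φ p (t + 1) = Φ p t := by
    intro p t
    simp only [Φ, chartModification, C, m, slotWindows, Set.mem_preimage, periodRep_add_one, perΓ]
  have smp : ∀ p, ContMDiff 𝓘(ℝ, ℝ) (𝓡 3) ∞ (Φ p) := fun p =>
    smΦ.comp (contMDiff_iff_contDiff.2 (by fun_prop : ContDiff ℝ ∞ (fun t : ℝ => (p, t))))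
  have hlp : ∀ j p, Differentiable ℝ (l j p) := fun j p =>
    ((hl j).comp (by fun_prop : ContDiff ℝ ∞ (fun t : ℝ => (p, t)))).differentiable (by simp)
  have hvel : ∀ j p t, |t - slotTime N j| < δ → velocity (Φ p) t =
      chartFrame e (c j + ρ • l j p ((t - slotTime N j) / ρ))
        (deriv (l j p) ((t - slotTime N j) / ρ)) := by
    intro j p t ht
    have hd : HasDerivAt (fun x => c j + ρ • l j p ((x - slotTime N j) / ρ))
        (deriv (l j p) ((t - slotTime N j) / ρ)) t := by
      have h1 : HasDerivAt (fun x : ℝ => (x - slotTime N j) / ρ) (1 / ρ) t :=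
        ((hasDerivAt_id t).sub_const _).div_const ρ
      have h2 := ((hlp j p _).hasDerivAt.scomp t h1).const_smul ρ
      have h3 := h2.const_add (c j)
      rwa [smul_smul, mul_one_div_cancel hρ0.ne', one_smul] at h3
    rw [he.velocity_eq (f := fun x => c j + ρ • l j p ((x - slotTime N j) / ρ))
      hd.differentiableAt (by simp [het]), hd.deriv]
    have : ∀ᶠ x in nhds t, |x - slotTime N j| < δ :=
      (by fun_prop : Continuous fun x : ℝ => |x - slotTime N j|).continuousAt.eventually
        (gt_mem_nhds ht)
    filter_upwards [this] with x hx using hΦ j p x hx.le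
  -- With this bound the separation of distinct centers by `hδc` applies to the modified strands
  -- too.
  have hnorm : ∀ j, ∀ p ∈ Q, ∀ t, |t - slotTime N j| ≤ δ →
      ‖ρ • l j p ((t - slotTime N j) / ρ)‖ ≤ δ * ‖V j‖ := by
    intro j p hp t ht
    rcases le_total |(t - slotTime N j) / ρ| R with h | h
    · rw [norm_smul, Real.norm_eq_abs, abs_of_pos hρ0]
      calc ρ * ‖l j p ((t - slotTime N j) / ρ)‖ ≤ ρ * B := by gcongr; exact hB j p hp _ h
        _ ≤ δ * ‖V j‖ := (hρV j).le
    · rw [hlR j p _ h, smul_smul, mul_div_cancel₀ _ hρ0.ne', norm_smul, Real.norm_eq_abs]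
      gcongr
  refine ⟨{
    scale := ρ
    center := c
    curve := Φ
    scale_pos := hρ0
    scale_le := by linarith
    center_eq := fun i j h => (hc i j).2 h
    smooth := smΦ
    periodic := perΦ
    curve_eq := hΦj
    velocity_eq := ?_
    immersion := ?_
    multiple_points := ?_
    onArc_eq := ?_ }⟩
  · intro j p τ hτ
    rw [hvel j p]
    · rw [add_sub_cancel_left, mul_div_cancel_left₀ _ hρ0.ne']
    · rw [add_sub_cancel_left, abs_mul, abs_of_pos hρ0]
      nlinarith
  · intro p hp t
    rw [← apply_periodRep (velocity_add_period (smp p) (perΦ p)) 0]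
    have hmem := periodRep_mem 0 t
    rw [zero_add] at hmem
    set t' := periodRep 0 t
    by_cases h : ∃ j, |t' - slotTime N j| < δ
    · obtain ⟨j, hj⟩ := h
      rw [hvel j p t' hj, Ne, map_eq_zero_iff _ (he.chartFrame_injective (by simp [het]))]
      exact hp j _
    · push Not at h
      have htC : t' ∉ C := by
        rw [mem_slotWindows_iff hmem]
        rintro ⟨j, hj⟩
        linarith [h j]
      rw [velocity_congr (γ' := Γ)]
      · exact immΓ t'
      · filter_upwards [hC.isOpen_compl.mem_nhds htC] with x hx
        exact chartModification_of_notMem hx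
  · intro p hp
    have main : ∀ s ∈ Set.Ico (0 : ℝ) 1, ∀ t ∈ Set.Ico (0 : ℝ) 1, s ∈ C → Φ p s = Φ p t →
        ∃ i j θ τ, loc i = loc j ∧ s = slotTime N i + ρ * θ ∧ t = slotTime N j + ρ * τ ∧
          l i p θ = l j p τ := by
      intro s hs t ht hsC hst
      obtain ⟨i, hi⟩ := (mem_slotWindows_iff hs).1 hsC
      rw [hΦ i p s (by linarith)] at hst
      by_cases h : ∃ j, |t - slotTime N j| ≤ δ
      · obtain ⟨j, hj⟩ := h
        rw [hΦ j p t hj] at hst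
        replace hst := hsymm hst
        have hloc : loc i = loc j := by
          by_contra hne
          have hcne : c i ≠ c j := fun h => hne ((hc i j).1 h)
          have h1 := hδc i j hcne
          have h2 : c i - c j = ρ • l j p ((t - slotTime N j) / ρ) -
              ρ • l i p ((s - slotTime N i) / ρ) := by
            rw [sub_eq_sub_iff_add_eq_add, hst]; abel
          have h3 := norm_sub_le (ρ • l j p ((t - slotTime N j) / ρ))
            (ρ • l i p ((s - slotTime N i) / ρ))
          rw [← h2] at h3
          linarith [hnorm j p hp t hj, hnorm i p hp s (by linarith)]
        refine ⟨i, j, (s - slotTime N i) / ρ, (t - slotTime N j) / ρ, hloc, ?_, ?_, ?_⟩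
        · rw [mul_div_cancel₀ _ hρ0.ne']; ring
        · rw [mul_div_cancel₀ _ hρ0.ne']; ring
        · rw [(hc i j).2 hloc, add_right_inj] at hst
          exact smul_right_injective _ hρ0.ne' hst
      -- A point of a model is within `ε` of a center, and the curve outside all windows keeps away
      -- from there.
      · exfalso
        push Not at h
        have htC : t ∉ C := by
          rw [mem_slotWindows_iff ht]
          rintro ⟨j, hj⟩
          linarith [h j]
        have hΦt : Φ p t = Γ t := chartModification_of_notMem htC
        rw [hΦt] at hst
        refine hε t ⟨ht.1, ht.2.le⟩ (fun j => (h j).le) i _ ?_ hst.symm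
        rw [norm_smul, Real.norm_eq_abs, abs_of_pos hρ0]
        refine lt_of_le_of_lt ?_ hρε
        gcongr
        refine hB i p hp _ ?_
        rw [abs_div, abs_of_pos hρ0, div_le_iff₀ hρ0]
        linarith
    intro s hs t ht hst
    by_cases hsC : s ∈ C
    · exact Or.inr (main s hs t ht hsC hst)
    by_cases htC : t ∈ C
    · obtain ⟨i, j, θ, τ, h1, h2, h3, h4⟩ := main t ht s hs htC hst.symm
      exact Or.inr ⟨j, i, τ, θ, h1.symm, h3, h2, h4.symm⟩
    have e1 : Φ p s = Γ s := chartModification_of_notMem hsC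
    have e2 : Φ p t = Γ t := chartModification_of_notMem htC
    rw [e1, e2] at hst
    rcases injΓ s hs t ht hst with h | ⟨i, j, h, -, -⟩
    · exact Or.inl h
    · exfalso
      apply hsC
      rw [mem_slotWindows_iff hs]
      exact ⟨i, by rw [h, sub_self, abs_zero]; positivity⟩
  · intro α hα p g₀ g₁ h₀ h₁
    let g₂ : C(ℝ, M) := ⟨Γ, smΓ.continuous⟩
    have hmp : ContDiff ℝ ∞ (m p) := hm.comp (by fun_prop : ContDiff ℝ ∞ (fun t : ℝ => (p, t)))
    have key : ∀ s t, α.onArc g₁ s t = α.onArc g₂ s t := fun s t =>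
      onArc_chartModification he smΓ hC hmp hCs (fun r _ t _ => by simp [het]) (hm0 p) α
        (Or.inr hα) (Or.inr hα) g₂ g₁ (fun t => rfl) h₁
    obtain ⟨b1, b2⟩ := alΓ α hα g₀ g₂ h₀ (fun _ => rfl)
    -- A strand stays in the chart, where the cocycle vanishes, so an arc may end anywhere on it.
    have short : ∀ j θ, |θ| ≤ R → α.onArc g₂ (slotTime N j) (slotTime N j + ρ * θ) = 0 := by
      intro j θ hθ
      refine hα _ fun r => ?_
      change Γ _ ∈ _
      rw [linΓ j]
      · exact mem_source _
      · rw [add_sub_cancel_left, add_sub_cancel_left, abs_mul, abs_mul, abs_of_pos hρ0,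
          abs_of_nonneg r.2.1]
        calc (r : ℝ) * (ρ * |θ|) ≤ 1 * (ρ * R) := by
              have := r.2.2
              gcongr
          _ ≤ δ := by linarith
    refine ⟨fun i j θ τ hθ hτ => ?_, by rw [key, b2]⟩
    rw [key, ← b1, ← α.onArc_add g₂ _ (slotTime N i), ← α.onArc_add g₂ (slotTime N i)
      (slotTime N j), short j τ hτ, α.onArc_comm, short i θ hθ, zero_add, add_zero]

end Insertion

/-! ### Singular knots from families of curves -/

section SingularKnots

variable {M : Type*} [TopologicalSpace M] [ChartedSpace (EuclideanSpace ℝ (Fin 3)) M] {n : ℕ}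

/-- The word of a singular knot can be read off from a sorted list of the times at which the double
points are passed. -/
theorem SingularKnot.word_eq (K : SingularKnot M n) {l : List (ℝ × Fin n)}
    (hl : l.Pairwise fun x y => x.1 < y.1) (h : ∀ x ∈ l, x.1 = K.fst x.2 ∨ x.1 = K.snd x.2)
    (hfst : ∀ c, (K.fst c, c) ∈ l) (hsnd : ∀ c, (K.snd c, c) ∈ l) :
    K.word = l.map Prod.snd := by
  classical
  let T : Fin n ⊕ Fin n → ℝ := Sum.elim K.fst K.snd
  have hT : Function.Injective T := K.times_injective
  let s : ℝ × Fin n → Fin n ⊕ Fin n := fun x => if x.1 = K.fst x.2 then Sum.inl x.2 else Sum.inr x.2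
  have hs : ∀ x ∈ l, T (s x) = x.1 := by
    intro x hx
    simp only [s]
    split_ifs with h1
    · exact h1.symm
    · exact ((h x hx).resolve_left h1).symm
  have hs2 : ∀ x, Sum.elim id id (s x) = x.2 := by
    intro x
    simp only [s]
    split_ifs <;> rfl
  have hlt : (l.map s).Pairwise fun x y => T x < T y := by
    rw [List.pairwise_map]
    exact hl.imp_of_mem fun {x y} hx hy hxy => by rwa [hs x hx, hs y hy]
  have hnd : (l.map s).Nodup := hlt.imp fun {x y} hxy he => by rw [he] at hxy; exact lt_irrefl _ hxy
  have hmem : ∀ y, y ∈ l.map s := by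
    rintro (c | c)
    · exact List.mem_map.2 ⟨_, hfst c, by simp [s]⟩
    · refine List.mem_map.2 ⟨_, hsnd c, ?_⟩
      simp [s, (K.fst_lt_snd c).ne']
  have hperm : (Finset.univ : Finset (Fin n ⊕ Fin n)).toList.Perm (l.map s) :=
    (List.perm_ext_iff_of_nodup (Finset.nodup_toList _) hnd).2 fun y => by simp [hmem y]
  have hsort : ((Finset.univ : Finset (Fin n ⊕ Fin n)).toList.mergeSort
      (fun x y => decide (T x ≤ T y))) = l.map s := by
    -- The times are distinct, so the sorted arrangement is unique.
    refine List.Perm.eq_of_pairwise (le := fun x y => T x ≤ T y) ?_ ?_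
      (hlt.imp fun {x y} h => h.le) ((List.mergeSort_perm _ _).trans hperm)
    · intro x y _ _ h1 h2
      exact hT (le_antisymm h1 h2)
    · have := List.pairwise_mergeSort (le := fun x y => decide (T x ≤ T y))
        (fun x y z h1 h2 => by simp at *; exact h1.trans h2)
        (fun x y => by simpa using le_total _ _) (Finset.univ : Finset (Fin n ⊕ Fin n)).toList
      simpa using this
  have : K.word = ((Finset.univ : Finset (Fin n ⊕ Fin n)).toList.mergeSort
      (fun x y => decide (T x ≤ T y))).map (Sum.elim id id) := by
    unfold SingularKnot.word
    congr!
  rw [this, hsort, List.map_map]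
  exact List.map_congr_left fun x _ => hs2 x

/-- The determinant is nonzero. Thus transversality of a double point comes for free from the
positivity of its resolution. -/
theorem ManifoldOrientation.IsPositive.linearIndependent {o : ManifoldOrientation M} {x : M}
    {e₁ e₂ e₃ : EuclideanSpace ℝ (Fin 3)} (h : o.IsPositive x e₁ e₂ e₃) :
    LinearIndependent ℝ ![e₁, e₂] := by
  have hdet : (Matrix.of ![e₁.ofLp, e₂.ofLp, e₃.ofLp]).det ≠ 0 := by
    intro h0
    unfold ManifoldOrientation.IsPositive at h
    rw [h0, mul_zero] at h
    exact lt_irrefl _ h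
  have h1 : LinearIndependent ℝ ![e₁.ofLp, e₂.ofLp, e₃.ofLp] := by
    have := Matrix.linearIndependent_rows_of_det_ne_zero hdet
    exact this
  rw [LinearIndependent.pair_iff]
  intro a b hab
  have h2 := Fintype.linearIndependent_iff.1 h1 ![a, b, 0] (by
    have := congrArg WithLp.ofLp hab
    simpa [Fin.sum_univ_three] using this)
  exact ⟨by simpa using h2 0, by simpa using h2 1⟩

/-- The singular knot is the member `u = 0` of the family, and its axioms are the case `u = 0` of
the conditions on the family. -/
theorem exists_resolution (o : ManifoldOrientation M) (Ψ : (Fin n → ℝ) → ℝ → M)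
    (smooth : ContMDiff 𝓘(ℝ, (Fin n → ℝ) × ℝ) (𝓡 3) ∞ (Function.uncurry Ψ))
    (periodic : ∀ u t, Ψ u (t + 1) = Ψ u t) (fst snd : Fin n → ℝ) (fst_nonneg : ∀ c, 0 ≤ fst c)
    (fst_lt_snd : ∀ c, fst c < snd c) (snd_lt_one : ∀ c, snd c < 1)
    (times_injective : Function.Injective (Sum.elim fst snd))
    (immersion : ∀ u ∈ Set.Icc (-1 : Fin n → ℝ) 1, ∀ t, velocity (Ψ u) t ≠ 0)
    (double_points : ∀ u ∈ Set.Icc (-1 : Fin n → ℝ) 1,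
      ∀ s ∈ Set.Ico (0 : ℝ) 1, ∀ t ∈ Set.Ico (0 : ℝ) 1, (Ψ u s = Ψ u t ↔ s = t ∨
        ∃ c, u c = 0 ∧ ((s = fst c ∧ t = snd c) ∨ (s = snd c ∧ t = fst c))))
    (positive : ∀ u ∈ Set.Icc (-1 : Fin n → ℝ) 1, ∀ c, u c = 0 →
      o.IsPositive (Ψ u (fst c)) (velocity (Ψ u) (fst c)) (velocity (Ψ u) (snd c))
        (velocity (fun x => Ψ (Function.update u c x) (fst c)) 0
          - velocity (fun x => Ψ (Function.update u c x) (snd c)) 0)) :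
    ∃ (K : SingularKnot M n) (R : K.Resolution o),
      K.toFun = Ψ 0 ∧ K.fst = fst ∧ K.snd = snd ∧ R.family = Ψ := by
  have h0 : (0 : Fin n → ℝ) ∈ Set.Icc (-1 : Fin n → ℝ) 1 := by
    constructor <;> intro c <;> simp
  let K : SingularKnot M n :=
    { toFun := Ψ 0
      smooth := smooth.comp (contMDiff_iff_contDiff.2
        (by fun_prop : ContDiff ℝ ∞ (fun t : ℝ => ((0 : Fin n → ℝ), t))))
      periodic := periodic 0
      immersion := immersion 0 h0
      fst := fst
      snd := snd
      fst_nonneg := fst_nonneg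
      fst_lt_snd := fst_lt_snd
      snd_lt_one := snd_lt_one
      times_injective := times_injective
      double_points := by simpa using double_points 0 h0
      transverse := fun c => (positive 0 h0 c rfl).linearIndependent }
  exact ⟨K, ⟨Ψ, smooth, rfl, periodic, immersion, double_points, positive⟩, rfl, rfl, rfl, rfl⟩

open Classical in
/-- A function on knots as a function on all curves. -/
def knotValue {F : Type*} [Zero F] (v : Knot M → F) (γ : ℝ → M) : F :=
  if h : ∃ K : Knot M, K.toFun = γ then v h.choose else 0

/-- A knot is determined by its function, the other fields being proofs. -/
theorem knotValue_toFun {F : Type*} [Zero F] (v : Knot M → F) (K : Knot M) :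
    knotValue v K.toFun = v K := by
  have h : ∃ K' : Knot M, K'.toFun = K.toFun := ⟨K, rfl⟩
  have h1 : h.choose = K := by
    have h2 := h.choose_spec
    generalize h.choose = K' at h2
    cases K'
    cases K
    simpa using h2
  rw [knotValue, dif_pos h, h1]

/-- Written in terms of curves, the summands of resolutions of different singular knots can be
compared and cancelled. -/
theorem SingularKnot.Resolution.alternatingSum_eq {F : Type*} [Field F]
    {o : ManifoldOrientation M} {K : SingularKnot M n} (R : K.Resolution o) (v : Knot M → F) :
    R.alternatingSum v = ∑ ε : Fin n → ℤˣ, (∏ c, ((ε c : ℤ) : F)) *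
      knotValue v (R.family fun c => ((ε c : ℤ) : ℝ)) := by
  unfold SingularKnot.Resolution.alternatingSum
  refine Finset.sum_congr rfl fun ε _ => ?_
  rw [← knotValue_toFun v (R.vertex ε)]
  rfl

/-- Goodness makes the arbitrary choice in `symbol` irrelevant. -/
theorem symbol_eq {F : Type*} [Field F] {o : ManifoldOrientation M} {α : ModTwoCocycle M}
    {v : Knot M → F} (hgood : IsGood o α v n) {K : SingularKnot M n} (R : K.Resolution o)
    (hK : K.IsEven α) : symbol o α v n (K.framedChordDiagram α) = R.alternatingSum v := by
  have h : ∃ (K' : SingularKnot M n) (_ : K'.Resolution o),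
      K'.IsEven α ∧ K'.framedChordDiagram α = K.framedChordDiagram α := ⟨K, R, hK, rfl⟩
  rw [symbol, dif_pos h]
  exact hgood _ _ _ _ h.choose_spec.choose_spec.1 hK h.choose_spec.choose_spec.2

end SingularKnots

/-! ### Words with one special letter -/

/-- A word of length `N + 1` in which the special letter occurs once, in the beginning, and every
other letter occurs twice. -/
structure SlotWord (n N : ℕ) where
  special : Fin n
  letter : Fin (N + 1) → Fin n
  first : Fin n → Fin (N + 1)
  second : Fin n → Fin (N + 1)
  first_lt_second : ∀ c ≠ special, first c < second c
  letter_eq_iff : ∀ c ≠ special, ∀ i, letter i = c ↔ i = first c ∨ i = second c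
  letter_eq_special_iff : ∀ i, letter i = special ↔ i = 0

theorem exists_two_occurrences {A : Type*} [DecidableEq A] {N : ℕ} (f : Fin N → A) {c : A}
    (h : (List.ofFn f).count c = 2) : ∃ a b, a < b ∧ ∀ i, f i = c ↔ i = a ∨ i = b := by
  have h1 : (Finset.univ.filter fun i => f i = c).card = 2 := by
    rw [← h, List.ofFn_eq_map, List.count_eq_countP, List.countP_map, List.countP_eq_length_filter,
      ← List.toFinset_card_of_nodup ((List.nodup_finRange N).filter _)]
    congr 1
    ext i
    simp
  obtain ⟨x, y, hxy, h2⟩ := Finset.card_eq_two.1 h1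
  have h3 : ∀ i, f i = c ↔ i = x ∨ i = y := by
    intro i
    have : i ∈ (Finset.univ.filter fun i => f i = c) ↔ i ∈ ({x, y} : Finset (Fin N)) := by rw [h2]
    simpa using this
  rcases lt_or_gt_of_ne hxy with h | h
  · exact ⟨x, y, h, h3⟩
  · exact ⟨y, x, h, fun i => by rw [h3 i, or_comm]⟩

theorem exists_slotWord {n : ℕ} (h : Fin n) (T : List (Fin n)) (h0 : T.count h = 0)
    (h2 : ∀ c ≠ h, T.count c = 2) :
    ∃ W : SlotWord n T.length, W.special = h ∧ W.letter = (h :: T).get := by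
  have h1 : ∀ c, ∃ a b : Fin (T.length + 1), c ≠ h →
      a < b ∧ ∀ i, (h :: T).get i = c ↔ i = a ∨ i = b := by
    intro c
    by_cases hc : c = h
    -- Arbitrary positions for the special letter, about which nothing is claimed.
    · exact ⟨0, 0, fun h' => absurd hc h'⟩
    · obtain ⟨a, b, hab⟩ := exists_two_occurrences (h :: T).get (c := c) (by
        rw [List.ofFn_get, List.count_cons_of_ne (Ne.symm hc), h2 c hc])
      exact ⟨a, b, fun _ => hab⟩
  choose a b hab using h1
  refine ⟨⟨h, (h :: T).get, a, b, fun c hc => (hab c hc).1, fun c hc => (hab c hc).2, ?_⟩, rfl, rfl⟩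
  intro i
  refine Fin.cases ?_ (fun j => ?_) i
  · simp
  · have : T.get j ≠ h := fun h' => by
      have := List.count_pos_iff.2 (h' ▸ List.get_mem T j : h ∈ T)
      omega
    simp only [Fin.succ_ne_zero, iff_false]
    exact this

namespace SlotWord

variable {n N : ℕ} (W : SlotWord n N)

theorem letter_first {c : Fin n} (hc : c ≠ W.special) : W.letter (W.first c) = c :=
  (W.letter_eq_iff c hc _).2 (Or.inl rfl)

theorem letter_second {c : Fin n} (hc : c ≠ W.special) : W.letter (W.second c) = c :=
  (W.letter_eq_iff c hc _).2 (Or.inr rfl)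

theorem first_ne_zero {c : Fin n} (hc : c ≠ W.special) : W.first c ≠ 0 := fun h =>
  hc (by rw [← W.letter_first hc, (W.letter_eq_special_iff _).2 h])

theorem second_ne_zero {c : Fin n} (hc : c ≠ W.special) : W.second c ≠ 0 := fun h =>
  hc (by rw [← W.letter_second hc, (W.letter_eq_special_iff _).2 h])

theorem second_ne_first {c : Fin n} (hc : c ≠ W.special) : W.second c ≠ W.first c :=
  (W.first_lt_second c hc).ne'

theorem slot_cases (i : Fin (N + 1)) :
    i = 0 ∨ ∃ c, c ≠ W.special ∧ (i = W.first c ∨ i = W.second c) := by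
  by_cases h : W.letter i = W.special
  · exact Or.inl ((W.letter_eq_special_iff i).1 h)
  · exact Or.inr ⟨W.letter i, h, (W.letter_eq_iff _ h i).1 rfl⟩

/-- The kind of a slot: the first or second occurrence of its letter, or the special letter. -/
def strand (i : Fin (N + 1)) : Fin 3 :=
  if i = 0 then 2 else if i = W.first (W.letter i) then 0 else 1

/-- The location of a slot; the special slot is placed at `p`. -/
def loc (p : Fin n) (i : Fin (N + 1)) : Fin n := if i = 0 then p else W.letter i

/-- The values of the cocycle on the arcs from the beginning to the slots. -/
def level (fr : Fin n → ZMod 2) (i : Fin (N + 1)) : ZMod 2 :=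
  if i = 0 then fr W.special else if i = W.first (W.letter i) then 0 else fr (W.letter i)

@[simp] theorem strand_zero : W.strand 0 = 2 := if_pos rfl
@[simp] theorem loc_zero (p : Fin n) : W.loc p 0 = p := if_pos rfl
@[simp] theorem level_zero (fr : Fin n → ZMod 2) : W.level fr 0 = fr W.special := if_pos rfl

variable {W} {c : Fin n}

theorem strand_first (hc : c ≠ W.special) : W.strand (W.first c) = 0 := by
  rw [strand, if_neg (W.first_ne_zero hc), W.letter_first hc, if_pos rfl]

theorem strand_second (hc : c ≠ W.special) : W.strand (W.second c) = 1 := by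
  rw [strand, if_neg (W.second_ne_zero hc), W.letter_second hc, if_neg (W.second_ne_first hc)]

theorem loc_first (p : Fin n) (hc : c ≠ W.special) : W.loc p (W.first c) = c := by
  rw [loc, if_neg (W.first_ne_zero hc), W.letter_first hc]

theorem loc_second (p : Fin n) (hc : c ≠ W.special) : W.loc p (W.second c) = c := by
  rw [loc, if_neg (W.second_ne_zero hc), W.letter_second hc]

theorem level_first (fr : Fin n → ZMod 2) (hc : c ≠ W.special) :
    W.level fr (W.first c) = 0 := by
  rw [level, if_neg (W.first_ne_zero hc), W.letter_first hc, if_pos rfl]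

theorem level_second (fr : Fin n → ZMod 2) (hc : c ≠ W.special) :
    W.level fr (W.second c) = fr c := by
  rw [level, if_neg (W.second_ne_zero hc), W.letter_second hc, if_neg (W.second_ne_first hc)]

/-- Different slots at one location have different kinds and hence independent directions, as the
base curve requires. -/
theorem eq_of_loc_strand {p : Fin n} {i j : Fin (N + 1)} (hl : W.loc p i = W.loc p j)
    (hs : W.strand i = W.strand j) : i = j := by
  rcases W.slot_cases i with rfl | ⟨c, hc, rfl | rfl⟩ <;>
  rcases W.slot_cases j with rfl | ⟨c', hc', rfl | rfl⟩ <;>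
  simp_all [strand_first, strand_second, loc_first, loc_second]

end SlotWord

/-! ### The models of the strands -/

/-- The models of the strands at a double point, and a third strand `k`. The first strand is moved
by `x` in the direction of the third axis. -/
def strandModel (k : ℝ × ℝ → ℝ → EuclideanSpace ℝ (Fin 3)) (i : Fin 3) (x : ℝ) (w : ℝ × ℝ)
    (τ : ℝ) : EuclideanSpace ℝ (Fin 3) :=
  match i with
  | 0 => !₂[τ, 0, x * plateau (1 / 4) (1 / 2) τ]
  | 1 => !₂[0, τ, 0]
  | 2 => k w τ

theorem contDiff_vec {V : Type*} [NormedAddCommGroup V] [NormedSpace ℝ V] {f₀ f₁ f₂ : V → ℝ}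
    {m : WithTop ℕ∞} (h₀ : ContDiff ℝ m f₀) (h₁ : ContDiff ℝ m f₁) (h₂ : ContDiff ℝ m f₂) :
    ContDiff ℝ m (fun x => (!₂[f₀ x, f₁ x, f₂ x] : EuclideanSpace ℝ (Fin 3))) := by
  rw [contDiff_euclidean]
  intro i
  fin_cases i
  · simpa using h₀
  · simpa using h₁
  · simpa using h₂

theorem hasDerivAt_vec {f₀ f₁ f₂ : ℝ → ℝ} {a₀ a₁ a₂ t : ℝ} (h₀ : HasDerivAt f₀ a₀ t)
    (h₁ : HasDerivAt f₁ a₁ t) (h₂ : HasDerivAt f₂ a₂ t) :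
    HasDerivAt (fun x => (!₂[f₀ x, f₁ x, f₂ x] : EuclideanSpace ℝ (Fin 3))) !₂[a₀, a₁, a₂] t := by
  have h : HasDerivAt (fun x => (![f₀ x, f₁ x, f₂ x] : Fin 3 → ℝ)) ![a₀, a₁, a₂] t := by
    rw [hasDerivAt_pi]
    intro i
    fin_cases i
    · simpa using h₀
    · simpa using h₁
    · simpa using h₂
  exact (PiLp.continuousLinearEquiv 2 ℝ (fun _ : Fin 3 => ℝ)).symm.hasFDerivAt.comp_hasDerivAt t h

theorem vec_eq_iff {a b c a' b' c' : ℝ} :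
    (!₂[a, b, c] : EuclideanSpace ℝ (Fin 3)) = !₂[a', b', c'] ↔ a = a' ∧ b = b' ∧ c = c' := by
  constructor
  · intro h
    exact ⟨by simpa using congrArg (fun v => v 0) h, by simpa using congrArg (fun v => v 1) h,
      by simpa using congrArg (fun v => v 2) h⟩
  · rintro ⟨rfl, rfl, rfl⟩
    rfl

theorem vec_ne_zero_of {a b c : ℝ} (h : a ≠ 0 ∨ b ≠ 0 ∨ c ≠ 0) :
    (!₂[a, b, c] : EuclideanSpace ℝ (Fin 3)) ≠ 0 := by
  intro h'
  have h0 : a = 0 := by simpa using congrArg (fun v => v 0) h'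
  have h1 : b = 0 := by simpa using congrArg (fun v => v 1) h'
  have h2 : c = 0 := by simpa using congrArg (fun v => v 2) h'
  simp [h0, h1, h2] at h

theorem det_vec (a b c a' b' c' a'' b'' c'' : ℝ) :
    (Matrix.of ![(!₂[a, b, c] : EuclideanSpace ℝ (Fin 3)).ofLp,
      (!₂[a', b', c'] : EuclideanSpace ℝ (Fin 3)).ofLp,
      (!₂[a'', b'', c''] : EuclideanSpace ℝ (Fin 3)).ofLp]).det =
    a * b' * c'' - a * c' * b'' - b * a' * c'' + b * c' * a'' + c * a' * b'' - c * b' * a'' := by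
  rw [Matrix.det_fin_three]
  simp

theorem hasDerivAt_plateau (r R t : ℝ) :
    HasDerivAt (plateau r R) (deriv (plateau r R) t) t :=
  ((contDiff_plateau r R).differentiable (by simp) t).hasDerivAt

theorem hasDerivAt_strandModel_zero (k : ℝ × ℝ → ℝ → EuclideanSpace ℝ (Fin 3)) (x : ℝ) (w : ℝ × ℝ)
    (τ : ℝ) : HasDerivAt (strandModel k 0 x w)
      !₂[1, 0, x * deriv (plateau (1 / 4) (1 / 2)) τ] τ :=
  hasDerivAt_vec (hasDerivAt_id τ) (hasDerivAt_const τ 0) ((hasDerivAt_plateau _ _ τ).const_mul x)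

theorem hasDerivAt_strandModel_one (k : ℝ × ℝ → ℝ → EuclideanSpace ℝ (Fin 3)) (x : ℝ) (w : ℝ × ℝ)
    (τ : ℝ) : HasDerivAt (strandModel k 1 x w) !₂[0, 1, 0] τ :=
  hasDerivAt_vec (hasDerivAt_const τ 0) (hasDerivAt_id τ) (hasDerivAt_const τ 0)

/-- The directions of the strands. -/
def strandDirection (i : Fin 3) : EuclideanSpace ℝ (Fin 3) :=
  match i with
  | 0 => !₂[1, 0, 0]
  | 1 => !₂[0, 1, 0]
  | 2 => !₂[0, 0, 1]

theorem strandDirection_ne_zero (i : Fin 3) : strandDirection i ≠ 0 := by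
  fin_cases i <;> exact vec_ne_zero_of (by simp)

theorem linearIndependent_strandDirection {i j : Fin 3} (h : i ≠ j) :
    LinearIndependent ℝ ![strandDirection i, strandDirection j] := by
  rw [LinearIndependent.pair_iff]
  intro a b hab
  have h0 := congrArg (fun v => v 0) hab
  have h1 := congrArg (fun v => v 1) hab
  have h2 := congrArg (fun v => v 2) hab
  fin_cases i <;> fin_cases j <;> simp [strandDirection] at h0 h1 h2 h <;> simp_all

/-- The conditions on the third strand. -/
structure IsThirdStrand (k : ℝ × ℝ → ℝ → EuclideanSpace ℝ (Fin 3)) : Prop where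
  smooth : ContDiff ℝ ∞ (Function.uncurry k)
  eq_of_le : ∀ w τ, 2 ≤ |τ| → k w τ = !₂[0, 0, τ]

theorem strandModel_eq_of_le {k : ℝ × ℝ → ℝ → EuclideanSpace ℝ (Fin 3)} (hk : IsThirdStrand k)
    (i : Fin 3) (x : ℝ) (w : ℝ × ℝ) {τ : ℝ} (hτ : 2 ≤ |τ|) :
    strandModel k i x w τ = τ • strandDirection i := by
  have hp : plateau (1 / 4) (1 / 2) τ = 0 :=
    plateau_eq_zero (by norm_num) (by norm_num) (by linarith)
  fin_cases i
  · change !₂[τ, 0, x * plateau (1 / 4) (1 / 2) τ] = _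
    rw [hp]
    ext m; fin_cases m <;> simp [strandDirection]
  · ext m; fin_cases m <;> simp [strandModel, strandDirection]
  · change k w τ = _
    rw [hk.eq_of_le w τ hτ]
    ext m; fin_cases m <;> simp [strandDirection]

/-- The models of the strands at the slots, depending on the parameters of the resolution and
two further parameters. -/
def SlotWord.model {n N : ℕ} (W : SlotWord n N) (k : ℝ × ℝ → ℝ → EuclideanSpace ℝ (Fin 3))
    (p : Fin n) (i : Fin (N + 1)) (P : (Fin n → ℝ) × (ℝ × ℝ)) (τ : ℝ) : EuclideanSpace ℝ (Fin 3) :=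
  strandModel k (W.strand i) (P.1 (W.loc p i)) P.2 τ

theorem SlotWord.contDiff_model {n N : ℕ} (W : SlotWord n N)
    {k : ℝ × ℝ → ℝ → EuclideanSpace ℝ (Fin 3)} (hk : IsThirdStrand k) (p : Fin n)
    (i : Fin (N + 1)) : ContDiff ℝ ∞ (Function.uncurry (W.model k p i)) := by
  unfold SlotWord.model
  generalize W.strand i = s
  generalize W.loc p i = c
  fin_cases s
  · refine contDiff_vec contDiff_snd contDiff_const ?_
    have h1 : ContDiff ℝ ∞ (fun x : ((Fin n → ℝ) × (ℝ × ℝ)) × ℝ => x.1.1 c) := by fun_prop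
    exact h1.mul ((contDiff_plateau _ _).comp contDiff_snd)
  · exact contDiff_vec contDiff_const contDiff_snd contDiff_const
  · exact hk.smooth.comp (by fun_prop :
      ContDiff ℝ ∞ (fun x : ((Fin n → ℝ) × (ℝ × ℝ)) × ℝ => (x.1.2, x.2)))

/-- The real number `0` or `1` that represents an element of `ℤ/2`. -/
def bitValue (x : ZMod 2) : ℝ := if x = 0 then 0 else 1

theorem bitValue_eq (x : ZMod 2) : bitValue x = 0 ∨ bitValue x = 1 := by
  unfold bitValue; split_ifs <;> simp

/-! ### Singular knots with prescribed framed chord diagrams -/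

section Realization

variable {M : Type*} [TopologicalSpace M] [ChartedSpace (EuclideanSpace ℝ (Fin 3)) M] {n N : ℕ}

theorem slotTime_scale_injective {ρ : ℝ} (hρ : 0 < ρ) (hρr : ρ * 2 ≤ slotRadius N) {i j : Fin N}
    {x y : ℝ} (hx : |x| ≤ 1) (hy : |y| ≤ 1)
    (h : slotTime N i + ρ * x = slotTime N j + ρ * y) : i = j ∧ x = y := by
  have hx' := abs_le.1 hx
  have hy' := abs_le.1 hy
  have hrad := slotRadius_pos N
  have hij : i = j := by
    by_contra hne
    have h1 := slotTime_dist hne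
    have h2 : slotTime N i - slotTime N j = ρ * (y - x) := by linarith
    rw [h2, abs_mul, abs_of_pos hρ] at h1
    have h3 : |y - x| ≤ 2 := abs_le.2 ⟨by linarith, by linarith⟩
    nlinarith
  subst hij
  exact ⟨rfl, mul_left_cancel₀ hρ.ne' (by linarith)⟩

theorem slotTime_scale_mem {ρ : ℝ} (hρ : 0 < ρ) (hρr : ρ * 2 ≤ slotRadius N) (i : Fin N)
    {x : ℝ} (hx : |x| ≤ 1) : slotTime N i + ρ * x ∈ Set.Ioo (0 : ℝ) 1 := by
  have hx' := abs_le.1 hx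
  have h1 := slotTime_ge N i
  have h2 := slotTime_le N i
  have h3 := slotRadius_pos N
  constructor <;> nlinarith

/-- Two strands of an inserted family that meet while a parameter is zero and move apart
in the positive direction. -/
theorem InsertedFamily.isPositive {o : ManifoldOrientation M}
    {e : OpenPartialHomeomorph M (EuclideanSpace ℝ (Fin 3))} (he : IsSmoothChart e)
    (het : e.target = Set.univ)
    (hpos : ∀ z e₁ e₂ e₃, 0 < (Matrix.of ![e₁.ofLp, e₂.ofLp, e₃.ofLp]).det →
        o.IsPositive (e.symm z) (chartFrame e z e₁) (chartFrame e z e₂) (chartFrame e z e₃))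
    {L : ℝ → M} {κ : Type*} {loc : Fin N → κ} {g : Fin N → ℝ} {P : Type*} [NormedAddCommGroup P]
    [NormedSpace ℝ P] {l : Fin N → P → ℝ → EuclideanSpace ℝ (Fin 3)} {R : ℝ} {Q : Set P}
    (F : InsertedFamily e L loc g l R Q) {i j : Fin N} (hij : loc i = loc j) {θ τ : ℝ}
    (hθ : |θ| ≤ R) (hτ : |τ| ≤ R) {q : ℝ → P} {D₁ D₂ D₃ D₄ : EuclideanSpace ℝ (Fin 3)}
    (hmeet : l i (q 0) θ = l j (q 0) τ)
    (h₁ : HasDerivAt (l i (q 0)) D₁ θ) (h₂ : HasDerivAt (l j (q 0)) D₂ τ)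
    (h₃ : HasDerivAt (fun x => l i (q x) θ) D₃ 0) (h₄ : HasDerivAt (fun x => l j (q x) τ) D₄ 0)
    (hdet : 0 < (Matrix.of ![D₁.ofLp, D₂.ofLp, (D₃ - D₄).ofLp]).det) :
    o.IsPositive (F.curve (q 0) (slotTime N i + F.scale * θ))
      (velocity (F.curve (q 0)) (slotTime N i + F.scale * θ))
      (velocity (F.curve (q 0)) (slotTime N j + F.scale * τ))
      (velocity (fun x => F.curve (q x) (slotTime N i + F.scale * θ)) 0
        - velocity (fun x => F.curve (q x) (slotTime N j + F.scale * τ)) 0) := by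
  have hv : ∀ j τ D, |τ| ≤ R → HasDerivAt (fun x => l j (q x) τ) D 0 →
      velocity (fun x => F.curve (q x) (slotTime N j + F.scale * τ)) 0 =
        chartFrame e (F.center j + F.scale • l j (q 0) τ) (F.scale • D) := by
    intro j τ D hτ hD
    have hd := (hD.const_smul F.scale).const_add (F.center j)
    rw [he.velocity_eq (f := fun x => F.center j + F.scale • l j (q x) τ) hd.differentiableAt
      (by simp [het]) (Filter.Eventually.of_forall fun x => F.curve_eq j (q x) τ hτ)]
    congr 1
    exact hd.deriv
  rw [hv i θ D₃ hθ h₃, hv j τ D₄ hτ h₄, F.velocity_eq i _ θ hθ, F.velocity_eq j _ τ hτ,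
    F.curve_eq i _ θ hθ, ← F.center_eq i j hij, ← hmeet, h₁.deriv, h₂.deriv, ← map_sub, ← smul_sub]
  apply hpos
  have : (Matrix.of ![D₁.ofLp, D₂.ofLp, (F.scale • (D₃ - D₄)).ofLp]).det =
      F.scale * (Matrix.of ![D₁.ofLp, D₂.ofLp, (D₃ - D₄).ofLp]).det := by
    rw [Matrix.det_fin_three, Matrix.det_fin_three]
    simp
    ring
  rw [this]
  exact mul_pos F.scale_pos hdet

/-- The parameters of the resolution: the special letter moves the third strand. -/
def SlotWord.path (W : SlotWord n N) (w : ℝ → ℝ × ℝ) (u : Fin n → ℝ) : (Fin n → ℝ) × (ℝ × ℝ) :=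
  (Function.update u W.special 0, w (u W.special))

theorem SlotWord.contDiff_path (W : SlotWord n N) {w : ℝ → ℝ × ℝ} (hw : ContDiff ℝ ∞ w) :
    ContDiff ℝ ∞ (W.path w) := by
  refine ContDiff.prodMk ?_ (hw.comp (by fun_prop))
  rw [contDiff_pi]
  intro c
  by_cases hc : c = W.special
  · subst hc
    simpa using contDiff_const
  · simp only [Function.update_of_ne hc]
    fun_prop

theorem SlotWord.path_mem (W : SlotWord n N) {w : ℝ → ℝ × ℝ}
    (hw : ∀ x ∈ Set.Icc (-1 : ℝ) 1, w x ∈ Set.Icc (-1 : ℝ × ℝ) 1) {u : Fin n → ℝ}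
    (hu : u ∈ Set.Icc (-1 : Fin n → ℝ) 1) :
    W.path w u ∈ Set.Icc (-1 : (Fin n → ℝ) × (ℝ × ℝ)) 1 := by
  have h2 := hw (u W.special) ⟨hu.1 _, hu.2 _⟩
  refine ⟨⟨fun c => ?_, h2.1⟩, ⟨fun c => ?_, h2.2⟩⟩ <;> by_cases hc : c = W.special
  · subst hc; simp [SlotWord.path]
  · simpa [SlotWord.path, Function.update_of_ne hc] using hu.1 c
  · subst hc; simp [SlotWord.path]
  · simpa [SlotWord.path, Function.update_of_ne hc] using hu.2 c

/-- A strand of the special chord is at time `θ` on the third strand, the other at time `τ` on the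
strand `j`. This says that the two strands meet exactly when the parameter is zero, and that they
move apart in the positive direction. -/
structure SlotWord.IsCrossing (W : SlotWord n N) (k : ℝ × ℝ → ℝ → EuclideanSpace ℝ (Fin 3))
    (p : Fin n) (w : ℝ → ℝ × ℝ) (j : Fin (N + 1)) (θ τ : ℝ) : Prop where
  smooth : ContDiff ℝ ∞ w
  mem : ∀ x ∈ Set.Icc (-1 : ℝ) 1, w x ∈ Set.Icc (-1 : ℝ × ℝ) 1
  loc_eq : W.loc p j = p
  abs_le_fst : |θ| ≤ 1
  abs_le_snd : |τ| ≤ 1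
  ne_zero : τ ≠ 0
  lt : 0 < j ∨ j = 0 ∧ θ < τ
  immersion : ∀ x ∈ Set.Icc (-1 : ℝ) 1, ∀ t, deriv (k (w x)) t ≠ 0
  double_point : ∀ x ∈ Set.Icc (-1 : ℝ) 1, ∀ y ∈ Set.Icc (-1 : ℝ) 1, ∀ i, W.loc p i = p →
    ∀ a b, k (w x) a = strandModel k (W.strand i) y (w x) b →
      i = 0 ∧ a = b ∨ x = 0 ∧ (a = θ ∧ i = j ∧ b = τ ∨ j = 0 ∧ a = τ ∧ i = 0 ∧ b = θ)
  meet : ∀ y, k (w 0) θ = strandModel k (W.strand j) y (w 0) τ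
  positive : ∀ y, ∃ D₁ D₂ D₃ D₄ : EuclideanSpace ℝ (Fin 3), HasDerivAt (k (w 0)) D₁ θ ∧
    HasDerivAt (strandModel k (W.strand j) y (w 0)) D₂ τ ∧
    HasDerivAt (fun x => k (w x) θ) D₃ 0 ∧
    HasDerivAt (fun x => strandModel k (W.strand j) y (w x) τ) D₄ 0 ∧
    0 < (Matrix.of ![D₁.ofLp, D₂.ofLp, (D₃ - D₄).ofLp]).det

/-- The slot and the local time of the first end of a chord. -/
def SlotWord.fstEnd (W : SlotWord n N) (θ : ℝ) (c : Fin n) : Fin (N + 1) × ℝ :=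
  if c = W.special then (0, θ) else (W.first c, 0)

/-- The slot and the local time of the second end of a chord. -/
def SlotWord.sndEnd (W : SlotWord n N) (j : Fin (N + 1)) (τ : ℝ) (c : Fin n) : Fin (N + 1) × ℝ :=
  if c = W.special then (j, τ) else (W.second c, 0)

/-- Ordinary ends have local time `0` on slots other than `0`. The first special end is on slot `0`
and the second has local time `τ ≠ 0`, so neither coincides with an ordinary end, and `lt` separates
the two from each other. -/
theorem SlotWord.IsCrossing.ends_injective {W : SlotWord n N}
    {k : ℝ × ℝ → ℝ → EuclideanSpace ℝ (Fin 3)} {p : Fin n} {w : ℝ → ℝ × ℝ} {j : Fin (N + 1)}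
    {θ τ : ℝ} (h : W.IsCrossing k p w j θ τ) :
    Function.Injective (Sum.elim (W.fstEnd θ) (W.sndEnd j τ)) := by
  have hlt : ((0 : Fin (N + 1)), θ) ≠ (j, τ) := by
    intro h'
    rw [Prod.mk.injEq] at h'
    rcases h.lt with h1 | ⟨-, h1⟩
    · exact h1.ne h'.1
    · exact h1.ne h'.2
  have hne := h.ne_zero
  have key : ∀ c c', c ≠ W.special → c' ≠ W.special → W.first c ≠ W.second c' := by
    intro c c' hc hc' h1
    have h2 := W.letter_first hc
    rw [h1, W.letter_second hc'] at h2
    subst h2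
    exact W.second_ne_first hc h1.symm
  rintro (c | c) (c' | c') hcc <;>
  simp only [Sum.elim_inl, Sum.elim_inr, SlotWord.fstEnd, SlotWord.sndEnd] at hcc <;>
  by_cases hc : c = W.special <;> by_cases hc' : c' = W.special <;>
  simp only [hc, hc', if_true, if_false, Prod.mk.injEq] at hcc ⊢
  · exact absurd hcc.1.symm (W.first_ne_zero hc')
  · exact absurd hcc.1 (W.first_ne_zero hc)
  · congr 1
    rw [← W.letter_first hc, hcc.1, W.letter_first hc']
  · exact absurd (Prod.ext hcc.1 hcc.2) hlt
  · exact absurd hcc.1.symm (W.second_ne_zero hc')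
  · exact absurd hcc.2.symm hne
  · exact absurd hcc.1 (key c c' hc hc')
  · exact absurd (Prod.ext hcc.1.symm hcc.2.symm) hlt
  · exact absurd hcc.2 hne
  · exact absurd hcc.1 (W.second_ne_zero hc)
  · exact absurd hcc.1.symm (key c' c hc' hc)
  · exact absurd hcc.2 hne
  · exact absurd hcc.2.symm hne
  · congr 1
    rw [← W.letter_second hc, hcc.1, W.letter_second hc']

variable {o : ManifoldOrientation M} {e : OpenPartialHomeomorph M (EuclideanSpace ℝ (Fin 3))}
  {L : ℝ → M} {W : SlotWord n N} {p : Fin n} {fr : Fin n → ZMod 2}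
  {k : ℝ × ℝ → ℝ → EuclideanSpace ℝ (Fin 3)}

/-- The family of curves for a word, with a third strand `k` at the place of the letter `p`. -/
abbrev SlotWord.Family (W : SlotWord n N)
    (e : OpenPartialHomeomorph M (EuclideanSpace ℝ (Fin 3))) (L : ℝ → M) (p : Fin n)
    (fr : Fin n → ZMod 2) (k : ℝ × ℝ → ℝ → EuclideanSpace ℝ (Fin 3)) :=
  InsertedFamily e L (W.loc p) (fun i => bitValue (W.level fr i)) (W.model k p) 2
    (Set.Icc (-1 : (Fin n → ℝ) × (ℝ × ℝ)) 1)

theorem SlotWord.nonempty_family [T2Space M] [IsManifold (𝓡 3) ∞ M] (he : IsSmoothChart e)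
    (het : e.target = Set.univ) (hL : ContMDiff 𝓘(ℝ, ℝ) (𝓡 3) ∞ L) (hL0 : L 0 = e.symm 0)
    (hL1 : L 1 = e.symm 0) (hk : IsThirdStrand k) : Nonempty (W.Family e L p fr k) :=
  nonempty_insertedFamily he het hL hL0 hL1 (Nat.succ_pos N) _
    (fun i => strandDirection (W.strand i)) (fun _ => strandDirection_ne_zero _)
    (fun _ _ hij hl => linearIndependent_strandDirection
      fun hs => hij (SlotWord.eq_of_loc_strand hl hs))
    _ (fun _ => bitValue_eq _) _ (fun i => W.contDiff_model hk p i) two_pos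
    (fun _ _ _ hτ => strandModel_eq_of_le hk _ _ _ hτ) isCompact_Icc

/-- The time at which the family passes a point of a slot. -/
def SlotWord.Family.time (F : W.Family e L p fr k) (x : Fin (N + 1) × ℝ) : ℝ :=
  slotTime (N + 1) x.1 + F.scale * x.2

theorem SlotWord.Family.time_injective (F : W.Family e L p fr k) {x y : Fin (N + 1) × ℝ}
    (hx : |x.2| ≤ 1) (hy : |y.2| ≤ 1) (h : F.time x = F.time y) : x = y := by
  obtain ⟨h1, h2⟩ := slotTime_scale_injective F.scale_pos F.scale_le hx hy h
  exact Prod.ext h1 h2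

theorem SlotWord.Family.time_lt (F : W.Family e L p fr k) {x y : Fin (N + 1) × ℝ}
    (hx : |x.2| ≤ 1) (hy : |y.2| ≤ 1) (h : x.1 < y.1) : F.time x < F.time y := by
  have h1 := slotTime_add_le h
  have h2 := abs_le.1 hx
  have h3 := abs_le.1 hy
  have h4 := F.scale_pos
  have h5 := F.scale_le
  have h6 := slotRadius_pos (N + 1)
  unfold SlotWord.Family.time
  nlinarith

theorem SlotWord.Family.time_mem (F : W.Family e L p fr k) {x : Fin (N + 1) × ℝ}
    (hx : |x.2| ≤ 1) : F.time x ∈ Set.Ioo (0 : ℝ) 1 :=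
  slotTime_scale_mem F.scale_pos F.scale_le x.1 hx

/-- For parameters in the cube, the immersion condition concerns the third strand only. -/
theorem SlotWord.Family.immersion_of (F : W.Family e L p fr k) {q : (Fin n → ℝ) × (ℝ × ℝ)}
    (h : ∀ t, deriv (k q.2) t ≠ 0) (t : ℝ) : velocity (F.curve q) t ≠ 0 := by
  refine F.immersion q (fun i τ => ?_) t
  change deriv (strandModel k (W.strand i) (q.1 (W.loc p i)) q.2) τ ≠ 0
  generalize q.1 (W.loc p i) = x
  generalize W.strand i = s
  fin_cases s
  · change deriv (strandModel k 0 x q.2) τ ≠ 0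
    rw [(hasDerivAt_strandModel_zero k x q.2 τ).deriv]
    exact vec_ne_zero_of (by simp)
  · change deriv (strandModel k 1 x q.2) τ ≠ 0
    rw [(hasDerivAt_strandModel_one k x q.2 τ).deriv]
    exact vec_ne_zero_of (by simp)
  · exact h τ

/-- Multiple points of the family are the double points of the word and those on the third
strand. -/
theorem SlotWord.Family.multiple_points_of (F : W.Family e L p fr k)
    {q : (Fin n → ℝ) × (ℝ × ℝ)} (hq : q ∈ Set.Icc (-1 : (Fin n → ℝ) × (ℝ × ℝ)) 1) {s t : ℝ}
    (hs : s ∈ Set.Ico (0 : ℝ) 1) (ht : t ∈ Set.Ico (0 : ℝ) 1) (hst : F.curve q s = F.curve q t) :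
    s = t ∨
    (∃ c, c ≠ W.special ∧ q.1 c = 0 ∧ (s = F.time (W.first c, 0) ∧ t = F.time (W.second c, 0) ∨
      s = F.time (W.second c, 0) ∧ t = F.time (W.first c, 0))) ∨
    ∃ i a b, W.loc p i = p ∧ k q.2 a = strandModel k (W.strand i) (q.1 p) q.2 b ∧
      (s = F.time (0, a) ∧ t = F.time (i, b) ∨ s = F.time (i, b) ∧ t = F.time (0, a)) := by
  rcases F.multiple_points q hq s hs t ht hst with h | ⟨i, j, a, b, hl, h1, h2, h3⟩
  · exact Or.inl h
  change strandModel k (W.strand i) (q.1 (W.loc p i)) q.2 a =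
    strandModel k (W.strand j) (q.1 (W.loc p j)) q.2 b at h3
  have hp0 : plateau (1 / 4) (1 / 2) 0 = 1 := plateau_eq_one (by norm_num) (by norm_num) (by simp)
  by_cases hi0 : i = 0
  · subst hi0
    rw [W.loc_zero] at hl
    rw [W.strand_zero, ← hl] at h3
    exact Or.inr (Or.inr ⟨j, a, b, hl.symm, h3, Or.inl ⟨h1, h2⟩⟩)
  by_cases hj0 : j = 0
  · subst hj0
    rw [W.loc_zero] at hl
    rw [W.strand_zero, hl] at h3
    exact Or.inr (Or.inr ⟨i, b, a, hl, h3.symm, Or.inr ⟨h1, h2⟩⟩)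
  obtain ⟨c, hc, hic⟩ := (W.slot_cases i).resolve_left hi0
  obtain ⟨c', hc', hjc⟩ := (W.slot_cases j).resolve_left hj0
  have hcc : c = c' := by
    rcases hic with rfl | rfl <;> rcases hjc with rfl | rfl <;>
    simpa [SlotWord.loc_first, SlotWord.loc_second, hc, hc'] using hl
  subst hcc
  rcases hic with rfl | rfl <;> rcases hjc with rfl | rfl <;>
  simp only [SlotWord.loc_first, SlotWord.strand_first, SlotWord.strand_second, hc, ne_eq,
    not_false_eq_true, strandModel, vec_eq_iff] at h3
  · left
    rw [h1, h2, h3.1]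
  · right; left
    obtain ⟨h4, h5, h6⟩ := h3
    subst h4
    rw [hp0, mul_one] at h6
    exact ⟨c, hc, h6, Or.inl ⟨h1, by rw [h2, ← h5]; rfl⟩⟩
  · right; left
    obtain ⟨h4, h5, h6⟩ := h3
    rw [← h4, hp0, mul_one] at h6
    exact ⟨c, hc, h6.symm, Or.inr ⟨by rw [h1, h5]; rfl, by rw [h2, ← h4]; rfl⟩⟩
  · left
    rw [h1, h2, h3.2.1]

theorem SlotWord.Family.curve_time (F : W.Family e L p fr k) (q : (Fin n → ℝ) × (ℝ × ℝ))
    {x : Fin (N + 1) × ℝ} (hx : |x.2| ≤ 1) : F.curve q (F.time x) = e.symm (F.center x.1 +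
      F.scale • strandModel k (W.strand x.1) (q.1 (W.loc p x.1)) q.2 x.2) :=
  F.curve_eq x.1 q x.2 (by linarith)

end Realization

/-- Between the parameters `0` and `1` the arc is trivial or the whole loop, in one direction or the
other. If all framings vanish, all levels are `0` and the loop is never run through. -/
theorem SlotWord.onArc_bitValue {M : Type*} [TopologicalSpace M] {n N : ℕ} {W : SlotWord n N}
    {fr : Fin n → ZMod 2} {α : ModTwoCocycle M} {γ : C(ℝ, M)}
    (h : (∀ c, fr c = 0) ∨ α.onArc γ 0 1 = 1) (i i' : Fin (N + 1)) :
    α.onArc γ (bitValue (W.level fr i)) (bitValue (W.level fr i')) =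
      W.level fr i + W.level fr i' := by
  rcases h with h | h
  · have : ∀ i, W.level fr i = 0 := fun i => by simp [SlotWord.level, h]
    simp [this, bitValue, α.onArc_self]
  · have h2 : ∀ x : ZMod 2, x = 0 ∨ x = 1 := by decide
    have h3 : (1 : ZMod 2) + 1 = 0 := by decide
    rcases h2 (W.level fr i) with h4 | h4 <;> rcases h2 (W.level fr i') with h5 | h5 <;>
    simp [h4, h5, bitValue, α.onArc_self, h, h3, α.onArc_comm γ 1 0]

section Realization

variable {M : Type*} [TopologicalSpace M] [ChartedSpace (EuclideanSpace ℝ (Fin 3)) M] {n N : ℕ}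
  {o : ManifoldOrientation M} {e : OpenPartialHomeomorph M (EuclideanSpace ℝ (Fin 3))}
  {L : ℝ → M} {W : SlotWord n N} {p : Fin n} {fr : Fin n → ZMod 2}
  {k : ℝ × ℝ → ℝ → EuclideanSpace ℝ (Fin 3)} {w : ℝ → ℝ × ℝ} {j : Fin (N + 1)} {θ τ : ℝ}

theorem plateau_quarter_zero : plateau (1 / 4) (1 / 2) 0 = 1 :=
  plateau_eq_one (by norm_num) (by norm_num) (by simp)

theorem SlotWord.path_update_special (W : SlotWord n N) (w : ℝ → ℝ × ℝ) (u : Fin n → ℝ) (x : ℝ) :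
    W.path w (Function.update u W.special x) = (Function.update u W.special 0, w x) := by
  simp [SlotWord.path]

theorem SlotWord.path_fst_of_ne (W : SlotWord n N) (w : ℝ → ℝ × ℝ) (u : Fin n → ℝ) {c : Fin n}
    (hc : c ≠ W.special) : (W.path w u).1 c = u c := by
  simp [SlotWord.path, Function.update_of_ne hc]

/-- Coincidences off the third strand are the double points of the word; those on it are governed by
`IsCrossing.double_point`. -/
theorem SlotWord.Family.double_points (F : W.Family e L p fr k)
    (h : W.IsCrossing k p w j θ τ) {u : Fin n → ℝ} (hu : u ∈ Set.Icc (-1 : Fin n → ℝ) 1) {s t : ℝ}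
    (hs : s ∈ Set.Ico (0 : ℝ) 1) (ht : t ∈ Set.Ico (0 : ℝ) 1) :
    F.curve (W.path w u) s = F.curve (W.path w u) t ↔ s = t ∨ ∃ c, u c = 0 ∧
      ((s = F.time (W.fstEnd θ c) ∧ t = F.time (W.sndEnd j τ c)) ∨
        (s = F.time (W.sndEnd j τ c) ∧ t = F.time (W.fstEnd θ c))) := by
  have hq := W.path_mem h.mem hu
  have hends : ∀ c, u c = 0 → F.curve (W.path w u) (F.time (W.fstEnd θ c)) =
      F.curve (W.path w u) (F.time (W.sndEnd j τ c)) := by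
    intro c hc
    by_cases hcs : c = W.special
    · subst hcs
      simp only [SlotWord.fstEnd, SlotWord.sndEnd, if_true]
      rw [F.curve_time _ h.abs_le_fst, F.curve_time _ h.abs_le_snd,
        F.center_eq 0 j (by rw [W.loc_zero, h.loc_eq]), W.strand_zero, h.loc_eq]
      have hw : (W.path w u).2 = w 0 := by simp [SlotWord.path, hc]
      rw [hw, ← h.meet]
      rfl
    · simp only [SlotWord.fstEnd, SlotWord.sndEnd, if_neg hcs]
      rw [F.curve_time _ (by simp), F.curve_time _ (by simp), F.center_eq (W.first c) (W.second c)
        (by rw [SlotWord.loc_first p hcs, SlotWord.loc_second p hcs]), SlotWord.strand_first hcs,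
        SlotWord.strand_second hcs, SlotWord.loc_first p hcs, W.path_fst_of_ne w u hcs, hc]
      simp [strandModel]
  constructor
  · intro hst
    rcases F.multiple_points_of hq hs ht hst with h1 | ⟨c, hc, h0, h1⟩ | ⟨i, a, b, hi, hab, h1⟩
    · exact Or.inl h1
    · right
      rw [W.path_fst_of_ne w u hc] at h0
      exact ⟨c, h0, by simpa only [SlotWord.fstEnd, SlotWord.sndEnd, if_neg hc] using h1⟩
    · have hx : u W.special ∈ Set.Icc (-1 : ℝ) 1 := ⟨hu.1 _, hu.2 _⟩
      have hy : (W.path w u).1 p ∈ Set.Icc (-1 : ℝ) 1 := ⟨hq.1.1 p, hq.2.1 p⟩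
      rcases h.double_point _ hx _ hy i hi a b hab with ⟨rfl, rfl⟩ | ⟨h0, h2⟩
      · left
        rcases h1 with ⟨h1, h2⟩ | ⟨h1, h2⟩ <;> rw [h1, h2]
      · right
        refine ⟨W.special, h0, ?_⟩
        simp only [SlotWord.fstEnd, SlotWord.sndEnd, if_true]
        rcases h2 with ⟨rfl, rfl, rfl⟩ | ⟨rfl, rfl, rfl, rfl⟩
        · exact h1
        · exact h1.symm
  · rintro (rfl | ⟨c, hc, ⟨rfl, rfl⟩ | ⟨rfl, rfl⟩⟩)
    · rfl
    · exact hends c hc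
    · exact (hends c hc).symm

theorem SlotWord.Family.positive (he : IsSmoothChart e) (het : e.target = Set.univ)
    (hpos : ∀ z e₁ e₂ e₃, 0 < (Matrix.of ![e₁.ofLp, e₂.ofLp, e₃.ofLp]).det →
        o.IsPositive (e.symm z) (chartFrame e z e₁) (chartFrame e z e₂) (chartFrame e z e₃))
    (F : W.Family e L p fr k) (h : W.IsCrossing k p w j θ τ) (u : Fin n → ℝ) {c : Fin n}
    (hc : u c = 0) :
    o.IsPositive (F.curve (W.path w u) (F.time (W.fstEnd θ c)))
      (velocity (F.curve (W.path w u)) (F.time (W.fstEnd θ c)))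
      (velocity (F.curve (W.path w u)) (F.time (W.sndEnd j τ c)))
      (velocity (fun x => F.curve (W.path w (Function.update u c x)) (F.time (W.fstEnd θ c))) 0
        - velocity (fun x => F.curve (W.path w (Function.update u c x))
          (F.time (W.sndEnd j τ c))) 0) := by
  have hu0 : Function.update u c 0 = u := by rw [← hc, Function.update_eq_self]
  by_cases hcs : c = W.special
  · subst hcs
    simp only [SlotWord.fstEnd, SlotWord.sndEnd, if_true]
    obtain ⟨D₁, D₂, D₃, D₄, h1, h2, h3, h4, hdet⟩ := h.positive ((W.path w u).1 p)
    have hl0 : ∀ x, W.model k p 0 (W.path w (Function.update u W.special x)) = k (w x) := by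
      intro x
      funext t
      rw [W.path_update_special, SlotWord.model, W.strand_zero]
      rfl
    have hlj : ∀ x, W.model k p j (W.path w (Function.update u W.special x)) =
        strandModel k (W.strand j) ((W.path w u).1 p) (w x) := by
      intro x
      funext t
      rw [W.path_update_special, SlotWord.model, h.loc_eq]
      rfl
    have := F.isPositive he het hpos (i := 0) (j := j) (by rw [W.loc_zero, h.loc_eq]) (θ := θ)
      (τ := τ) (by linarith [h.abs_le_fst]) (by linarith [h.abs_le_snd])
      (q := fun x => W.path w (Function.update u W.special x)) (D₁ := D₁) (D₂ := D₂) (D₃ := D₃)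
      (D₄ := D₄) (by simp only [hl0, hlj]; exact h.meet _) (by simp only [hl0]; exact h1)
      (by simp only [hlj]; exact h2) (by simp only [hl0]; exact h3)
      (by simp only [hlj]; exact h4) hdet
    simp only [hu0] at this
    exact this
  · simp only [SlotWord.fstEnd, SlotWord.sndEnd, if_neg hcs]
    have hx : ∀ x, (W.path w (Function.update u c x)).1 c = x := fun x => by
      rw [W.path_fst_of_ne w _ hcs, Function.update_self]
    have hl0 : ∀ x, W.model k p (W.first c) (W.path w (Function.update u c x)) =
        strandModel k 0 x (W.path w (Function.update u c x)).2 := by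
      intro x
      funext t
      rw [SlotWord.model, SlotWord.strand_first hcs, SlotWord.loc_first p hcs, hx]
    have hl1 : ∀ x, W.model k p (W.second c) (W.path w (Function.update u c x)) =
        fun t => !₂[0, t, 0] := by
      intro x
      funext t
      rw [SlotWord.model, SlotWord.strand_second hcs]
      rfl
    have := F.isPositive he het hpos (i := W.first c) (j := W.second c)
      (by rw [SlotWord.loc_first p hcs, SlotWord.loc_second p hcs]) (θ := 0) (τ := 0)
      (by simp) (by simp) (q := fun x => W.path w (Function.update u c x)) (D₁ := !₂[1, 0, 0])
      (D₂ := !₂[0, 1, 0]) (D₃ := !₂[0, 0, 1]) (D₄ := 0)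
      (by simp only [hl0, hl1]; simp [strandModel])
      (by
        simp only [hl0]
        simpa using hasDerivAt_strandModel_zero k 0 (W.path w (Function.update u c 0)).2 0)
      (by
        simp only [hl1]
        exact hasDerivAt_strandModel_one k 0 0 0)
      (by
        simp only [hl0, strandModel]
        refine hasDerivAt_vec (hasDerivAt_const _ _) (hasDerivAt_const _ _) ?_
        rw [plateau_quarter_zero]
        simpa using hasDerivAt_id' (0 : ℝ))
      (by
        simp only [hl1]
        exact hasDerivAt_const _ _)
      (by rw [sub_zero, det_vec]; norm_num)
    simp only [hu0] at this
    exact this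

/-- The even singular knot of a family of curves. -/
theorem SlotWord.Family.exists_singularKnot (he : IsSmoothChart e) (het : e.target = Set.univ)
    (hpos : ∀ z e₁ e₂ e₃, 0 < (Matrix.of ![e₁.ofLp, e₂.ofLp, e₃.ofLp]).det →
        o.IsPositive (e.symm z) (chartFrame e z e₁) (chartFrame e z e₂) (chartFrame e z e₃))
    (F : W.Family e L p fr k) (h : W.IsCrossing k p w j θ τ) (α : ModTwoCocycle M)
    (γ : C(ℝ, M)) (hγ : ∀ t, γ t = L t) (hL : L 0 = L 1)
    (hfr : (∀ c, fr c = 0) ∨ α.onArc γ 0 1 = 1) :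
    ∃ (K : SingularKnot M n) (R : K.Resolution o),
      (∀ c, K.fst c = F.time (W.fstEnd θ c)) ∧ (∀ c, K.snd c = F.time (W.sndEnd j τ c)) ∧
      (∀ u, R.family u = F.curve (W.path w u)) ∧ K.IsEven α ∧
      ∀ c, (K.framedArcDiagram α).framing c =
        if c = W.special then fr W.special + W.level fr j else fr c := by
  have hf1 : ∀ c, |(W.fstEnd θ c).2| ≤ 1 := by
    intro c
    unfold SlotWord.fstEnd
    split_ifs
    · exact h.abs_le_fst
    · simp
  have hs1 : ∀ c, |(W.sndEnd j τ c).2| ≤ 1 := by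
    intro c
    unfold SlotWord.sndEnd
    split_ifs
    · exact h.abs_le_snd
    · simp
  have himm : ∀ u ∈ Set.Icc (-1 : Fin n → ℝ) 1, ∀ t, velocity (F.curve (W.path w u)) t ≠ 0 := by
    intro u hu
    exact F.immersion_of (h.immersion _ ⟨hu.1 _, hu.2 _⟩)
  obtain ⟨K, R, hK0, hK1, hK2, hK3⟩ := exists_resolution o (fun u => F.curve (W.path w u))
    (F.smooth.comp (contMDiff_iff_contDiff.2 (((W.contDiff_path h.smooth).comp contDiff_fst).prodMk
      contDiff_snd)))
    (fun u => F.periodic _) (fun c => F.time (W.fstEnd θ c)) (fun c => F.time (W.sndEnd j τ c))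
    (fun c => (F.time_mem (hf1 c)).1.le)
    (by
      intro c
      by_cases hc : c = W.special
      · simp only [SlotWord.fstEnd, SlotWord.sndEnd, if_pos hc]
        rcases h.lt with h1 | ⟨h1, h2⟩
        · exact F.time_lt h.abs_le_fst h.abs_le_snd h1
        · subst h1
          unfold SlotWord.Family.time
          have := F.scale_pos
          simp only
          nlinarith
      · simp only [SlotWord.fstEnd, SlotWord.sndEnd, if_neg hc]
        exact F.time_lt (by simp) (by simp) (W.first_lt_second c hc))
    (fun c => (F.time_mem (hs1 c)).2)
    (by
      intro x y hxy
      apply h.ends_injective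
      have hb : ∀ x, |(Sum.elim (W.fstEnd θ) (W.sndEnd j τ) x).2| ≤ 1 := by
        rintro (c | c)
        · exact hf1 c
        · exact hs1 c
      have ht : ∀ x, Sum.elim (fun c => F.time (W.fstEnd θ c)) (fun c => F.time (W.sndEnd j τ c)) x
          = F.time (Sum.elim (W.fstEnd θ) (W.sndEnd j τ) x) := by
        rintro (c | c) <;> rfl
      rw [ht, ht] at hxy
      exact F.time_injective (hb x) (hb y) hxy)
    himm (fun u hu s hs t ht => F.double_points h hu hs ht)
    (fun u _ c hc => F.positive he het hpos h u hc)
  -- The arcs are computed with a cohomologous cocycle that vanishes in the chart. Evenness and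
  -- framings concern closed arcs, on which both cocycles agree.
  obtain ⟨f, hf⟩ := α.exists_addCoboundary_vanishesOn e het
  obtain ⟨ha1, ha2⟩ := F.onArc_eq (α.addCoboundary f) hf (W.path w 0) γ K.toContinuousMap hγ
    (fun t => by change K.toFun t = _; rw [hK0])
  have hfr' : (∀ c, fr c = 0) ∨ (α.addCoboundary f).onArc γ 0 1 = 1 := by
    rwa [α.addCoboundary_onArc f γ (by rw [hγ, hγ, hL])]
  refine ⟨K, R, fun c => by rw [hK1], fun c => by rw [hK2], fun u => by rw [hK3], ?_, ?_⟩
  · unfold SingularKnot.IsEven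
    rw [← ha2, α.addCoboundary_onArc]
    have := K.periodic 0
    rw [zero_add] at this
    exact this.symm
  · intro c
    change α.onArc K.toContinuousMap (K.fst c) (K.snd c) = _
    rw [← α.addCoboundary_onArc f, hK1, hK2]
    · unfold SlotWord.Family.time
      rw [ha1 _ _ _ _ (by linarith [hf1 c]) (by linarith [hs1 c]), SlotWord.onArc_bitValue hfr']
      by_cases hc : c = W.special
      · simp only [SlotWord.fstEnd, SlotWord.sndEnd, if_pos hc, W.level_zero]
      · simp only [SlotWord.fstEnd, SlotWord.sndEnd, if_neg hc, SlotWord.level_first fr hc,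
          SlotWord.level_second fr hc, zero_add]
    · exact (K.double_points _ ⟨K.fst_nonneg c, (K.fst_lt_snd c).trans (K.snd_lt_one c)⟩ _
        ⟨(K.fst_nonneg c).trans (K.fst_lt_snd c).le, K.snd_lt_one c⟩).2
        (Or.inr ⟨c, Or.inl ⟨rfl, rfl⟩⟩)

end Realization

/-! ### The word of the realized singular knots -/

theorem List.pairwise_take_cons_drop {A : Type*} {r : A → A → Prop} {l : List A} (h : l.Pairwise r)
    {m : ℕ} {x : A} (hr : ∀ a b c, r a b → r b c → r a c)
    (h₁ : ∀ (i : ℕ) (hi : i < l.length), i < m → r l[i] x)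
    (h₂ : ∀ (i : ℕ) (hi : i < l.length), m ≤ i → r x l[i]) :
    (l.take m ++ x :: l.drop m).Pairwise r := by
  have ht : ∀ a ∈ l.take m, r a x := by
    intro a ha
    obtain ⟨i, hi, rfl⟩ := List.mem_take_iff_getElem.1 ha
    exact h₁ i (by omega) (by omega)
  have hd : ∀ a ∈ l.drop m, r x a := by
    intro a ha
    obtain ⟨i, hi, rfl⟩ := List.mem_drop_iff_getElem.1 ha
    exact h₂ _ (by omega) (by omega)
  rw [List.pairwise_append, List.pairwise_cons]
  refine ⟨h.take, ⟨hd, h.drop⟩, fun a ha b hb => ?_⟩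
  rcases List.mem_cons.1 hb with rfl | hb
  · exact ht a ha
  · exact hr _ _ _ (ht a ha) (hd b hb)

/-- The word in which the missing end of the special letter is inserted before the position `m`. -/
def SlotWord.insertedWord {n N : ℕ} (W : SlotWord n N) (m : ℕ) : List (Fin n) :=
  (List.ofFn W.letter).take m ++ W.special :: (List.ofFn W.letter).drop m

theorem SlotWord.insertedWord_eq {n N : ℕ} {W : SlotWord n N} {A B : List (Fin n)}
    (h : List.ofFn W.letter = A ++ B) {m : ℕ} (hm : A.length = m) :
    W.insertedWord m = A ++ W.special :: B := by
  rw [SlotWord.insertedWord, h, List.take_left' hm, List.drop_left' hm]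

section Realization

variable {M : Type*} [TopologicalSpace M] [ChartedSpace (EuclideanSpace ℝ (Fin 3)) M] {n N : ℕ}
  {e : OpenPartialHomeomorph M (EuclideanSpace ℝ (Fin 3))}
  {L : ℝ → M} {W : SlotWord n N} {p : Fin n} {fr : Fin n → ZMod 2}
  {k : ℝ × ℝ → ℝ → EuclideanSpace ℝ (Fin 3)}

/-- The word of a singular knot in the family. -/
theorem SlotWord.Family.word_eq (F : W.Family e L p fr k) {j : Fin (N + 1)} {θ τ : ℝ}
    (hθ : |θ| ≤ 1) (hτ : |τ| ≤ 1) (K : SingularKnot M n)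
    (hfst : ∀ c, K.fst c = F.time (W.fstEnd θ c)) (hsnd : ∀ c, K.snd c = F.time (W.sndEnd j τ c))
    {m : ℕ} (hm : m = j + 1 ∧ (if j = 0 then θ else 0) < τ ∨
      m = j ∧ τ < (if j = 0 then θ else 0)) :
    K.word = W.insertedWord m := by
  -- The ends present in the slots, in the order of time; only the end in slot `0` has a local time
  -- `θ` that may differ from `0`.
  set f : Fin (N + 1) → ℝ × Fin n := fun i => (F.time (i, if i = 0 then θ else 0), W.letter i)
    with hf
  have habs : ∀ i : Fin (N + 1), |(if i = 0 then θ else 0)| ≤ 1 := by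
    intro i
    split_ifs
    · exact hθ
    · simp
  have hmap : List.ofFn W.letter = (List.ofFn f).map Prod.snd := by
    rw [List.map_ofFn]
    rfl
  have hlt : ∀ {a b : ℝ} (i : Fin (N + 1)), a < b → F.time (i, a) < F.time (i, b) := by
    intro a b i hab
    have := F.scale_pos
    unfold SlotWord.Family.time
    simp only
    nlinarith
  have hperm : ∀ x, x ∈ (List.ofFn f).take m ++ (F.time (j, τ), W.special) :: (List.ofFn f).drop m ↔
      x = (F.time (j, τ), W.special) ∨ ∃ i, f i = x := by
    intro x
    rw [List.perm_middle.mem_iff, List.take_append_drop, List.mem_cons, List.mem_ofFn]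
  rw [SlotWord.insertedWord, hmap, ← List.map_take, ← List.map_drop, ← List.map_cons
    (f := Prod.snd) (a := (F.time (j, τ), W.special)), ← List.map_append]
  refine K.word_eq ?_ ?_ ?_ ?_
  · refine List.pairwise_take_cons_drop ?_ (fun a b c => lt_trans) ?_ ?_
    · rw [List.pairwise_ofFn]
      intro a b hab
      exact F.time_lt (habs a) (habs b) hab
    · intro i hi him
      rw [List.getElem_ofFn]
      rw [List.length_ofFn] at hi
      have hij : (⟨i, hi⟩ : Fin (N + 1)) < j ∨ (⟨i, hi⟩ : Fin (N + 1)) = j ∧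
          (if j = 0 then θ else 0) < τ := by
        rcases hm with ⟨rfl, h⟩ | ⟨rfl, h⟩
        · rcases (Nat.lt_succ_iff.1 him).lt_or_eq with h1 | h1
          · exact Or.inl h1
          · exact Or.inr ⟨Fin.ext h1, h⟩
        · exact Or.inl him
      rcases hij with h1 | ⟨h1, h2⟩
      · exact F.time_lt (habs _) hτ h1
      · rw [h1]
        exact hlt j h2
    · intro i hi him
      rw [List.getElem_ofFn]
      rw [List.length_ofFn] at hi
      have hij : j < (⟨i, hi⟩ : Fin (N + 1)) ∨ (⟨i, hi⟩ : Fin (N + 1)) = j ∧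
          τ < (if j = 0 then θ else 0) := by
        rcases hm with ⟨rfl, h⟩ | ⟨rfl, h⟩
        · exact Or.inl (Nat.lt_of_succ_le him)
        · rcases him.lt_or_eq with h1 | h1
          · exact Or.inl h1
          · exact Or.inr ⟨Fin.ext h1.symm, h⟩
      rcases hij with h1 | ⟨h1, h2⟩
      · exact F.time_lt hτ (habs _) h1
      · rw [h1]
        exact hlt j h2
  · intro x hx
    rcases (hperm x).1 hx with rfl | ⟨i, rfl⟩
    · right
      simp [hsnd, SlotWord.sndEnd]
    · rcases W.slot_cases i with rfl | ⟨c, hc, rfl | rfl⟩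
      · left
        simp [hf, hfst, SlotWord.fstEnd, (W.letter_eq_special_iff 0).2 rfl]
      · left
        simp [hf, hfst, SlotWord.fstEnd, W.letter_first hc, W.first_ne_zero hc, hc]
      · right
        simp [hf, hsnd, SlotWord.sndEnd, W.letter_second hc, W.second_ne_zero hc, hc]
  · intro c
    rw [hperm]
    right
    by_cases hc : c = W.special
    · exact ⟨0, by simp [hf, hfst, SlotWord.fstEnd, hc, (W.letter_eq_special_iff 0).2 rfl]⟩
    · exact ⟨W.first c, by
        simp [hf, hfst, SlotWord.fstEnd, W.letter_first hc, W.first_ne_zero hc, hc]⟩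
  · intro c
    rw [hperm]
    by_cases hc : c = W.special
    · left
      simp [hsnd, SlotWord.sndEnd, hc]
    · right
      exact ⟨W.second c, by
        simp [hf, hsnd, SlotWord.sndEnd, W.letter_second hc, W.second_ne_zero hc, hc]⟩

end Realization

/-! ### The third strand of the four-term relation -/

/-- The third axis, moved by `w` in the plane of the two other axes. -/
def shiftedAxis (w : ℝ × ℝ) (τ : ℝ) : EuclideanSpace ℝ (Fin 3) :=
  !₂[plateau 1 2 τ * w.1, plateau 1 2 τ * w.2, τ]

theorem isThirdStrand_shiftedAxis : IsThirdStrand shiftedAxis where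
  smooth := by
    have h : ContDiff ℝ ∞ fun x : (ℝ × ℝ) × ℝ => plateau 1 2 x.2 :=
      (contDiff_plateau _ _).comp contDiff_snd
    exact contDiff_vec (h.mul (by fun_prop)) (h.mul (by fun_prop)) contDiff_snd
  eq_of_le w τ hτ := by
    simp [shiftedAxis, plateau_eq_zero (by norm_num : (0 : ℝ) ≤ 1) (by norm_num) hτ]

theorem hasDerivAt_shiftedAxis (w : ℝ × ℝ) (τ : ℝ) : HasDerivAt (shiftedAxis w)
    !₂[deriv (plateau 1 2) τ * w.1, deriv (plateau 1 2) τ * w.2, 1] τ :=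
  hasDerivAt_vec ((hasDerivAt_plateau _ _ τ).mul_const _) ((hasDerivAt_plateau _ _ τ).mul_const _)
    (hasDerivAt_id τ)

theorem plateau_one_two_of_abs_le {τ : ℝ} (h : |τ| ≤ 1) : plateau 1 2 τ = 1 :=
  plateau_eq_one (by norm_num) (by norm_num) h

theorem deriv_plateau_one_two_zero : deriv (plateau 1 2) 0 = 0 := by
  have h : plateau 1 2 =ᶠ[nhds 0] fun _ => 1 := by
    filter_upwards [Metric.ball_mem_nhds (0 : ℝ) one_pos] with x hx
    rw [Metric.mem_ball, dist_zero_right, Real.norm_eq_abs] at hx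
    exact plateau_one_two_of_abs_le hx.le
  rw [h.deriv_eq]
  simp

theorem hasDerivAt_shiftedAxis_zero (w : ℝ × ℝ) :
    HasDerivAt (shiftedAxis w) !₂[0, 0, 1] 0 := by
  simpa [deriv_plateau_one_two_zero] using hasDerivAt_shiftedAxis w 0

theorem plateau_quarter_half_abs_le (x : ℝ) : |plateau (1 / 4) (1 / 2) x| ≤ 1 := by
  rw [plateau, abs_of_nonneg (Real.smoothTransition.nonneg _)]
  exact Real.smoothTransition.le_one _

/-- The bump of the first strand has height at most `1`, so a meeting point lies on the part where
the third strand is exactly vertical and its position is `w`. -/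
theorem strandModel_zero_height {y : ℝ} (hy : y ∈ Set.Icc (-1 : ℝ) 1) {w : ℝ × ℝ} {a b : ℝ}
    (h : shiftedAxis w a = strandModel shiftedAxis 0 y w b) :
    b = w.1 ∧ w.2 = 0 ∧ a = y * plateau (1 / 4) (1 / 2) w.1 := by
  obtain ⟨h1, h2, h3⟩ := vec_eq_iff.1 h
  have ha : |a| ≤ 1 := by
    rw [h3, abs_mul]
    exact mul_le_one₀ (abs_le.2 hy) (abs_nonneg _) (plateau_quarter_half_abs_le b)
  rw [plateau_one_two_of_abs_le ha, one_mul] at h1 h2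
  exact ⟨h1.symm, h2, by rw [h1, h3]⟩

theorem strandModel_one_height {y : ℝ} {w : ℝ × ℝ} {a b : ℝ}
    (h : shiftedAxis w a = strandModel shiftedAxis 1 y w b) : a = 0 ∧ w.1 = 0 ∧ b = w.2 := by
  obtain ⟨h1, h2, h3⟩ := vec_eq_iff.1 h
  rw [h3, plateau_one_two_of_abs_le (by simp), one_mul] at h1 h2
  exact ⟨h3, h1, h2.symm⟩

theorem SlotWord.loc_eq_iff {n N : ℕ} {W : SlotWord n N} {p : Fin n} (hp : p ≠ W.special)
    {i : Fin (N + 1)} : W.loc p i = p ↔ i = 0 ∨ i = W.first p ∨ i = W.second p := by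
  by_cases hi : i = 0
  · simp [hi]
  · simp only [SlotWord.loc, hi, if_false, false_or]
    exact W.letter_eq_iff p hp i

/-! ### The crossings of the third strand with the two strands of a chord -/

section Crossings

variable {n N : ℕ} {W : SlotWord n N} {p : Fin n} {η : ℝ}

theorem deriv_shiftedAxis_ne_zero (w : ℝ × ℝ) (t : ℝ) : deriv (shiftedAxis w) t ≠ 0 := by
  rw [(hasDerivAt_shiftedAxis w t).deriv]
  exact vec_ne_zero_of (by simp)

/-- The resolution of the chord `p` moves its strand only near the origin and does not reach the
points at distance `1`, where the third strand crosses. -/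
theorem plateau_quarter_half_of_abs_eq_one (hη : |η| = 1) : plateau (1 / 4) (1 / 2) η = 0 :=
  plateau_eq_zero (by norm_num) (by norm_num) (by rw [hη]; norm_num)

/-- The third strand moves along the line of points `(η, x)` and meets the first axis at `x = 0`
only; it misses the second axis because `η ≠ 0`. The crossing is positive because the third, first
and second axes, in this order, form a positive basis. -/
theorem SlotWord.isCrossing_first (hp : p ≠ W.special) (hη : |η| = 1) :
    W.IsCrossing shiftedAxis p (fun x => (η, x)) (W.first p) 0 η where
  smooth := by fun_prop
  mem x hx := ⟨⟨(abs_le.1 hη.le).1, hx.1⟩, ⟨(abs_le.1 hη.le).2, hx.2⟩⟩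
  loc_eq := W.loc_first p hp
  abs_le_fst := by simp
  abs_le_snd := hη.le
  ne_zero := by rintro rfl; simp at hη
  lt := Or.inl (Fin.pos_iff_ne_zero.2 (W.first_ne_zero hp))
  immersion x _ t := deriv_shiftedAxis_ne_zero _ t
  double_point x hx y hy i hi a b h := by
    rcases (SlotWord.loc_eq_iff hp).1 hi with rfl | rfl | rfl
    · rw [W.strand_zero] at h
      exact Or.inl ⟨rfl, (vec_eq_iff.1 h).2.2⟩
    · rw [SlotWord.strand_first hp] at h
      obtain ⟨h1, h2, h3⟩ := strandModel_zero_height hy h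
      rw [plateau_quarter_half_of_abs_eq_one hη, mul_zero] at h3
      exact Or.inr ⟨h2, Or.inl ⟨h3, rfl, h1⟩⟩
    · rw [SlotWord.strand_second hp] at h
      obtain ⟨h1, h2, h3⟩ := strandModel_one_height h
      simp only at h2
      simp [h2] at hη
  meet y := by
    rw [SlotWord.strand_first hp]
    rw [strandModel, plateau_quarter_half_of_abs_eq_one hη]
    simp [shiftedAxis, plateau_one_two_of_abs_le]
  positive y := by
    rw [SlotWord.strand_first hp]
    refine ⟨_, _, !₂[0, 1, 0], 0, hasDerivAt_shiftedAxis_zero _,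
      hasDerivAt_strandModel_zero _ _ _ _, ?_, hasDerivAt_const _ _, ?_⟩
    · simp only [shiftedAxis, plateau_one_two_of_abs_le (τ := 0) (by simp), one_mul]
      exact hasDerivAt_vec (hasDerivAt_const _ _) (hasDerivAt_id' _) (hasDerivAt_const _ _)
    · rw [sub_zero, det_vec]
      norm_num

/-- The minus sign in `-x` is dictated by the orientation: the third axis, the second axis and the
negative first axis form a positive basis. This sign makes the four corners cancel in the four-term
relation. -/
theorem SlotWord.isCrossing_second (hp : p ≠ W.special) (hη : |η| = 1) :
    W.IsCrossing shiftedAxis p (fun x => (-x, η)) (W.second p) 0 η where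
  smooth := by fun_prop
  mem x hx := ⟨⟨neg_le_neg hx.2, (abs_le.1 hη.le).1⟩, ⟨neg_le.1 hx.1, (abs_le.1 hη.le).2⟩⟩
  loc_eq := W.loc_second p hp
  abs_le_fst := by simp
  abs_le_snd := hη.le
  ne_zero := by rintro rfl; simp at hη
  lt := Or.inl (Fin.pos_iff_ne_zero.2 (W.second_ne_zero hp))
  immersion x _ t := deriv_shiftedAxis_ne_zero _ t
  double_point x hx y hy i hi a b h := by
    rcases (SlotWord.loc_eq_iff hp).1 hi with rfl | rfl | rfl
    · rw [W.strand_zero] at h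
      exact Or.inl ⟨rfl, (vec_eq_iff.1 h).2.2⟩
    · rw [SlotWord.strand_first hp] at h
      obtain ⟨h1, h2, h3⟩ := strandModel_zero_height hy h
      simp only at h2
      simp [h2] at hη
    · rw [SlotWord.strand_second hp] at h
      obtain ⟨h1, h2, h3⟩ := strandModel_one_height h
      exact Or.inr ⟨neg_eq_zero.1 h2, Or.inl ⟨h1, rfl, h3⟩⟩
  meet y := by
    rw [SlotWord.strand_second hp]
    simp [shiftedAxis, strandModel, plateau_one_two_of_abs_le]
  positive y := by
    rw [SlotWord.strand_second hp]
    refine ⟨_, _, !₂[-1, 0, 0], 0, hasDerivAt_shiftedAxis_zero _,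
      hasDerivAt_strandModel_one _ _ _ _, ?_, hasDerivAt_const _ _, ?_⟩
    · simp only [shiftedAxis, plateau_one_two_of_abs_le (τ := 0) (by simp), one_mul]
      exact hasDerivAt_vec (hasDerivAt_neg _) (hasDerivAt_const _ _) (hasDerivAt_const _ _)
    · rw [sub_zero, det_vec]
      norm_num

end Crossings

/-! ### The symbol on realized diagrams -/

/-- An alternating sum vanishes if its terms do not depend on one of the signs. -/
theorem sum_prod_units_mul_eq_zero {n : ℕ} {F : Type*} [Field F] (q : Fin n)
    (g : (Fin n → ℤˣ) → F) (hg : ∀ ε, g (Function.update ε q (-ε q)) = g ε) :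
    ∑ ε : Fin n → ℤˣ, (∏ c, ((ε c : ℤ) : F)) * g ε = 0 := by
  have hne : ∀ x : ℤˣ, -x ≠ x := by decide
  -- Flipping the sign at `q` pairs off the terms, since it reverses the product of signs.
  refine Finset.sum_involution (fun ε _ => Function.update ε q (-ε q)) (fun ε _ => ?_)
    (fun ε _ _ h => ?_) (fun _ _ => Finset.mem_univ _) (fun ε _ => by simp)
  · have h : (∏ c, ((Function.update ε q (-ε q) c : ℤ) : F)) = -∏ c, ((ε c : ℤ) : F) := by
      rw [← Finset.mul_prod_erase _ _ (Finset.mem_univ q),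
        ← Finset.mul_prod_erase _ (fun c => ((ε c : ℤ) : F)) (Finset.mem_univ q), ← neg_mul]
      congr 1
      · simp
      · refine Finset.prod_congr rfl fun c hc => ?_
        rw [Function.update_of_ne (Finset.ne_of_mem_erase hc)]
    rw [h, hg]
    ring
  · exact hne (ε q) (by simpa using congrFun h q)

section Symbol

variable {M : Type*} [TopologicalSpace M] [ChartedSpace (EuclideanSpace ℝ (Fin 3)) M]

/-- A chart that is onto `ℝ³` and preserves the orientation, and a smooth loop at its center. -/
structure ChartedLoop (o : ManifoldOrientation M) where
  chart : OpenPartialHomeomorph M (EuclideanSpace ℝ (Fin 3))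
  isSmoothChart : IsSmoothChart chart
  target_eq : chart.target = Set.univ
  positive : ∀ z e₁ e₂ e₃, 0 < (Matrix.of ![e₁.ofLp, e₂.ofLp, e₃.ofLp]).det →
    o.IsPositive (chart.symm z) (chartFrame chart z e₁) (chartFrame chart z e₂)
      (chartFrame chart z e₃)
  loop : C(ℝ, M)
  smooth : ContMDiff 𝓘(ℝ, ℝ) (𝓡 3) ∞ loop
  loop_zero : loop 0 = chart.symm 0
  loop_one : loop 1 = chart.symm 0

variable {n N : ℕ} {o : ManifoldOrientation M}

/-- The framings that can be realized with the help of a loop. -/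
def ChartedLoop.Realizes (B : ChartedLoop o) (α : ModTwoCocycle M) (fr : Fin n → ZMod 2) : Prop :=
  (∀ c, fr c = 0) ∨ α.onArc B.loop 0 1 = 1

/-- An odd chord cuts off from the knot a loop at its double point on which `α` is `1`. If all
chords are even, a constant loop will do. -/
theorem exists_chartedLoop [IsManifold (𝓡 3) ∞ M] (o : ManifoldOrientation M)
    (α : ModTwoCocycle M) (K : SingularKnot M n) :
    ∃ B : ChartedLoop o, B.Realizes α (K.framedArcDiagram α).framing := by
  by_cases h : ∀ c, (K.framedArcDiagram α).framing c = 0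
  · obtain ⟨e, he, het, he0, hpos⟩ := exists_oriented_chart o (K.toFun 0)
    exact ⟨⟨e, he, het, hpos, ContinuousMap.const ℝ (K.toFun 0), contMDiff_const, he0.symm,
      he0.symm⟩, Or.inl h⟩
  · push Not at h
    obtain ⟨c, hc⟩ := h
    have h1 : α.onArc K.toContinuousMap (K.fst c) (K.snd c) = 1 := by
      have h2 : ∀ x : ZMod 2, x ≠ 0 → x = 1 := by decide
      exact h2 _ hc
    obtain ⟨e, he, het, he0, hpos⟩ := exists_oriented_chart o (K.toFun (K.fst c))
    let y : C(ℝ, ℝ) := ⟨fun t => K.fst c + t * (K.snd c - K.fst c), by fun_prop⟩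
    have hy : ContDiff ℝ ∞ y := by
      change ContDiff ℝ ∞ fun t => K.fst c + t * (K.snd c - K.fst c)
      fun_prop
    have hK : K.toFun (K.snd c) = K.toFun (K.fst c) :=
      (K.double_points _ ⟨(K.fst_nonneg c).trans (K.fst_lt_snd c).le, K.snd_lt_one c⟩ _
        ⟨K.fst_nonneg c, (K.fst_lt_snd c).trans (K.snd_lt_one c)⟩).2
        (Or.inr ⟨c, Or.inr ⟨rfl, rfl⟩⟩)
    have hy0 : y 0 = K.fst c := by simp [y]
    have hy1 : y 1 = K.snd c := by simp [y]
    refine ⟨⟨e, he, het, hpos, K.toContinuousMap.comp y,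
      K.smooth.comp (contMDiff_iff_contDiff.2 hy), ?_, ?_⟩, Or.inr ?_⟩
    · change K.toFun (y 0) = _
      rw [hy0, he0]
    · change K.toFun (y 1) = _
      rw [hy1, he0, hK]
    · change α.onArc (K.toContinuousMap.comp y) 0 1 = 1
      rw [α.onArc_comp, hy0, hy1, h1]

/-- The loop of a singular knot realizes the framings of all diagrams with the same closure. -/
theorem ChartedLoop.Realizes.of_closure_eq {B : ChartedLoop o} {α : ModTwoCocycle M}
    {D D' : FramedArcDiagram n} (h : B.Realizes α D.framing) (hD : D.closure = D'.closure) :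
    B.Realizes α D'.framing := by
  obtain ⟨π, -, hπ⟩ : D.SameClosure D' := Quotient.exact hD
  refine h.imp_left fun h c => ?_
  have := hπ (π⁻¹ c)
  simpa [h] using this

/-- If no loop realizes the framings of a diagram, then the symbol is zero. -/
theorem symbol_closure_eq_zero [IsManifold (𝓡 3) ∞ M] {F : Type*} [Field F] {α : ModTwoCocycle M}
    {v : Knot M → F} {D : FramedArcDiagram n}
    (h : ∀ B : ChartedLoop o, ¬ B.Realizes α D.framing) : symbol o α v n D.closure = 0 := by
  rw [symbol, dif_neg]
  rintro ⟨K, -, -, hD⟩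
  obtain ⟨B, hB⟩ := exists_chartedLoop o α K
  exact h B (hB.of_closure_eq hD)

variable {W : SlotWord n N} {p : Fin n} {fr : Fin n → ZMod 2}
  {k : ℝ × ℝ → ℝ → EuclideanSpace ℝ (Fin 3)} {w : ℝ → ℝ × ℝ} {j : Fin (N + 1)} {θ τ : ℝ}

/-- The symbol of a diagram that is realized by a singular knot of a family. -/
theorem SlotWord.Family.symbol_closure {F : Type*} [Field F] {α : ModTwoCocycle M}
    {v : Knot M → F} (hgood : IsGood o α v n) (B : ChartedLoop o)
    (hB : B.Realizes α fr) (G : W.Family B.chart B.loop p fr k) (h : W.IsCrossing k p w j θ τ)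
    {D : FramedArcDiagram n} {m : ℕ}
    (hm : m = j + 1 ∧ (if j = 0 then θ else 0) < τ ∨ m = j ∧ τ < (if j = 0 then θ else 0))
    (hword : D.word = W.insertedWord m)
    (hframing : ∀ c, D.framing c = if c = W.special then fr W.special + W.level fr j else fr c) :
    symbol o α v n D.closure = ∑ ε : Fin n → ℤˣ, (∏ c, ((ε c : ℤ) : F)) *
      knotValue v (G.curve (Function.update (fun c => ((ε c : ℤ) : ℝ)) W.special 0,
        w ((ε W.special : ℤ) : ℝ))) := by
  obtain ⟨K, R, h1, h2, h3, h4, h5⟩ := G.exists_singularKnot B.isSmoothChart B.target_eq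
    B.positive h α B.loop (fun _ => rfl) (by rw [B.loop_zero, B.loop_one]) hB
  have hD : K.framedArcDiagram α = D := by
    have hw : (K.framedArcDiagram α).word = D.word :=
      (G.word_eq h.abs_le_fst h.abs_le_snd K h1 h2 hm).trans hword.symm
    have hf : (K.framedArcDiagram α).framing = D.framing :=
      funext fun c => (h5 c).trans (hframing c).symm
    generalize K.framedArcDiagram α = D' at hw hf
    cases D
    cases D'
    cases hw
    cases hf
    rfl
  rw [← hD]
  refine (symbol_eq hgood R h4).trans ?_
  rw [R.alternatingSum_eq]
  simp only [h3]
  rfl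

/-- A configuration of the four-term relation comes from a word in which one end of the moving chord
is missing. -/
theorem IsFourTermConfiguration.exists_slotWord {p q : Fin n} {D₁ D₂ D₃ D₄ : FramedArcDiagram n}
    (h : IsFourTermConfiguration p q D₁ D₂ D₃ D₄) :
    p ≠ q ∧ ∃ (N : ℕ) (W : SlotWord n N), W.special = q ∧
      D₁.word = W.insertedWord (W.first p + 1) ∧ D₂.word = W.insertedWord (W.first p) ∧
      D₃.word = W.insertedWord (W.second p + 1) ∧ D₄.word = W.insertedWord (W.second p) := by
  obtain ⟨⟨X, Y, Z, h1, h2, h3, h4⟩, -⟩ := h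
  have hcount := D₁.count_word
  simp only [h1, List.count_append, List.count_cons, List.count_nil] at hcount
  have hpq : p ≠ q := by
    rintro rfl
    have := hcount p
    simp at this
    omega
  -- The word `q :: T` is common to the four diagrams; they differ in where the second `q` is
  -- inserted.
  let T := X ++ p :: (Y ++ p :: Z)
  obtain ⟨W, hW1, hW2⟩ := _root_.exists_slotWord q T
    (by
      have := hcount q
      simp [hpq] at this
      simp [T, hpq]
      omega)
    (by
      intro c hc
      have := hcount c
      simp [hc.symm] at this
      simp [T, List.count_cons]
      omega)
  have hp : p ≠ W.special := hW1 ▸ hpq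
  have hofFn : List.ofFn W.letter = q :: T := by rw [hW2, List.ofFn_get]
  have hab : ((W.first p : ℕ) = X.length + 1) ∧ (W.second p : ℕ) = X.length + Y.length + 2 := by
    have ha : X.length + 1 < T.length + 1 := by simp [T]
    have hb : X.length + Y.length + 2 < T.length + 1 := by simp [T]; omega
    have h1 : W.letter ⟨X.length + 1, ha⟩ = p := by
      rw [hW2]
      simp [T]
    have h2 : W.letter ⟨X.length + Y.length + 2, hb⟩ = p := by
      rw [hW2]
      have : X.length + Y.length + 1 = X.length + (Y.length + 1) := by ring
      simp [T, this, List.getElem_append_right]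
    rw [W.letter_eq_iff p hp, Fin.ext_iff, Fin.ext_iff] at h1 h2
    have h3 : (W.first p : ℕ) < W.second p := W.first_lt_second p hp
    simp only at h1 h2
    omega
  refine ⟨hpq, _, W, hW1, ?_⟩
  rw [hab.1, hab.2, h1, h2, h3, h4]
  refine ⟨?_, ?_, ?_, ?_⟩
  · rw [SlotWord.insertedWord_eq (A := q :: X ++ [p]) (B := Y ++ p :: Z) (by rw [hofFn]; simp [T])
      (by simp), hW1]
    simp
  · rw [SlotWord.insertedWord_eq (A := q :: X) (B := p :: Y ++ p :: Z) (by rw [hofFn]; simp [T])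
      (by simp), hW1]
    simp
  · rw [SlotWord.insertedWord_eq (A := q :: X ++ p :: Y ++ [p]) (B := Z) (by rw [hofFn]; simp [T])
      (by simp; omega), hW1]
    simp
  · rw [SlotWord.insertedWord_eq (A := q :: X ++ p :: Y) (B := p :: Z) (by rw [hofFn]; simp [T])
      (by simp; omega), hW1]
    simp

/-- The symbol satisfies the framed four-term relations. -/
theorem symbol_fourTerm [T2Space M] [IsManifold (𝓡 3) ∞ M] {F : Type*} [Field F]
    {α : ModTwoCocycle M} {v : Knot M → F} (hgood : IsGood o α v n) {p q : Fin n}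
    {D₁ D₂ D₃ D₄ : FramedArcDiagram n} (h : IsFourTermConfiguration p q D₁ D₂ D₃ D₄) :
    symbol o α v n D₁.closure - symbol o α v n D₂.closure +
      (symbol o α v n D₃.closure - symbol o α v n D₄.closure) = 0 := by
  obtain ⟨hpq, N, W, rfl, hw1, hw2, hw3, hw4⟩ := h.exists_slotWord
  obtain ⟨-, hf2, hf3, hf4⟩ := h
  -- If no loop realizes `D₁`, then none realizes `D₃` either, and in that case all four symbols
  -- vanish.
  have hzero : (∀ c, D₃.framing c = 0) → ∀ c, D₁.framing c = 0 := by
    intro h0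
    have hp : D₁.framing p = 0 := by
      have := h0 p
      rwa [hf3, Function.update_of_ne hpq] at this
    intro c
    have := h0 c
    rw [hf3] at this
    by_cases hc : c = W.special
    · subst hc
      simpa [hp] using this
    · rwa [Function.update_of_ne hc] at this
  by_cases hB : ∃ B : ChartedLoop o, B.Realizes α D₁.framing
  · obtain ⟨B, hB⟩ := hB
    -- One family serves all four diagrams, which use different paths of its two plane parameters.
    obtain ⟨G⟩ := SlotWord.nonempty_family (W := W) (p := p) (fr := D₁.framing) B.isSmoothChart
      B.target_eq B.smooth B.loop_zero B.loop_one isThirdStrand_shiftedAxis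
    have h0 := W.first_ne_zero hpq
    have h0' := W.second_ne_zero hpq
    have hfirst : ∀ c, D₁.framing c = if c = W.special then
        D₁.framing W.special + W.level D₁.framing (W.first p) else D₁.framing c := by
      intro c
      rw [SlotWord.level_first _ hpq, add_zero]
      split_ifs with hc
      · rw [hc]
      · rfl
    -- The second end of `p` sits at the level of its framing, which is therefore added to the
    -- framing of the moving chord.
    have hsecond : ∀ c, D₃.framing c = if c = W.special then
        D₁.framing W.special + W.level D₁.framing (W.second p) else D₁.framing c := by
      intro c
      rw [SlotWord.level_second _ hpq, hf3, Function.update_apply, add_comm]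
    rw [G.symbol_closure hgood B hB (SlotWord.isCrossing_first hpq (η := 1) (by simp))
        (Or.inl ⟨rfl, by simp [h0]⟩) hw1 hfirst,
      G.symbol_closure hgood B hB (SlotWord.isCrossing_first hpq (η := -1) (by simp))
        (Or.inr ⟨rfl, by simp [h0]⟩) hw2 (by rwa [hf2]),
      G.symbol_closure hgood B hB (SlotWord.isCrossing_second hpq (η := 1) (by simp))
        (Or.inl ⟨rfl, by simp [h0']⟩) hw3 hsecond,
      G.symbol_closure hgood B hB (SlotWord.isCrossing_second hpq (η := -1) (by simp))
        (Or.inr ⟨rfl, by simp [h0']⟩) hw4 (by rwa [hf4]),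
      ← Finset.sum_sub_distrib, ← Finset.sum_sub_distrib, ← Finset.sum_add_distrib]
    simp only [← mul_sub, ← mul_add]
    -- For either sign of the moving chord the four terms add up to the value at the corner `(1, 1)`
    -- minus that at `(-1, -1)`.
    refine sum_prod_units_mul_eq_zero W.special _ fun ε => ?_
    have hupd : Function.update (fun c => ((Function.update ε W.special (-ε W.special) c : ℤ) : ℝ))
        W.special 0 = Function.update (fun c => ((ε c : ℤ) : ℝ)) W.special 0 := by
      ext c
      by_cases hc : c = W.special
      · subst hc; simp
      · simp [Function.update_of_ne hc]
    rw [hupd, Function.update_self]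
    rcases Int.units_eq_one_or (ε W.special) with h1 | h1 <;> simp [h1]
  · push Not at hB
    have hB3 : ∀ B : ChartedLoop o, ¬ B.Realizes α D₃.framing :=
      fun B h => hB B (h.imp_left hzero)
    rw [symbol_closure_eq_zero hB, symbol_closure_eq_zero (D := D₂) (by rwa [hf2]),
      symbol_closure_eq_zero hB3, symbol_closure_eq_zero (D := D₄) (by rwa [hf4])]
    simp

end Symbol

/-! ### The kink of the one-term relation -/

/-- An even smooth function that is decreasing on `[0, 2]` and zero on `[2, ∞)`. -/
def kinkRadius (τ : ℝ) : ℝ := expNegInvGlue (4 - τ ^ 2) / expNegInvGlue 3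

theorem expNegInvGlue_three_pos : 0 < expNegInvGlue 3 := expNegInvGlue.pos_of_pos (by norm_num)

theorem contDiff_kinkRadius : ContDiff ℝ ∞ kinkRadius :=
  (expNegInvGlue.contDiff.comp (by fun_prop : ContDiff ℝ ∞ fun τ : ℝ => 4 - τ ^ 2)).div_const _

theorem kinkRadius_nonneg (τ : ℝ) : 0 ≤ kinkRadius τ :=
  div_nonneg (expNegInvGlue.nonneg _) expNegInvGlue_three_pos.le

theorem kinkRadius_eq_zero_iff {τ : ℝ} : kinkRadius τ = 0 ↔ 2 ≤ |τ| := by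
  rw [kinkRadius, div_eq_zero_iff, or_iff_left expNegInvGlue_three_pos.ne',
    expNegInvGlue.zero_iff_nonpos, sub_nonpos, ← sq_abs τ]
  constructor <;> intro h
  · nlinarith [abs_nonneg τ]
  · nlinarith

theorem kinkRadius_one : kinkRadius 1 = 1 := by
  rw [kinkRadius]
  norm_num [expNegInvGlue_three_pos.ne']

theorem kinkRadius_neg (τ : ℝ) : kinkRadius (-τ) = kinkRadius τ := by
  simp [kinkRadius]

/-- On its support the radius is an injective function of `τ ^ 2`, so the curl can cross itself at
opposite times only. -/
theorem sq_eq_of_kinkRadius_eq {a b : ℝ} (h : kinkRadius a = kinkRadius b) (ha : |a| < 2) :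
    a ^ 2 = b ^ 2 := by
  have hb : |b| < 2 := by
    by_contra hb
    rw [not_lt, ← kinkRadius_eq_zero_iff, ← h, kinkRadius_eq_zero_iff] at hb
    linarith
  have hpos : ∀ x : ℝ, |x| < 2 → 0 < 4 - x ^ 2 := by
    intro x hx
    rw [← sq_abs]
    nlinarith [abs_nonneg x]
  have h1 : expNegInvGlue (4 - a ^ 2) = expNegInvGlue (4 - b ^ 2) := by
    unfold kinkRadius at h
    exact (div_left_inj' expNegInvGlue_three_pos.ne').1 h
  rw [expNegInvGlue, expNegInvGlue, if_neg (not_le.2 (hpos a ha)), if_neg (not_le.2 (hpos b hb)),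
    Real.exp_eq_exp, neg_inj, inv_inj] at h1
  linarith

theorem hasDerivAt_kinkRadius {τ : ℝ} (h : |τ| < 2) :
    HasDerivAt kinkRadius (kinkRadius τ * (-(2 * τ) / (4 - τ ^ 2) ^ 2)) τ := by
  have hpos : 0 < 4 - τ ^ 2 := by
    rw [← sq_abs]
    nlinarith [abs_nonneg τ]
  have h1 : HasDerivAt (fun x : ℝ => 4 - x ^ 2) (-(2 * τ)) τ := by
    simpa using (hasDerivAt_pow 2 τ).const_sub 4
  have h2 : kinkRadius =ᶠ[nhds τ] fun x => Real.exp (-(4 - x ^ 2)⁻¹) / expNegInvGlue 3 := by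
    filter_upwards [h1.continuousAt.eventually (lt_mem_nhds hpos)] with x hx
    rw [kinkRadius, expNegInvGlue, if_neg (not_le.2 hx)]
  have h3 := ((h1.fun_inv hpos.ne').fun_neg.exp.div_const (expNegInvGlue 3)).congr_of_eventuallyEq h2
  refine h3.congr_deriv ?_
  rw [h2.eq_of_nhds]
  ring

theorem deriv_kinkRadius_of_le {τ : ℝ} (h : 2 ≤ |τ|) : deriv kinkRadius τ = 0 := by
  refine IsLocalMin.deriv_eq_zero (Filter.Eventually.of_forall fun x => ?_)
  rw [kinkRadius_eq_zero_iff.2 h]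
  exact kinkRadius_nonneg x

theorem deriv_kinkRadius_ne_zero {τ : ℝ} (h : |τ| < 2) (h0 : τ ≠ 0) : deriv kinkRadius τ ≠ 0 := by
  have hpos : 0 < 4 - τ ^ 2 := by
    rw [← sq_abs]
    nlinarith [abs_nonneg τ]
  rw [(hasDerivAt_kinkRadius h).deriv]
  have hne : kinkRadius τ ≠ 0 := fun h' => absurd (kinkRadius_eq_zero_iff.1 h') (not_le.2 h)
  exact mul_ne_zero hne (div_ne_zero (neg_ne_zero.2 (mul_ne_zero two_ne_zero h0))
    (pow_ne_zero 2 hpos.ne'))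

/-- This is needed for the velocity of the kink at time `0` when `w = (0, 1)`. -/
theorem kinkRadius_zero_ne_one : kinkRadius 0 ≠ 1 := by
  intro h
  rw [← kinkRadius_one] at h
  have := sq_eq_of_kinkRadius_eq h (by simp)
  norm_num at this

/-- A curl on the third axis: with `w.2 = 1` it crosses itself, positively or negatively depending
on the sign of `w.1`; with `w.2 = 0` it is a graph over the third axis. -/
def kink (w : ℝ × ℝ) (τ : ℝ) : EuclideanSpace ℝ (Fin 3) :=
  !₂[kinkRadius τ, w.1 * (τ * kinkRadius τ), τ * (1 - w.2 * kinkRadius τ)]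

theorem isThirdStrand_kink : IsThirdStrand kink where
  smooth := by
    have h : ContDiff ℝ ∞ fun x : (ℝ × ℝ) × ℝ => kinkRadius x.2 :=
      contDiff_kinkRadius.comp contDiff_snd
    exact contDiff_vec h (ContDiff.mul (by fun_prop) (contDiff_snd.mul h))
      (contDiff_snd.mul (contDiff_const.sub (ContDiff.mul (by fun_prop) h)))
  eq_of_le w τ hτ := by simp [kink, kinkRadius_eq_zero_iff.2 hτ]

theorem hasDerivAt_kink (w : ℝ × ℝ) {τ ρ : ℝ} (h : HasDerivAt kinkRadius ρ τ) :
    HasDerivAt (kink w) !₂[ρ, w.1 * (kinkRadius τ + τ * ρ),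
      (1 - w.2 * kinkRadius τ) - τ * (w.2 * ρ)] τ := by
  refine hasDerivAt_vec h ?_ ?_
  · simpa using ((hasDerivAt_id' τ).fun_mul h).const_mul w.1
  · have := (hasDerivAt_id' τ).fun_mul ((h.const_mul w.2).const_sub 1)
    refine this.congr_deriv ?_
    ring

/-- For `0 < |τ| < 2` the radius has nonzero derivative, and for `2 ≤ |τ|` the curve is the third
axis. The condition on `w` is needed at `τ = 0` only. -/
theorem deriv_kink_ne_zero {w : ℝ × ℝ} (hw : w.1 ≠ 0 ∨ w.2 = 0 ∨ w.2 = 1) (τ : ℝ) :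
    deriv (kink w) τ ≠ 0 := by
  have hd := (contDiff_kinkRadius.differentiable (by simp) τ).hasDerivAt
  rw [(hasDerivAt_kink w hd).deriv]
  apply vec_ne_zero_of
  by_cases h2 : 2 ≤ |τ|
  · rw [deriv_kinkRadius_of_le h2, kinkRadius_eq_zero_iff.2 h2]
    simp
  by_cases h0 : τ = 0
  · subst h0
    have hne : kinkRadius 0 ≠ 0 := fun h' => h2 (kinkRadius_eq_zero_iff.1 h')
    right
    rcases hw with hw | hw | hw
    · left
      simp [hw, hne]
    · simp [hw]
    · right
      simpa [hw, sub_eq_zero] using kinkRadius_zero_ne_one.symm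
  · exact Or.inl (deriv_kinkRadius_ne_zero (not_le.1 h2) h0)

/-- The first coordinate gives `b = ±a` on the support of the radius. For `b = -a ≠ 0`, the second
and third coordinates are odd in the time and must vanish. -/
theorem kink_eq_kink {w : ℝ × ℝ} {a b : ℝ} (h : kink w a = kink w b) :
    a = b ∨ w.1 = 0 ∧ b = -a ∧ w.2 * kinkRadius a = 1 := by
  obtain ⟨h1, h2, h3⟩ := vec_eq_iff.1 h
  by_cases ha : 2 ≤ |a|
  · have ha' := kinkRadius_eq_zero_iff.2 ha
    rw [← h1, ha'] at h3
    simpa using Or.inl h3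
  have hr : kinkRadius a ≠ 0 := fun h' => ha (kinkRadius_eq_zero_iff.1 h')
  rcases sq_eq_sq_iff_eq_or_eq_neg.1 (sq_eq_of_kinkRadius_eq h1 (not_le.1 ha)) with hab | hab
  · exact Or.inl hab
  · by_cases ha0 : a = 0
    · left
      linarith
    have hb : b = -a := by linarith
    subst hb
    rw [← h1] at h2 h3
    right
    have h4 : w.1 * (a * kinkRadius a) = 0 := by linarith
    have h5 : a * (1 - w.2 * kinkRadius a) = 0 := by linarith
    refine ⟨(mul_eq_zero.1 h4).resolve_right (mul_ne_zero ha0 hr), rfl, ?_⟩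
    linarith [(mul_eq_zero.1 h5).resolve_left ha0]

section Crossing

variable {n N : ℕ} {W : SlotWord n N}

theorem SlotWord.loc_special_eq_iff {i : Fin (N + 1)} : W.loc W.special i = W.special ↔ i = 0 := by
  by_cases hi : i = 0
  · simp [hi]
  · simp only [SlotWord.loc, hi, if_false]
    rw [W.letter_eq_special_iff]
    simp [hi]

/-- The normalization `kinkRadius 1 = 1` places the self-crossing at the local times `-1` and `1`;
the parameter `w.1` pulls the two branches apart along the second axis. -/
theorem SlotWord.isCrossing_kink :
    W.IsCrossing kink W.special (fun x => (x, 1)) 0 (-1) 1 where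
  smooth := by fun_prop
  mem x hx := ⟨⟨hx.1, by norm_num⟩, ⟨hx.2, le_refl _⟩⟩
  loc_eq := W.loc_zero _
  abs_le_fst := by simp
  abs_le_snd := by simp
  ne_zero := one_ne_zero
  lt := Or.inr ⟨rfl, by norm_num⟩
  immersion x _ t := deriv_kink_ne_zero (Or.inr (Or.inr rfl)) t
  double_point x hx y hy i hi a b h := by
    obtain rfl := SlotWord.loc_special_eq_iff.1 hi
    rw [W.strand_zero] at h
    rcases kink_eq_kink h with h | ⟨h1, h2, h3⟩
    · exact Or.inl ⟨rfl, h⟩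
    · right
      refine ⟨h1, ?_⟩
      simp only [one_mul] at h3
      rw [← kinkRadius_one] at h3
      have ha : a = 1 ∨ a = -1 := sq_eq_sq_iff_eq_or_eq_neg.1
        (sq_eq_of_kinkRadius_eq h3.symm (by norm_num)).symm
      rcases ha with rfl | rfl
      · exact Or.inr ⟨rfl, rfl, rfl, h2⟩
      · exact Or.inl ⟨rfl, rfl, by rw [h2, neg_neg]⟩
  meet y := by
    rw [W.strand_zero]
    simp [strandModel, kink, kinkRadius_neg, kinkRadius_one]
  positive y := by
    rw [W.strand_zero]
    have h1 := hasDerivAt_kinkRadius (τ := 1) (by norm_num)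
    have h2 := hasDerivAt_kinkRadius (τ := -1) (by norm_num)
    refine ⟨_, _, !₂[0, -1, 0], !₂[0, 1, 0], hasDerivAt_kink _ h2, hasDerivAt_kink _ h1, ?_, ?_, ?_⟩
    · simp only [kink, kinkRadius_neg, kinkRadius_one]
      exact hasDerivAt_vec (hasDerivAt_const _ _) (by simpa using (hasDerivAt_neg' (0 : ℝ)))
        (hasDerivAt_const _ _)
    · simp only [strandModel, kink, kinkRadius_one]
      exact hasDerivAt_vec (hasDerivAt_const _ _) (by simpa using (hasDerivAt_id' (0 : ℝ)))
        (hasDerivAt_const _ _)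
    · have : (!₂[0, -1, 0] : EuclideanSpace ℝ (Fin 3)) - !₂[0, 1, 0] = !₂[0, -2, 0] := by
        ext i
        fin_cases i <;> norm_num
      rw [this, det_vec, kinkRadius_neg, kinkRadius_one]
      norm_num

end Crossing

/-! ### The one-term relation for the symbol -/

section OneTerm

variable {M : Type*} [TopologicalSpace M] [ChartedSpace (EuclideanSpace ℝ (Fin 3)) M] {n N : ℕ}
  {e : OpenPartialHomeomorph M (EuclideanSpace ℝ (Fin 3))}
  {L : ℝ → M} {W : SlotWord n N} {fr : Fin n → ZMod 2}

/-- As long as the kink is embedded, the curves of the family are knots. -/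
theorem SlotWord.Family.exists_knot (G : W.Family e L W.special fr kink)
    {q : (Fin n → ℝ) × (ℝ × ℝ)} (hq : q ∈ Set.Icc (-1 : (Fin n → ℝ) × (ℝ × ℝ)) 1)
    (h0 : ∀ c ≠ W.special, q.1 c ≠ 0) (hq2 : q.2.1 ≠ 0 ∨ q.2.2 = 0) :
    ∃ K : Knot M, K.toFun = G.curve q := by
  refine ⟨⟨G.curve q, ?_, G.periodic q,
    G.immersion_of (deriv_kink_ne_zero (hq2.imp_right Or.inl)), ?_⟩, rfl⟩
  · exact G.smooth.comp (contMDiff_iff_contDiff.2 (by fun_prop : ContDiff ℝ ∞ fun t : ℝ => (q, t)))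
  · intro s hs t ht hst
    rcases G.multiple_points_of hq hs ht hst with h | ⟨c, hc, hc0, -⟩ | ⟨i, a, b, hi, hab, h⟩
    · exact h
    · exact absurd hc0 (h0 c hc)
    · obtain rfl := SlotWord.loc_special_eq_iff.1 hi
      rw [W.strand_zero] at hab
      have hab' : a = b := by
        rcases kink_eq_kink hab with h | ⟨h1, -, h3⟩
        · exact h
        · rcases hq2 with h' | h'
          · exact absurd h1 h'
          · simp [h'] at h3
      subst hab'
      rcases h with ⟨h1, h2⟩ | ⟨h1, h2⟩ <;> rw [h1, h2]

theorem SlotWord.Family.knotValue_eq (G : W.Family e L W.special fr kink) {F : Type*} [Field F]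
    {v : Knot M → F} (hv : ∀ K K' : Knot M, K.IsIsotopic K' → v K = v K') {a : Fin n → ℝ}
    (ha : a ∈ Set.Icc (-1 : Fin n → ℝ) 1) (h0 : ∀ c ≠ W.special, a c ≠ 0) {z : ℝ → ℝ × ℝ}
    (hz : ContDiff ℝ ∞ z)
    (hz1 : ∀ s ∈ Set.Icc (0 : ℝ) 1, z s ∈ Set.Icc (-1 : ℝ × ℝ) 1 ∧ ((z s).1 ≠ 0 ∨ (z s).2 = 0)) :
    knotValue v (G.curve (a, z 0)) = knotValue v (G.curve (a, z 1)) := by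
  have hK : ∀ s ∈ Set.Icc (0 : ℝ) 1, ∃ K : Knot M, K.toFun = G.curve (a, z s) := fun s hs =>
    G.exists_knot ⟨⟨ha.1, (hz1 s hs).1.1⟩, ⟨ha.2, (hz1 s hs).1.2⟩⟩ h0 (hz1 s hs).2
  obtain ⟨K, hK0⟩ := hK 0 (by simp)
  obtain ⟨K', hK1⟩ := hK 1 (by simp)
  rw [← hK0, ← hK1, knotValue_toFun, knotValue_toFun]
  refine hv K K' ⟨fun s => G.curve (a, z s), ?_, hK0.symm, hK1.symm, hK⟩
  exact G.smooth.comp (contMDiff_iff_contDiff.2 ((contDiff_const.prodMk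
    (hz.comp contDiff_fst)).prodMk contDiff_snd))

/-- The sign of the crossing of the kink does not matter. -/
theorem SlotWord.Family.knotValue_kink (G : W.Family e L W.special fr kink) {F : Type*} [Field F]
    {v : Knot M → F} (hv : ∀ K K' : Knot M, K.IsIsotopic K' → v K = v K') {a : Fin n → ℝ}
    (ha : a ∈ Set.Icc (-1 : Fin n → ℝ) 1) (h0 : ∀ c ≠ W.special, a c ≠ 0) :
    knotValue v (G.curve (a, (1, 1))) = knotValue v (G.curve (a, (-1, 1))) := by
  -- The isotopy follows the broken line `(1, 1)`, `(1, 0)`, `(-1, 0)`, `(-1, 1)` around the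
  -- singular parameter `(0, 1)`. On the middle piece `w.2 = 0`, so the curl is a graph and `w.1`
  -- may change its sign.
  have h1 := G.knotValue_eq hv ha h0 (z := fun s => (1, 1 - s)) (by fun_prop) fun s hs =>
    ⟨⟨⟨by norm_num, by simp only [Prod.snd_neg, Prod.snd_one]; linarith [hs.2]⟩,
      ⟨by simp, by simp only [Prod.snd_one]; linarith [hs.1]⟩⟩, by simp⟩
  have h2 := G.knotValue_eq hv ha h0 (z := fun s => (1 - 2 * s, 0)) (by fun_prop) fun s hs =>
    ⟨⟨⟨by simp only [Prod.fst_neg, Prod.fst_one]; linarith [hs.2], by simp⟩,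
      ⟨by simp only [Prod.fst_one]; linarith [hs.1], by simp⟩⟩, by simp⟩
  have h3 := G.knotValue_eq hv ha h0 (z := fun s => (-1, s)) (by fun_prop) fun s hs =>
    ⟨⟨⟨by norm_num, by simp only [Prod.snd_neg, Prod.snd_one]; linarith [hs.1]⟩,
      ⟨by norm_num, by simp only [Prod.snd_one]; linarith [hs.2]⟩⟩, by simp⟩
  norm_num at h1 h2 h3
  rw [h1, h2, h3]

variable {o : ManifoldOrientation M}

/-- The symbol satisfies the one-term relation. -/
theorem symbol_oneTerm [T2Space M] [IsManifold (𝓡 3) ∞ M] {F : Type*} [Field F]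
    {α : ModTwoCocycle M} {v : Knot M → F} (hv : ∀ K K' : Knot M, K.IsIsotopic K' → v K = v K')
    (hgood : IsGood o α v n) {p : Fin n} {D : FramedArcDiagram n} {X : List (Fin n)}
    (hD : D.word = [p, p] ++ X) (hp : D.framing p = 0) : symbol o α v n D.closure = 0 := by
  by_cases hB : ∃ B : ChartedLoop o, B.Realizes α D.framing
  · obtain ⟨B, hB⟩ := hB
    have hcount := D.count_word
    simp only [hD, List.count_append, List.count_cons, List.count_nil] at hcount
    obtain ⟨W, rfl, hW⟩ := exists_slotWord p X
      (by
        have := hcount p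
        simp at this
        simpa using this)
      (by
        intro c hc
        have := hcount c
        simpa [hc.symm] using this)
    obtain ⟨G⟩ := SlotWord.nonempty_family (W := W) (p := W.special) (fr := D.framing)
      B.isSmoothChart B.target_eq B.smooth B.loop_zero B.loop_one isThirdStrand_kink
    rw [G.symbol_closure hgood B hB SlotWord.isCrossing_kink (D := D) (m := 1)
      (Or.inl ⟨by simp, by norm_num⟩)
      (by
        rw [SlotWord.insertedWord_eq (A := [W.special]) (B := X) (by rw [hW, List.ofFn_get]; rfl)
          (by simp), hD]
        rfl)
      (by
        intro c
        -- Both ends of the kink are on slot `0`, whose level `D.framing p` is zero, so the realized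
        -- framing is zero as well.
        rw [W.level_zero, hp, add_zero]
        split_ifs with hc
        · rw [hc, hp]
        · rfl)]
    refine sum_prod_units_mul_eq_zero W.special _ fun ε => ?_
    have hupd : Function.update (fun c => ((Function.update ε W.special (-ε W.special) c : ℤ) : ℝ))
        W.special 0 = Function.update (fun c => ((ε c : ℤ) : ℝ)) W.special 0 := by
      ext c
      by_cases hc : c = W.special
      · subst hc; simp
      · simp [Function.update_of_ne hc]
    rw [hupd, Function.update_self]
    have hunit : ∀ x : ℤˣ, -1 ≤ ((x : ℤ) : ℝ) ∧ ((x : ℤ) : ℝ) ≤ 1 := by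
      intro x
      rcases Int.units_eq_one_or x with h | h <;> simp [h]
    have hkey := G.knotValue_kink hv (a := Function.update (fun c => ((ε c : ℤ) : ℝ)) W.special 0)
      (by
        constructor <;> intro c <;> by_cases hc : c = W.special
        · subst hc; simp
        · simpa [Function.update_of_ne hc] using (hunit (ε c)).1
        · subst hc; simp
        · simpa [Function.update_of_ne hc] using (hunit (ε c)).2)
      (by
        intro c hc
        simp [Function.update_of_ne hc])
    rcases Int.units_eq_one_or (ε W.special) with h1 | h1 <;> simp [h1, hkey]
  · push Not at hB
    exact symbol_closure_eq_zero hB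

end OneTerm

/-! ### Signs of odd chords -/

theorem FramedArcDiagram.neg_one_pow_oddCount {n : ℕ} {F : Type*} [Field F]
    (D : FramedArcDiagram n) :
    (-1 : F) ^ D.closure.oddCount = ∏ c, if D.framing c = 1 then (-1 : F) else 1 := by
  rw [Finset.prod_ite, Finset.prod_const, Finset.prod_const_one, mul_one]
  rfl

/-- Only the framing of `q` differs between the pairs, by the framing of `p`. Since `x ↦ (-1) ^ x`
is multiplicative on `ℤ/2`, the total sign changes by that of `p`. -/
theorem IsFourTermConfiguration.neg_one_pow_oddCount {n : ℕ} {F : Type*} [Field F] {p q : Fin n}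
    {D₁ D₂ D₃ D₄ : FramedArcDiagram n} (h : IsFourTermConfiguration p q D₁ D₂ D₃ D₄) :
    (-1 : F) ^ D₂.closure.oddCount = (-1 : F) ^ D₁.closure.oddCount ∧
    (if D₁.framing p = 0 then (1 : F) else -1) * (-1 : F) ^ D₃.closure.oddCount =
      (-1 : F) ^ D₁.closure.oddCount ∧
    (-1 : F) ^ D₄.closure.oddCount = (-1 : F) ^ D₃.closure.oddCount := by
  obtain ⟨-, h2, h3, h4⟩ := h
  simp only [FramedArcDiagram.neg_one_pow_oddCount]
  refine ⟨by rw [h2], ?_, by rw [h4]⟩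
  rw [← Finset.mul_prod_erase _ _ (Finset.mem_univ q),
    ← Finset.mul_prod_erase _ (fun c => if D₁.framing c = 1 then (-1 : F) else 1)
      (Finset.mem_univ q), ← mul_assoc]
  congr 1
  · rw [h3, Function.update_self]
    have hx : ∀ x : ZMod 2, x = 0 ∨ x = 1 := by decide
    have h11 : (1 : ZMod 2) + 1 = 0 := by decide
    rcases hx (D₁.framing p) with h5 | h5 <;> rcases hx (D₁.framing q) with h6 | h6 <;>
    simp [h5, h6, h11]
  · refine Finset.prod_congr rfl fun c hc => ?_
    rw [h3, Function.update_of_ne (Finset.ne_of_mem_erase hc)]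

end

/-! ### The main theorem -/

theorem mainTheorem1 {M : Type*} [TopologicalSpace M] [T2Space M] [SecondCountableTopology M]
    [ChartedSpace (EuclideanSpace ℝ (Fin 3)) M] [IsManifold (𝓡 3) ∞ M]
    {F : Type*} [Field F]
    (o : ManifoldOrientation M) (α : ModTwoCocycle M)
    (v : Knot M → F) (n : ℕ)
    (hv : IsVassilievInvariant o v n) (hgood : IsGood o α v n) :
    IsFramedWeightSystem (Finsupp.linearCombination F (symbol o α v n)) ∧
    SatisfiesOneTerm (Finsupp.linearCombination F (symbol o α v n)) ∧
    IsFramedWeightSystemStar (Finsupp.linearCombination F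
      (fun D : FramedChordDiagram n => (-1 : F) ^ D.oddCount * symbol o α v n D)) := by
  refine ⟨?_, ?_, ?_⟩
  · rintro r ⟨p, q, D₁, D₂, D₃, D₄, h, rfl⟩
    simpa using symbol_fourTerm hgood h
  · rintro r ⟨D, p, X, hD, hp, rfl⟩
    simpa using symbol_oneTerm hv.1 hgood hD hp
  · rintro r ⟨p, q, D₁, D₂, D₃, D₄, h, rfl⟩
    obtain ⟨h2, h3, h4⟩ := h.neg_one_pow_oddCount (F := F)
    have h5 := symbol_fourTerm hgood h
    simp only [map_add, map_sub, map_smul, Finsupp.linearCombination_single, smul_eq_mul]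
    rw [h2, h4]
    -- The relation for the symbol times the sign of `D₁`; by `h3` the factor in the other version
    -- compensates the different sign of `D₃` and `D₄`.
    linear_combination (-1 : F) ^ D₁.closure.oddCount * h5 +
      (symbol o α v n D₃.closure - symbol o α v n D₄.closure) * h3
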